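/- **Proposition 8.1.** Let $X$ be a compact manifold with boundary, of dimension $n\ge 1$, with a scattering metric $g=\frac{dx^2}{x^4}+\frac{h'}{x^2}$ near $\partial X$, and let $h=h'|_{\partial X}$ be the induced Riemannian metric on the closed manifold $Y=\partial X$; let $\lambda>0$. Everything below depends only on $(Y,h,\lambda)$, and $(Y,h)$ may be any closed Riemannian manifold of dimension $n-1$. Let $\mathrm{bf}=[0,\pi/2]_\theta\times Y\times Y$ be the front face of the b-double space $X^2_{\rm b}=[X^2;(\partial X)^2]$, where $\sigma=\tan\theta=x'/x''$ and $x',x''$ are the lifts of the boundary defining function $x$ of $X$ from the left and right factor. A point of the rescaled cotangent bundle of $X^2_{\rm b}$ over $(\theta,y',y'')\in\mathrm{bf}$ is written $$\tau'\frac{dx'}{x'^2}+\mu'\cdot\frac{dy'}{x'}+\tau''\frac{dx''}{x''^2}+\mu''\cdot\frac{dy''}{x''},\qquad \tau',\tau''\in\mathbb R,\ \mu'\in T^*_{y'}Y,\ \mu''\in T^*_{y''}Y,$$ and we put $\tau=\tau'\cos\theta+\tau''\sin\theta$. Let $\exp(sH_{\frac12 h})$ be the flow on $T^*Y$ of the Hamilton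 vector field of $\frac12|\mu|_h^2$, and write $c\,(y,\mu)=(y,c\mu)$. Let $L=L(\lambda)$ be the union of the set of all $(\theta,y',y'',\tau',\tau'',\mu',\mu'')$ for which there are $(y,\hat\mu)\in S^*Y$ and $s,s'\in[0,\pi]$ with $\sin^2 s+\sin^2 s'>0$ and $$\tan\theta=\frac{\sin s'}{\sin s},\quad \tau'=\lambda\cos s',\quad \tau''=-\lambda\cos s,$$ $$(y',\mu')=\lambda\sin s'\,\exp(s'H_{\frac12h})(y,\hat\mu),\quad (y'',\mu'')=-\lambda\sin s\,\exp(sH_{\frac12h})(y,\hat\mu)$$ (with $\theta=\pi/2$ if $\sin s=0$), and of the two sets $\{(\theta,y,y,\pm\lambda,\mp\lambda,0,0):\theta\in[0,\pi/2],\ y\in Y\}$. Let ${}^{\rm sc}N^*\Delta_{\rm b}$ be the boundary, over $\mathrm{bf}$, of the closure of the conormal bundle of the diagonal of the interior of $X^2$; explicitly, ${}^{\rm sc}N^*\Delta_{\rm b}=\{\sigma=1,\ y'=y'',\ \mu'=-\mu'',\ \tau=0\}$. Then: 1. Over the interior $\{0<\theta<\pi/2\}$ of $\mathrm{bf}$,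 $L$ is a smooth embedded submanifold of dimension $2n-1$. The intersection $L\cap{}^{\rm sc}N^*\Delta_{\rm b}$ lies over this interior and is a smooth embedded submanifold of dimension $2n-2$, i.e. of codimension one in $L$. 2. At every point of $L$ where $\tau=0$, the differential of $\tau|_L$ does not vanish. 3. $L\cap\{\tau=0\}=L\cap{}^{\rm sc}N^*\Delta_{\rm b}$. Hence $L\setminus{}^{\rm sc}N^*\Delta_{\rm b}$ is the disjoint union of $L_+=L\cap\{\tau<0\}$ and $L_-=L\cap\{\tau>0\}$. -/

import Mathlib

open Bundle Set Filter
open scoped Manifold ContDiff Topology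

noncomputable section

namespace ScatteringResolvent

/-- The model vector space of a `d`-dimensional manifold. -/
abbrev Model (d : ℕ) : Type := EuclideanSpace ℝ (Fin d)

/-- The model vector space of covectors. -/
abbrev CoModel (d : ℕ) : Type := Model d →L[ℝ] ℝ

section Cotangent

variable (d : ℕ) (Y : Type*) [TopologicalSpace Y] [ChartedSpace (Model d) Y]
  [IsManifold (𝓡 d) ∞ Y]

/-- The fibre `T*_y Y`. -/
abbrev CotangentFibre (y : Y) : Type _ :=
  TangentSpace (𝓡 d) y →L[ℝ] Bundle.Trivial Y ℝ y

/-- The cotangent bundle `T*Y`, with Mathlib's smooth structure on bundles of linear maps. -/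
abbrev Cotangent : Type _ :=
  TotalSpace (CoModel d) (CotangentFibre d Y)

/-- The model with corners of `T*Y`. -/
abbrev cotModel : ModelWithCorners ℝ (Model d × CoModel d) (ModelProd (Model d) (CoModel d)) :=
  (𝓡 d).prod 𝓘(ℝ, CoModel d)

/-- A smooth Riemannian metric on `Y`. -/
abbrev SmoothMetric : Type _ :=
  ContMDiffRiemannianMetric (𝓡 d) ∞ (Model d) (fun y : Y => TangentSpace (𝓡 d) y)

end Cotangent

section Flow

variable {d : ℕ} {Y : Type*} [TopologicalSpace Y] [ChartedSpace (Model d) Y]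
  [IsManifold (𝓡 d) ∞ Y]

/-- The squared dual norm `|μ|²_h` of a covector: if `μ = h(v, ·)` then `|μ|² = μ(v) = h(v, v)`.
The map `v ↦ h(v, ·)` is invertible, since `h` is positive definite and `Y` is
finite-dimensional. -/
def dualNormSq (h : SmoothMetric d Y) (p : Cotangent d Y) : ℝ :=
  p.snd ((h.inner p.proj).inverse p.snd)

/-- The Hamiltonian `½ |μ|²_h` on `T*Y`, whose flow is the (co)geodesic flow. -/
def kineticEnergy (h : SmoothMetric d Y) (p : Cotangent d Y) : ℝ :=
  (1 / 2) * dualNormSq h p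

/-- The canonical symplectic form of `T*Y` at `p`. The tangent space of `T*Y` at `p` is
represented in the chart of `T*Y` at `p`, i.e. in the canonical coordinates `(y, ξ)` induced by the
chart of `Y` at the base point; a vector is a pair `(δy, δξ)`, and the form is
`ω((δy, δξ), (δy', δξ')) = δξ'(δy) - δξ(δy')`. -/
def symplecticForm (p : Cotangent d Y) (v w : TangentSpace (cotModel d) p) : ℝ :=
  let v' : Model d × CoModel d := v
  let w' : Model d × CoModel d := w
  w'.2 v'.1 - v'.2 w'.1

/-- `V` is the Hamilton vector field of `f`: `ω(V, ·) = df`, that is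
`V = (∂f/∂ξ) ∂_y - (∂f/∂y) ∂_ξ` in canonical coordinates. -/
def IsHamiltonField (f : Cotangent d Y → ℝ)
    (V : (p : Cotangent d Y) → TangentSpace (cotModel d) p) : Prop :=
  ∀ (p : Cotangent d Y) (w : TangentSpace (cotModel d) p),
    mfderiv (cotModel d) 𝓘(ℝ, ℝ) f p w = symplecticForm p (V p) w

/-- `γ` is a complete integral curve of the Hamilton vector field of `½ |μ|²_h`, that is
`γ t = exp (t H_{½h}) (γ 0)` for all `t`. -/
def IsBicharacteristic (h : SmoothMetric d Y) (γ : ℝ → Cotangent d Y) : Prop :=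
  ∃ V : (p : Cotangent d Y) → TangentSpace (cotModel d) p,
    IsHamiltonField (kineticEnergy h) V ∧ IsMIntegralCurve (I := cotModel d) γ V

/-- Multiplication by `c` in the fibres of `T*Y`: `c (y, μ) = (y, c μ)`. -/
def fibreSmul (c : ℝ) (p : Cotangent d Y) : Cotangent d Y :=
  ⟨p.proj, c • p.snd⟩

end Flow

section PhaseSpace

variable (d : ℕ) (Y : Type*) [TopologicalSpace Y] [ChartedSpace (Model d) Y]
  [IsManifold (𝓡 d) ∞ Y]

/-- The scattering cotangent bundle over the boundary `Y = ∂X`: the point `(τ, (y, μ))` is the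
covector `τ dx/x² + μ · dy/x` at `y`. -/
abbrev ScCotangent : Type _ := ℝ × Cotangent d Y

/-- The rescaled cotangent bundle of the b-double space over the front face `bf`, the pull-back of
the scattering cotangent bundle from the two factors. The front face is `[0, π/2] × Y × Y`, with
first coordinate `θ`, `tan θ = x'/x''`. The point `(θ, (τ', (y', μ')), (τ'', (y'', μ'')))` is the
covector `τ' dx'/x'² + μ' · dy'/x' + τ'' dx''/x''² + μ'' · dy''/x''` at `(θ, y', y'')`. We let `θ`
range over `ℝ` in the type, and restrict it in the sets below. -/
abbrev PhaseSpace : Type _ := ℝ × ScCotangent d Y × ScCotangent d Y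

/-- The model vector space of `PhaseSpace`; its dimension is `4 d + 3`. -/
abbrev PhaseModel : Type :=
  ℝ × (ℝ × (Model d × CoModel d)) × (ℝ × (Model d × CoModel d))

/-- The model with corners of `PhaseSpace`, the product of those of its factors. -/
abbrev phaseModel : ModelWithCorners ℝ (PhaseModel d)
    (ModelProd ℝ (ModelProd (ModelProd ℝ (ModelProd (Model d) (CoModel d)))
      (ModelProd ℝ (ModelProd (Model d) (CoModel d))))) :=
  𝓘(ℝ, ℝ).prod ((𝓘(ℝ, ℝ).prod (cotModel d)).prod (𝓘(ℝ, ℝ).prod (cotModel d)))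

variable {d Y}

/-- The function `τ = τ' cos θ + τ'' sin θ`, the coefficient of `dx/x²`, where
`x⁻² = x'⁻² + x''⁻²`. -/
def tau (q : PhaseSpace d Y) : ℝ :=
  q.2.1.1 * Real.cos q.1 + q.2.2.1 * Real.sin q.1

/-- The part of `L(lam)` swept out by bicharacteristics. The curve `γ` is the bicharacteristic
through `(y, μ̂) ∈ S*Y`, so `γ s = exp (s H_{½h}) (y, μ̂)`; the condition `tan θ = sin s' / sin s`
is cleared of denominators, so that `sin s = 0` gives `θ = π/2`. -/
def flowPart (h : SmoothMetric d Y) (lam : ℝ) : Set (PhaseSpace d Y) :=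
  {q | q.1 ∈ Icc 0 (Real.pi / 2) ∧
    ∃ (γ : ℝ → Cotangent d Y) (s s' : ℝ),
      IsBicharacteristic h γ ∧ dualNormSq h (γ 0) = 1 ∧
      s ∈ Icc 0 Real.pi ∧ s' ∈ Icc 0 Real.pi ∧ 0 < Real.sin s ^ 2 + Real.sin s' ^ 2 ∧
      Real.sin q.1 * Real.sin s = Real.cos q.1 * Real.sin s' ∧
      q.2.1 = (lam * Real.cos s', fibreSmul (lam * Real.sin s') (γ s')) ∧
      q.2.2 = (-lam * Real.cos s, fibreSmul (-lam * Real.sin s) (γ s))}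

/-- The set `{(θ, y, y, c, -c, 0, 0) : θ ∈ [0, π/2], y ∈ Y}`. -/
def diagonalPart (c : ℝ) : Set (PhaseSpace d Y) :=
  {q | q.1 ∈ Icc 0 (Real.pi / 2) ∧
    ∃ y : Y, q.2.1 = (c, (⟨y, 0⟩ : Cotangent d Y)) ∧ q.2.2 = (-c, (⟨y, 0⟩ : Cotangent d Y))}

/-- The Legendrian `L = L(lam)`. -/
def Leg (h : SmoothMetric d Y) (lam : ℝ) : Set (PhaseSpace d Y) :=
  flowPart h lam ∪ diagonalPart lam ∪ diagonalPart (-lam)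

/-- The value of the covector `τ dx/x² + μ · dy/x` at `(x, y)` on the tangent vector
`a ∂_x + v`. -/
def scPairing (x : ℝ) (α : ScCotangent d Y) (a : ℝ) (v : TangentSpace (𝓡 d) α.2.proj) : ℝ :=
  α.1 * (a / x ^ 2) + α.2.snd v / x

/-- The conormal bundle of the diagonal of `X × X` in a collar `(0, ∞)_x × Y` of the boundary, in the
coordinates `(x, q)` on the rescaled cotangent bundle near the interior of `bf`. The left and right
boundary defining functions are `x' = x / cos θ` and `x'' = x / sin θ`; the base point lies on the
diagonal if `x' = x''` and `y' = y''`, and the covector is conormal if it annihilates all vectors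
`(w, w)`, `w = a ∂_x + v`. -/
def conormalDiag : Set (ℝ × PhaseSpace d Y) :=
  {r | 0 < r.1 ∧ r.2.1 ∈ Ioo 0 (Real.pi / 2) ∧
    r.1 / Real.cos r.2.1 = r.1 / Real.sin r.2.1 ∧
    ∃ (y : Y) (t' t'' : ℝ) (μ' μ'' : CotangentFibre d Y y),
      r.2.2.1 = (t', (⟨y, μ'⟩ : Cotangent d Y)) ∧ r.2.2.2 = (t'', (⟨y, μ''⟩ : Cotangent d Y)) ∧
      ∀ (a : ℝ) (v : TangentSpace (𝓡 d) y),
        scPairing (r.1 / Real.cos r.2.1) (t', (⟨y, μ'⟩ : Cotangent d Y)) a v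
          + scPairing (r.1 / Real.sin r.2.1) (t'', (⟨y, μ''⟩ : Cotangent d Y)) a v = 0}

variable (d Y) in
/-- The boundary at `x = 0` of the closure of the conormal bundle of the diagonal. -/
def scConormalDiag : Set (PhaseSpace d Y) :=
  {q | ((0 : ℝ), q) ∈ closure (conormalDiag (d := d) (Y := Y))}

end PhaseSpace

section Submanifold

variable {E : Type*} [NormedAddCommGroup E] [NormedSpace ℝ E] {H : Type*} [TopologicalSpace H]
  (I : ModelWithCorners ℝ E H) {M : Type*} [TopologicalSpace M] [ChartedSpace H M]

/-- Near `p`, the set `S` is a smooth embedded submanifold of codimension `c`: it is the zero set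
of a smooth submersion to `ℝᶜ`. -/
def IsSubmanifoldAt (c : ℕ) (S : Set M) (p : M) : Prop :=
  ∃ U : Set M, IsOpen U ∧ p ∈ U ∧ ∃ F : M → EuclideanSpace ℝ (Fin c),
    ContMDiffOn I 𝓘(ℝ, EuclideanSpace ℝ (Fin c)) ∞ F U ∧
    (∀ q ∈ U, Function.Surjective (mfderiv I 𝓘(ℝ, EuclideanSpace ℝ (Fin c)) F q)) ∧
    S ∩ U = {q ∈ U | F q = 0}

/-- The vectors tangent to `S` at `p`: velocities at `p` of smooth curves that lie in `S`. -/
def tangentVectors (S : Set M) (p : M) : Set (TangentSpace I p) :=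
  {v | ∃ γ : ℝ → M, ContMDiffAt 𝓘(ℝ, ℝ) I ∞ γ 0 ∧ (∀ᶠ t in 𝓝 0, γ t ∈ S) ∧
    (⟨γ 0, mfderiv 𝓘(ℝ, ℝ) I γ 0 (1 : ℝ)⟩ : TangentBundle I M) = ⟨p, v⟩}

end Submanifold

end ScatteringResolvent

end

open Bundle Set Filter
open scoped Manifold ContDiff Topology

noncomputable section

namespace ScatteringResolvent

/-! With `d = n - 1` the phase space has dimension `4d + 3`, so `L` must be cut out by `2d + 2`
independent equations. The parameters `(y, μ̂, s, s')` can be eliminated. The left covector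
determines `s'` through `τ' = λ cos s'`, and the point of the bicharacteristic at time `s'` is
`μ'/(λ sin s')`. Flowing for time `s - s'` and scaling by `-λ sin s` gives `μ''`. Hence `L` is
locally described by two equations between the scalars `(θ, τ', |μ'|², τ'')`, together with a
formula for the right covector as a scaled, flowed left covector, which accounts for the other `2d`
equations (`isSubmanifoldAt_of_graph`, `isSubmanifoldAt_of_scalars`). Away from `μ' = 0` the scalar
equations are `τ'² + |μ'|² = λ²` and `tan θ = sin s'/sin s` (`isSubmanifoldAt_of_mem_flowPart`).

At the radial points `μ' = 0` these formulas degenerate, because they divide by `sin s'`.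
Homogeneity of the flow (`geodesicFlow_fibreSmul`) rewrites the formula as `μ'' = -κ exp(T H) μ'`
with `κ = cot θ = sin s/sin s'` and `T = (s - s')/(λ sin s')`. Here `s` and `s'` approach the same
end of `[0, π]`. Since `arcsin x = x a(x²)` with `a` smooth (`exists_arcsin_eq_mul`), `T` is a
smooth function of `θ` and `|μ'|²`. The zero section is fixed by the flow, so the same equations
also describe the two diagonal sets (`isSubmanifoldAt_of_mem_diagonalPart`).

On the flow part, `τ = 0` reads `cos θ cos s' = sin θ cos s`. Together with `sin θ sin s = cos θ sin
s'` it forces `θ = π/4` and `s = s'`, which gives `τ'' = -τ'`, `μ'' = -μ'`. So `L ∩ {τ = 0}` is the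
graph of fibrewise negation over `τ'² + |μ'|² = λ²` (`mem_Leg_and_tau_eq_zero_iff`). The
differential of `τ` is tested on explicit curves in `L`: `s` varies with `s'` fixed, or `θ` alone
varies on the diagonal sets.

All this needs the cogeodesic flow to be complete and smooth. Smooth dependence on initial values
comes from the implicit function theorem in `C([0,1], E)`. Completeness comes from conservation of
energy and compactness of the energy sublevels. -/

/-! ### The superposition operator on spaces of continuous maps -/

section Superposition

universe u

set_option synthInstance.maxHeartbeats 200000
set_option linter.unusedSectionVars false

variable {K : Type*} [TopologicalSpace K] [CompactSpace K]
  {E F : Type u} [NormedAddCommGroup E] [NormedSpace ℝ E] [NormedAddCommGroup F] [NormedSpace ℝ F]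

/-- The superposition operator `γ ↦ f ∘ γ`. -/
def superpose (f : E → F) (hf : Continuous f) (γ : C(K, E)) : C(K, F) :=
  ContinuousMap.comp ⟨f, hf⟩ γ

@[simp] lemma superpose_apply (f : E → F) (hf : Continuous f) (γ : C(K, E)) (t : K) :
    superpose f hf γ t = f (γ t) := rfl

lemma continuous_superpose (f : E → F) (hf : Continuous f) :
    Continuous (superpose (K := K) f hf) :=
  ContinuousMap.continuous_postcomp _

variable (K E F) in
/-- Pointwise application of a continuous family of linear maps to a continuous map. -/
def pointwiseApply : C(K, E →L[ℝ] F) →L[ℝ] C(K, E) →L[ℝ] C(K, F) :=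
  LinearMap.mkContinuous₂
    (LinearMap.mk₂ ℝ (fun (A : C(K, E →L[ℝ] F)) (γ : C(K, E)) =>
        (⟨fun t => A t (γ t), by fun_prop⟩ : C(K, F)))
      (fun A B γ => by ext t; simp) (fun c A γ => by ext t; simp)
      (fun A γ δ => by ext t; simp) (fun c A γ => by ext t; simp)) 1
    (fun A γ => by
      rw [one_mul, ContinuousMap.norm_le _ (by positivity)]
      intro t
      exact (A t).le_opNorm_of_le (γ.norm_coe_le_norm t) |>.trans
        (mul_le_mul_of_nonneg_right (A.norm_coe_le_norm t) (norm_nonneg _)))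

@[simp] lemma pointwiseApply_apply (A : C(K, E →L[ℝ] F)) (γ : C(K, E)) (t : K) :
    pointwiseApply K E F A γ t = A t (γ t) := rfl

/-- The mean value inequality is applied at each `t`. The bound is uniform in `t` because `γ ↦ f' ∘
γ` is continuous for the sup norm. -/
lemma hasFDerivAt_superpose (f : E → F) (hf : ContDiff ℝ 1 f) (γ : C(K, E)) :
    HasFDerivAt (superpose (K := K) f hf.continuous)
      (pointwiseApply K E F (superpose (fderiv ℝ f) (hf.continuous_fderiv one_ne_zero) γ)) γ := by
  rw [hasFDerivAt_iff_isLittleO_nhds_zero, Asymptotics.isLittleO_iff]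
  intro c hc
  have hcont := (continuous_superpose (K := K) (fderiv ℝ f)
    (hf.continuous_fderiv one_ne_zero)).continuousAt (x := γ)
  obtain ⟨δ, hδ, hball⟩ := Metric.continuousAt_iff.mp hcont c hc
  filter_upwards [Metric.ball_mem_nhds (0 : C(K, E)) hδ] with η hη
  rw [ContinuousMap.norm_le _ (by positivity)]
  intro t
  have hη' : ‖η‖ < δ := by simpa using hη
  -- A point of this segment is the value at `t` of `γ + a • η`, which lies within `δ` of `γ`.
  have key : ∀ z ∈ segment ℝ (γ t) (γ t + η t), ‖fderiv ℝ f z - fderiv ℝ f (γ t)‖ ≤ c := by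
    intro z hz
    rw [segment_eq_image'] at hz
    obtain ⟨a, ha, rfl⟩ := hz
    have h1 : dist (γ + a • η) γ < δ := by
      rw [dist_eq_norm, add_sub_cancel_left, norm_smul, Real.norm_of_nonneg ha.1]
      nlinarith [norm_nonneg η, ha.2]
    have h2 := (ContinuousMap.dist_apply_le_dist t).trans_lt (hball h1)
    rw [dist_eq_norm] at h2
    simpa using h2.le
  have := Convex.norm_image_sub_le_of_norm_hasFDerivWithin_le' (𝕜 := ℝ) (f := f)
    (fun z _ => ((hf.differentiable one_ne_zero z).hasFDerivAt).hasFDerivWithinAt) key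
    (convex_segment _ _) (left_mem_segment ℝ _ _) (right_mem_segment ℝ _ _)
  simp only [add_sub_cancel_left] at this
  exact this.trans (mul_le_mul_of_nonneg_left (η.norm_coe_le_norm t) hc.le)

/-- The derivative is pointwise application of the superposition operator of `f'`, so induction
applies. The target `F` is quantified inside, since `f'` takes values in `E →L[ℝ] F`. -/
lemma contDiff_nat_superpose (n : ℕ) : ∀ {F : Type u} [NormedAddCommGroup F] [NormedSpace ℝ F]
    (f : E → F) (hf : ContDiff ℝ n f), ContDiff ℝ n (superpose (K := K) f hf.continuous) := by
  induction n with
  | zero =>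
    intro F _ _ f hf
    exact contDiff_zero.mpr (continuous_superpose f hf.continuous)
  | succ n ih =>
    intro F _ _ f hf
    have hf1 : ContDiff ℝ 1 f := hf.of_le (by exact_mod_cast Nat.le_add_left 1 n)
    have hf' : ContDiff ℝ n (fderiv ℝ f) := hf.fderiv_right (by norm_cast)
    have hB : ContDiff ℝ n fun A => pointwiseApply K E F A :=
      ContinuousLinearMap.contDiff _
    exact contDiff_succ_iff_hasFDerivAt.mpr
      ⟨fun γ => pointwiseApply K E F (superpose (fderiv ℝ f) hf'.continuous γ),
        hB.comp (ih (fderiv ℝ f) hf'), fun γ => hasFDerivAt_superpose f hf1 γ⟩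

lemma contDiff_superpose (f : E → F) (hf : ContDiff ℝ ∞ f) :
    ContDiff ℝ ∞ (superpose (K := K) f hf.continuous) :=
  contDiff_infty.mpr fun n =>
    contDiff_nat_superpose n f (hf.of_le (mod_cast le_top))

end Superposition

/-- A map that is smooth near a point agrees near that point with a smooth map. -/
lemma exists_contDiff_eventuallyEq {E F : Type*} [NormedAddCommGroup E] [NormedSpace ℝ E]
    [FiniteDimensional ℝ E] [NormedAddCommGroup F] [NormedSpace ℝ F] {f : E → F} {U : Set E}
    {x : E} (hU : U ∈ 𝓝 x) (hf : ContDiffOn ℝ ∞ f U) :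
    ∃ g : E → F, ContDiff ℝ ∞ g ∧ g =ᶠ[𝓝 x] f := by
  obtain ⟨r, hr, hrU⟩ := Metric.mem_nhds_iff.mp hU
  let b : ContDiffBump x := ⟨r / 3, r / 2, by positivity, by linarith⟩
  refine ⟨fun z => b z • f z, contDiff_iff_contDiffAt.mpr fun z => ?_, ?_⟩
  · by_cases hz : z ∈ Metric.ball x r
    · exact b.contDiff.contDiffAt.smul
        ((hf.mono hrU).contDiffAt (Metric.isOpen_ball.mem_nhds hz))
    · have hmem : {w | r / 2 < dist w x} ∈ 𝓝 z := by
        refine (isOpen_lt continuous_const (by fun_prop)).mem_nhds ?_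
        have : r ≤ dist z x := by simpa using hz
        simp only [mem_ofPred_eq]; linarith
      refine (contDiffAt_const (c := (0 : F))).congr_of_eventuallyEq ?_
      filter_upwards [hmem] with w hw
      rw [b.zero_of_le_dist (le_of_lt hw), zero_smul]
  · filter_upwards [b.eventuallyEq_one] with z hz
    simp [hz]

/-! ### Smooth dependence of solutions of an ordinary differential equation on initial values -/

section LocalFlow

set_option linter.unusedSectionVars false

variable {E : Type*} [NormedAddCommGroup E] [NormedSpace ℝ E] [CompleteSpace E]

variable (E) in
/-- The primitive vanishing at `0` of a continuous map on the unit interval. -/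
def primitive : C(unitInterval, E) →L[ℝ] C(unitInterval, E) :=
  LinearMap.mkContinuous
    { toFun := fun γ => ⟨fun s => ∫ u in (0 : ℝ)..s, γ (projIcc 0 1 zero_le_one u), by
        have : Continuous fun s : ℝ => ∫ u in (0 : ℝ)..s, γ (projIcc 0 1 zero_le_one u) :=
          intervalIntegral.continuous_primitive
            (fun a b => ((γ.continuous.comp continuous_projIcc).intervalIntegrable a b)) 0
        exact this.comp continuous_subtype_val⟩
      map_add' := fun γ δ => by
        ext s
        exact intervalIntegral.integral_add
          ((γ.continuous.comp continuous_projIcc).intervalIntegrable _ _)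
          ((δ.continuous.comp continuous_projIcc).intervalIntegrable _ _)
      map_smul' := fun c γ => by
        ext s
        exact intervalIntegral.integral_smul c _ } 1
    (fun γ => by
      rw [one_mul, ContinuousMap.norm_le _ (norm_nonneg _)]
      intro s
      have := intervalIntegral.norm_integral_le_of_norm_le_const (a := 0) (b := (s : ℝ))
        (f := fun u => γ (projIcc 0 1 zero_le_one u)) (C := ‖γ‖)
        (fun u _ => γ.norm_coe_le_norm _)
      refine this.trans ?_
      rw [sub_zero, abs_of_nonneg s.2.1]
      nlinarith [norm_nonneg γ, s.2.2])

lemma primitive_apply (γ : C(unitInterval, E)) (s : unitInterval) :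
    primitive E γ s = ∫ u in (0 : ℝ)..s, γ (projIcc 0 1 zero_le_one u) := rfl

/-- The defect of `γ` as a solution on `[0, 1]` of `γ' = ε v(γ)`, `γ(0) = x`. -/
def picardDefect (v : E → E) (hv : Continuous v)
    (w : (E × ℝ) × C(unitInterval, E)) : C(unitInterval, E) :=
  w.2 - ContinuousMap.const _ w.1.1 - w.1.2 • primitive E (superpose v hv w.2)

lemma contDiff_picardDefect (v : E → E) (hv : ContDiff ℝ ∞ v) :
    ContDiff ℝ ∞ (picardDefect v hv.continuous) := by
  have h1 : ContDiff ℝ ∞ fun w : (E × ℝ) × C(unitInterval, E) =>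
      ContinuousMap.const unitInterval w.1.1 :=
    (ContinuousLinearMap.const (R := ℝ) (M := E) unitInterval).contDiff.comp (contDiff_fst.comp contDiff_fst)
  have h2 : ContDiff ℝ ∞ fun w : (E × ℝ) × C(unitInterval, E) =>
      primitive E (superpose v hv.continuous w.2) :=
    (primitive E).contDiff.comp ((contDiff_superpose v hv).comp contDiff_snd)
  exact (contDiff_snd.sub h1).sub ((contDiff_snd.comp contDiff_fst).smul h2)

/-- A smooth vector field on a Banach space has a smooth local flow. -/
theorem exists_smooth_localFlow (v : E → E) (hv : ContDiff ℝ ∞ v) (x₀ : E) :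
    ∃ α : E × ℝ → E, ContDiffAt ℝ ∞ α (x₀, 0) ∧ ∃ r > 0, ∃ ε > 0, ∀ x ∈ Metric.ball x₀ r,
      α (x, 0) = x ∧ ∀ t ∈ Ioo (-ε) ε, HasDerivAt (fun t => α (x, t)) (v (α (x, t))) t := by
  -- Picard–Lindelöf supplies a flow that is only known to be jointly continuous. It is then
  -- identified near `(x₀, 0)` with a smooth implicit function.
  obtain ⟨ε, hε, a, r, L, K, hr, hP⟩ :=
    IsPicardLindelof.of_contDiffAt_one ((hv.of_le (mod_cast le_top)).contDiffAt (x := x₀))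
  obtain ⟨α, hα, hαc⟩ := (hP 0).exists_forall_mem_closedBall_eq_hasDerivWithinAt_continuousOn
  simp only [zero_sub, zero_add] at hα hαc
  have hr' : (0 : ℝ) < r := hr
  have hder : ∀ x ∈ Metric.ball x₀ r, ∀ t ∈ Ioo (-ε) ε,
      HasDerivAt (fun t => α (x, t)) (v (α (x, t))) t := fun x hx t ht =>
    ((hα x (Metric.ball_subset_closedBall hx)).2 t (Ioo_subset_Icc_self ht)).hasDerivAt
      (Icc_mem_nhds ht.1 ht.2)
  refine ⟨α, ?_, r, hr, ε, hε, fun x hx =>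
    ⟨(hα x (Metric.ball_subset_closedBall hx)).1, hder x hx⟩⟩
  -- the implicit function solving the integral equation
  set u : (E × ℝ) × C(unitInterval, E) := ((x₀, 0), ContinuousMap.const _ x₀) with hu
  have hG := (contDiff_picardDefect v hv).contDiffAt (x := u)
  have hG0 : picardDefect v hv.continuous u = 0 := by simp [picardDefect, hu]
  -- At time parameter `0` the integral term drops out, so the partial derivative in the curve
  -- variable is the identity.
  have hinr : fderiv ℝ (picardDefect v hv.continuous) u ∘L
      .inr ℝ (E × ℝ) C(unitInterval, E) = ContinuousLinearMap.id ℝ _ := by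
    have h1 := (hG.differentiableAt (by simp)).hasFDerivAt.comp (u.2)
      (hasFDerivAt_prodMk_right (𝕜 := ℝ) u.1 u.2)
    have h2 : HasFDerivAt (picardDefect v hv.continuous ∘ fun y => (u.1, y))
        (ContinuousLinearMap.id ℝ C(unitInterval, E)) u.2 := by
      have : (picardDefect v hv.continuous ∘ fun y => (u.1, y)) =
          fun y => y - ContinuousMap.const _ x₀ := by
        ext y; simp [picardDefect, hu]
      rw [this]
      exact (hasFDerivAt_id _).sub_const _
    exact h1.unique h2
  have hinv : (fderiv ℝ (picardDefect v hv.continuous) u ∘L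
      .inr ℝ (E × ℝ) C(unitInterval, E)).IsInvertible := by
    rw [hinr]; exact ⟨.refl ℝ _, rfl⟩
  set ψ := hG.implicitFunction (by simp) hinv with hψ
  have hψs : ContDiffAt ℝ ∞ ψ (x₀, 0) := hG.contDiffAt_implicitFunction (by simp) hinv
  have hψe := hG.eventually_apply_eq_iff_implicitFunction (by simp) hinv
  rw [hG0] at hψe
  have heval : ContDiffAt ℝ ∞ (fun p => ψ p 1) (x₀, (0 : ℝ)) :=
    (ContinuousMap.evalCLM ℝ (1 : unitInterval) : C(unitInterval, E) →L[ℝ] E).contDiff.contDiffAt.comp _ hψs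
  refine heval.congr_of_eventuallyEq ?_
  rw [Metric.eventually_nhds_iff] at hψe
  obtain ⟨δ, hδ, hψe⟩ := hψe
  have hαat : ContinuousAt α (x₀, 0) := hαc.continuousAt
    (prod_mem_nhds (Metric.closedBall_mem_nhds _ hr') (Icc_mem_nhds (by linarith) hε))
  have hα0 : α (x₀, 0) = x₀ := (hα x₀ (Metric.mem_closedBall_self hr'.le)).1
  -- Continuity of `α` keeps the whole curve close to the constant `x₀`, where the implicit function
  -- is the only solution.
  obtain ⟨η, hη, hαη⟩ := Metric.continuousAt_iff.mp hαat (δ / 2) (by positivity)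
  have hm : Metric.ball (x₀, (0 : ℝ)) (min (min η δ) (min r ε)) ∈ 𝓝 (x₀, (0 : ℝ)) :=
    Metric.ball_mem_nhds _ (by positivity)
  filter_upwards [hm] with p hp
  obtain ⟨x, t⟩ := p
  simp only [Metric.mem_ball, Prod.dist_eq, max_lt_iff, lt_min_iff, Real.dist_eq, sub_zero] at hp
  obtain ⟨⟨⟨hxη, htη⟩, hxδ, htδ⟩, ⟨hxr, -⟩, -, htε⟩ := hp
  have hscale : ∀ s ∈ Icc (0 : ℝ) 1, |t * s| ≤ |t| := fun s hs => by
    rw [abs_mul, abs_of_nonneg hs.1]; nlinarith [abs_nonneg t, hs.2]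
  -- Rescaling time puts all curves on `[0, 1]`: `s ↦ α (x, t s)` solves `γ' = t v(γ)`, and its
  -- endpoint is `α (x, t)`.
  have hd : ∀ s ∈ Icc (0 : ℝ) 1,
      HasDerivAt (fun s => α (x, t * s)) (t • v (α (x, t * s))) s := fun s hs => by
    have h1 := hder x hxr (t * s) (abs_lt.mp ((hscale s hs).trans_lt htε))
    have h2 : HasDerivAt (fun s : ℝ => t * s) t s := by simpa using (hasDerivAt_id s).const_mul t
    exact h1.scomp s h2
  have hcs : ContinuousOn (fun s => α (x, t * s)) (Icc 0 1) := fun s hs =>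
    (hd s hs).continuousAt.continuousWithinAt
  let γ : C(unitInterval, E) := ⟨fun s => α (x, t * s), hcs.domRestrict⟩
  have hγ : picardDefect v hv.continuous ((x, t), γ) = 0 := by
    ext s
    have hint : ∫ u in (0 : ℝ)..s, t • v (α (x, t * u)) = α (x, t * s) - α (x, t * 0) := by
      have hsub : uIcc (0 : ℝ) s ⊆ Icc 0 1 := by
        rw [uIcc_of_le s.2.1]; exact Icc_subset_Icc_right s.2.2
      refine intervalIntegral.integral_eq_sub_of_hasDerivAt (fun z hz => hd z (hsub hz)) ?_
      exact (continuousOn_const.smul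
        (hv.continuous.comp_continuousOn (hcs.mono hsub))).intervalIntegrable
    have hcongr : ∫ u in (0 : ℝ)..s, v (γ (projIcc 0 1 zero_le_one u)) =
        ∫ u in (0 : ℝ)..s, v (α (x, t * u)) := by
      refine intervalIntegral.integral_congr fun z hz => ?_
      rw [uIcc_of_le s.2.1] at hz
      have : z ∈ Icc (0 : ℝ) 1 := ⟨hz.1, hz.2.trans s.2.2⟩
      simp only [projIcc_of_mem zero_le_one this]
      rfl
    rw [intervalIntegral.integral_smul, mul_zero, (hα x hxr.le).1] at hint
    simp only [picardDefect, ContinuousMap.sub_apply, ContinuousMap.const_apply,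
      ContinuousMap.smul_apply, primitive_apply, superpose_apply, hcongr, hint]
    change α (x, t * s) - x - (α (x, t * s) - x) = 0
    rw [sub_self]
  have hdist : dist ((x, t), γ) u < δ := by
    have h1 : dist γ (ContinuousMap.const _ x₀) < δ := by
      refine lt_of_le_of_lt ((ContinuousMap.dist_le (by positivity)).mpr fun s => ?_)
        (half_lt_self hδ)
      have := hαη (x := (x, t * s)) (by
        simp only [Prod.dist_eq, max_lt_iff, Real.dist_eq, sub_zero]
        exact ⟨hxη, (hscale s s.2).trans_lt htη⟩)
      rw [hα0] at this
      exact this.le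
    simp only [hu, Prod.dist_eq, max_lt_iff, Real.dist_eq, sub_zero]
    exact ⟨⟨hxδ, htδ⟩, h1⟩
  have := (hψe hdist).mp hγ
  change α (x, t) = ψ (x, t) 1
  rw [show ψ (x, t) = γ from this]
  change α (x, t) = α (x, t * (1 : ℝ))
  rw [mul_one]

end LocalFlow

/-! ### Smooth flows on manifolds -/

section ManifoldFlow

set_option linter.unusedSectionVars false

variable {E : Type*} [NormedAddCommGroup E] [NormedSpace ℝ E]
  {H : Type*} [TopologicalSpace H] {I : ModelWithCorners ℝ E H} [I.Boundaryless]
  {M : Type*} [TopologicalSpace M] [ChartedSpace H M] [IsManifold I ∞ M]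
  {v : (x : M) → TangentSpace I x}

variable (v) in
/-- The expression of a vector field in the chart at `x₀`. -/
def chartField (x₀ : M) (z : E) : E :=
  tangentCoordChange I ((extChartAt I x₀).symm z) x₀ ((extChartAt I x₀).symm z)
    (v ((extChartAt I x₀).symm z))

lemma contDiffOn_chartField
    (hv : ContMDiff I I.tangent ∞ (fun x => (⟨x, v x⟩ : TangentBundle I M))) (x₀ : M) :
    ContDiffOn ℝ ∞ (chartField v x₀) (extChartAt I x₀).target := by
  have h1 : ContMDiffOn 𝓘(ℝ, E) I.tangent ∞
      (fun z => (⟨(extChartAt I x₀).symm z, v ((extChartAt I x₀).symm z)⟩ : TangentBundle I M))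
      (extChartAt I x₀).target :=
    hv.comp_contMDiffOn (contMDiffOn_extChartAt_symm x₀)
  have h2 : ContMDiffOn I.tangent (I.prod 𝓘(ℝ, E)) ∞
      (trivializationAt E (TangentSpace I : M → Type _) x₀)
      (trivializationAt E (TangentSpace I : M → Type _) x₀).source :=
    Trivialization.contMDiffOn _
  have h3 := h2.comp h1 (fun z hz => by
    rw [mem_preimage, Trivialization.mem_source, TangentBundle.trivializationAt_baseSet]
    simpa using (extChartAt I x₀).map_target hz)
  have h4 := (contMDiff_snd (I := I) (J := 𝓘(ℝ, E)) (M := M) (N := E)).comp_contMDiffOn h3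
  exact contMDiffOn_iff_contDiffOn.mp h4

/-- This returns from a solution in the chart at `x₀` to the manifold. The derivative there is read
in the chart at the moving point, so the two coordinate changes must cancel. -/
lemma hasMFDerivAt_symm_of_hasDerivAt {x₀ : M} {f : ℝ → E} {t : ℝ}
    (hft : f t ∈ (extChartAt I x₀).target) (hf : HasDerivAt f (chartField v x₀ (f t)) t) :
    HasMFDerivAt 𝓘(ℝ, ℝ) I (fun t => (extChartAt I x₀).symm (f t)) t
      ((1 : ℝ →L[ℝ] ℝ).smulRight (v ((extChartAt I x₀).symm (f t)))) := by
  let xₜ : M := (extChartAt I x₀).symm (f t)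
  have hft1 : xₜ ∈ (extChartAt I x₀).source := (extChartAt I x₀).map_target hft
  have hft2 := mem_extChartAt_source (I := I) xₜ
  have h1 : tangentCoordChange I x₀ xₜ xₜ (chartField v x₀ (f t)) = v xₜ := by
    have := tangentCoordChange_comp (I := I) (w := xₜ) (x := x₀) (y := xₜ) (z := xₜ) (v := v xₜ)
      ⟨⟨hft2, hft1⟩, hft2⟩
    exact this.trans (tangentCoordChange_self (I := I) hft2)
  have h2 := hasFDerivWithinAt_tangentCoordChange (I := I) (x := x₀) (y := xₜ) (z := xₜ)
    ⟨hft1, hft2⟩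
  rw [(extChartAt I x₀).right_inv hft, I.range_eq_univ, hasFDerivWithinAt_univ] at h2
  have h3 : HasDerivAt ((extChartAt I xₜ ∘ (extChartAt I x₀).symm) ∘ f)
      (tangentCoordChange I x₀ xₜ xₜ (chartField v x₀ (f t))) t := h2.comp_hasDerivAt t hf
  obtain ⟨w, hw⟩ : ∃ w : E, w = v xₜ := ⟨_, rfl⟩
  have h4 : HasFDerivAt ((extChartAt I xₜ ∘ (extChartAt I x₀).symm) ∘ f)
      ((1 : ℝ →L[ℝ] ℝ).smulRight w) t := by
    rw [ContinuousLinearMap.smulRight_one_eq_toSpanSingleton, hw, ← h1]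
    exact h3.hasFDerivAt
  refine ⟨(continuousAt_extChartAt_symm'' hft).comp hf.continuousAt, ?_⟩
  rw [hw] at h4
  exact h4.hasFDerivWithinAt

/-- A smooth vector field has a smooth local flow near every point. -/
theorem exists_contMDiffAt_localFlow [FiniteDimensional ℝ E]
    (hv : ContMDiff I I.tangent ∞ (fun x => (⟨x, v x⟩ : TangentBundle I M))) (x₀ : M) :
    ∃ A : M × ℝ → M, ContMDiffAt (I.prod 𝓘(ℝ, ℝ)) I ∞ A (x₀, 0) ∧
      ∃ U ∈ 𝓝 x₀, ∃ ε > 0, ∀ x ∈ U,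
        A (x, 0) = x ∧ IsMIntegralCurveOn (fun t => A (x, t)) v (Ioo (-ε) ε) := by
  have htgt : (extChartAt I x₀).target ∈ 𝓝 (extChartAt I x₀ x₀) := extChartAt_target_mem_nhds x₀
  -- The field is smooth only on the chart target. It is replaced by a global field that agrees with
  -- it near the base point, and short solutions stay where the two agree.
  obtain ⟨w, hw, hwv⟩ := exists_contDiff_eventuallyEq htgt (contDiffOn_chartField hv x₀)
  obtain ⟨α, hα, r, hr, ε, hε, hflow⟩ := exists_smooth_localFlow w hw (extChartAt I x₀ x₀)
  have hα0 : α (extChartAt I x₀ x₀, 0) = extChartAt I x₀ x₀ :=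
    (hflow _ (Metric.mem_ball_self hr)).1
  have hgood : ∀ᶠ p in 𝓝 (extChartAt I x₀ x₀, (0 : ℝ)),
      α p ∈ (extChartAt I x₀).target ∧ w (α p) = chartField v x₀ (α p) := by
    have h1 := hα.continuousAt.tendsto
    rw [hα0] at h1
    exact h1.eventually (Filter.inter_mem htgt hwv)
  obtain ⟨δ, hδ, hball⟩ := Metric.eventually_nhds_iff_ball.mp hgood
  have hcx : ContMDiffAt I 𝓘(ℝ, E) ∞ (extChartAt I x₀) x₀ := contMDiffAt_extChartAt
  refine ⟨fun p => (extChartAt I x₀).symm (α (extChartAt I x₀ p.1, p.2)), ?_,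
    (extChartAt I x₀).source ∩ extChartAt I x₀ ⁻¹' Metric.ball (extChartAt I x₀ x₀) (min r δ),
    Filter.inter_mem (extChartAt_source_mem_nhds x₀)
      (hcx.continuousAt.preimage_mem_nhds (Metric.ball_mem_nhds _ (by positivity))),
    min ε δ, by positivity, ?_⟩
  · have h1 : ContMDiffAt (I.prod 𝓘(ℝ, ℝ)) 𝓘(ℝ, E × ℝ) ∞
        (fun p : M × ℝ => (extChartAt I x₀ p.1, p.2)) (x₀, 0) := by
      have := (hcx.comp (x₀, (0 : ℝ)) (contMDiffAt_fst (I := I) (J := 𝓘(ℝ, ℝ)))).prodMk_space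
        (contMDiffAt_snd (I := I) (J := 𝓘(ℝ, ℝ)) (p := (x₀, (0 : ℝ))) (n := ∞))
      exact this
    have h2 : ContMDiffAt 𝓘(ℝ, E × ℝ) 𝓘(ℝ, E) ∞ α (extChartAt I x₀ x₀, 0) := hα.contMDiffAt
    have h3 : ContMDiffAt 𝓘(ℝ, E) I ∞ (extChartAt I x₀).symm (α (extChartAt I x₀ x₀, 0)) := by
      rw [hα0]
      exact (contMDiffOn_extChartAt_symm x₀).contMDiffAt htgt
    exact h3.comp (x₀, (0 : ℝ)) (h2.comp (x₀, (0 : ℝ)) h1)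
  · rintro x ⟨hxs, hx⟩
    have hx' : dist (extChartAt I x₀ x) (extChartAt I x₀ x₀) < min r δ := hx
    rw [lt_min_iff] at hx'
    obtain ⟨hx0, hxd⟩ := hflow _ hx'.1
    refine ⟨?_, fun t ht => ?_⟩
    · change (extChartAt I x₀).symm (α (extChartAt I x₀ x, 0)) = x
      rw [hx0, (extChartAt I x₀).left_inv hxs]
    · have ht' : |t| < min ε δ := abs_lt.mpr ht
      rw [lt_min_iff] at ht'
      have hmem := hball (extChartAt I x₀ x, t) (by
        simp only [Metric.mem_ball, Prod.dist_eq, max_lt_iff, Real.dist_eq, sub_zero]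
        exact ⟨hx'.2, ht'.2⟩)
      have hd := hxd t (abs_lt.mp ht'.1)
      rw [hmem.2] at hd
      exact (hasMFDerivAt_symm_of_hasDerivAt (f := fun t => α (extChartAt I x₀ x, t))
        hmem.1 hd).hasMFDerivWithinAt

variable [T2Space M]

/-- The flow of a complete smooth vector field is smooth. -/
theorem contMDiff_flow [FiniteDimensional ℝ E]
    (hv : ContMDiff I I.tangent ∞ (fun x => (⟨x, v x⟩ : TangentBundle I M)))
    (Φ : ℝ → M → M) (hΦ0 : ∀ x, Φ 0 x = x) (hΦ : ∀ x, IsMIntegralCurve (fun t => Φ t x) v) :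
    ContMDiff (𝓘(ℝ, ℝ).prod I) I ∞ (fun p : ℝ × M => Φ p.1 p.2) := by
  have hv1 : ContMDiff I I.tangent 1 (fun x => (⟨x, v x⟩ : TangentBundle I M)) :=
    hv.of_le (mod_cast le_top)
  have hgroup : ∀ s t x, Φ (s + t) x = Φ s (Φ t x) := by
    intro s t x
    have h1 : IsMIntegralCurve (fun s => Φ (s + t) x) v := (hΦ x).comp_add t
    exact congrFun (isMIntegralCurve_Ioo_eq_of_contMDiff_boundaryless (t₀ := 0) hv1 h1
      (hΦ (Φ t x)) (by simp [hΦ0])) s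
  -- For finite `n`, being `Cⁿ` at a point implies being `Cⁿ` in a neighbourhood. The argument uses
  -- this openness.
  refine contMDiff_infty.mpr fun n => ?_
  have hn : ((n : ℕ∞) : WithTop ℕ∞) ≤ ∞ := mod_cast le_top
  -- near every point the flow is smooth for a short time
  have hlocal : ∀ q : M, ∃ ε > 0, ∃ U ∈ 𝓝 q, ∀ s, |s| < ε → ∀ x ∈ U,
      ContMDiffAt (𝓘(ℝ, ℝ).prod I) I n (fun p : ℝ × M => Φ p.1 p.2) (s, x) := by
    intro q
    obtain ⟨A, hA, U, hU, ε, hε, hAU⟩ := exists_contMDiffAt_localFlow hv q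
    have heq : ∀ x ∈ U, EqOn (fun t => A (x, t)) (fun t => Φ t x) (Ioo (-ε) ε) := fun x hx =>
      isMIntegralCurveOn_Ioo_eqOn_of_contMDiff_boundaryless (t₀ := 0) ⟨by linarith, hε⟩ hv1
        (hAU x hx).2 ((hΦ x).isMIntegralCurveOn _) (by rw [(hAU x hx).1, hΦ0])
    have hswap : ContMDiffAt (𝓘(ℝ, ℝ).prod I) I ∞ (fun p : ℝ × M => A (p.2, p.1)) (0, q) :=
      ContMDiffAt.comp (I' := I.prod 𝓘(ℝ, ℝ)) ((0 : ℝ), q) (g := A)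
        (f := fun p : ℝ × M => (p.2, p.1)) hA (contMDiffAt_snd.prodMk contMDiffAt_fst)
    have hΦq : ContMDiffAt (𝓘(ℝ, ℝ).prod I) I n (fun p : ℝ × M => Φ p.1 p.2) (0, q) := by
      refine (hswap.of_le hn).congr_of_eventuallyEq ?_
      filter_upwards [prod_mem_nhds (Ioo_mem_nhds (by linarith : -ε < 0) hε) hU] with p hp
      exact (heq p.2 hp.2 hp.1).symm
    obtain ⟨W, hW, U', hU', hWU⟩ := mem_nhds_prod_iff.mp
      ((contMDiffAt_iff_contMDiffAt_nhds (by simp)).mp hΦq)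
    obtain ⟨δ, hδ, hδW⟩ := Metric.mem_nhds_iff.mp hW
    exact ⟨δ, hδ, U', hU', fun s hs x hx => hWU ⟨hδW (by simpa using hs), hx⟩⟩
  -- the set of times at which the flow is smooth at a given point is open and closed
  rintro ⟨t, x₀⟩
  let J : Set ℝ := {t | ContMDiffAt (𝓘(ℝ, ℝ).prod I) I n (fun p : ℝ × M => Φ p.1 p.2) (t, x₀)}
  -- Smoothness passes between any two times of the ball by `Φ_s = Φ_{s - t₁} ∘ Φ_{t₁}`, as the
  -- outer factor is a short-time flow near `Φ t x₀`. One such radius makes both `J` and its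
  -- complement open.
  have hJ : ∀ t, ∃ δ > 0, ∀ t₁ ∈ Metric.ball t δ, ∀ t₂ ∈ Metric.ball t δ, t₁ ∈ J → t₂ ∈ J := by
    intro t
    obtain ⟨ε, hε, U, hU, hsm⟩ := hlocal (Φ t x₀)
    obtain ⟨δ, hδ, hδU⟩ := Metric.mem_nhds_iff.mp ((hΦ x₀).continuous.continuousAt hU)
    refine ⟨min δ (ε / 2), by positivity, fun t₁ h₁ t₂ h₂ hJ₁ => ?_⟩
    simp only [Metric.mem_ball, lt_min_iff] at h₁ h₂
    have hfun : (fun p : ℝ × M => Φ p.1 p.2) =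
        (fun p : ℝ × M => Φ p.1 p.2) ∘ fun p : ℝ × M => (p.1 - t₁, Φ t₁ p.2) := by
      funext p
      simp only [Function.comp_apply]
      rw [← hgroup, sub_add_cancel]
    have hinner : ContMDiffAt (𝓘(ℝ, ℝ).prod I) I n (fun p : ℝ × M => Φ t₁ p.2) (t₂, x₀) :=
      ContMDiffAt.comp (I' := 𝓘(ℝ, ℝ).prod I) (t₂, x₀) (g := fun p : ℝ × M => Φ p.1 p.2)
        (f := fun p : ℝ × M => (t₁, p.2)) hJ₁ (contMDiffAt_const.prodMk contMDiffAt_snd)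
    have hsub : ContMDiffAt (𝓘(ℝ, ℝ).prod I) 𝓘(ℝ, ℝ) n (fun p : ℝ × M => p.1 - t₁) (t₂, x₀) :=
      ContMDiffAt.comp (I' := 𝓘(ℝ, ℝ)) (t₂, x₀) (g := fun s : ℝ => s - t₁) (f := Prod.fst)
        (contDiff_id.sub contDiff_const).contMDiff.contMDiffAt contMDiffAt_fst
    change ContMDiffAt (𝓘(ℝ, ℝ).prod I) I n (fun p : ℝ × M => Φ p.1 p.2) (t₂, x₀)
    rw [hfun]
    refine ContMDiffAt.comp (I' := 𝓘(ℝ, ℝ).prod I) (t₂, x₀)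
      (hsm (t₂ - t₁) ?_ (Φ t₁ x₀) (hδU h₁.1)) (hsub.prodMk hinner)
    have := dist_triangle t₂ t t₁
    rw [dist_comm t t₁] at this
    rw [← Real.dist_eq]
    linarith [h₁.2, h₂.2]
  have hclopen : IsClopen J := by
    refine ⟨isOpen_compl_iff.mp (Metric.isOpen_iff.mpr fun t ht => ?_),
      Metric.isOpen_iff.mpr fun t ht => ?_⟩
    · obtain ⟨δ, hδ, hδJ⟩ := hJ t
      exact ⟨δ, hδ, fun s hs hsJ => ht (hδJ s hs t (Metric.mem_ball_self hδ) hsJ)⟩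
    · obtain ⟨δ, hδ, hδJ⟩ := hJ t
      exact ⟨δ, hδ, fun s hs => hδJ t (Metric.mem_ball_self hδ) s hs ht⟩
  have h0 : (0 : ℝ) ∈ J := by
    obtain ⟨ε, hε, U, hU, hsm⟩ := hlocal x₀
    exact hsm 0 (by simpa using hε) x₀ (mem_of_mem_nhds hU)
  have hall := (isClopen_iff.mp hclopen).resolve_left (Set.nonempty_iff_ne_empty.mp ⟨0, h0⟩)
  exact hall.symm.subset (mem_univ t)

/-- A smooth vector field that vanishes outside a compact set is complete. -/
theorem exists_isMIntegralCurve_of_compact_support [FiniteDimensional ℝ E]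
    (hv : ContMDiff I I.tangent ∞ (fun x => (⟨x, v x⟩ : TangentBundle I M)))
    {K : Set M} (hK : IsCompact K) (hvK : ∀ x ∉ K, v x = 0) (x : M) :
    ∃ γ : ℝ → M, γ 0 = x ∧ IsMIntegralCurve γ v := by
  have hv1 : ContMDiff I I.tangent 1 (fun x => (⟨x, v x⟩ : TangentBundle I M)) :=
    hv.of_le (mod_cast le_top)
  -- A common existence time on `K` extends to all of `M`, because points outside `K` are
  -- stationary. A uniform existence time implies completeness.
  have hunif : ∃ ε > 0, ∀ x ∈ K, ∃ γ : ℝ → M, γ 0 = x ∧ IsMIntegralCurveOn γ v (Ioo (-ε) ε) := by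
    refine hK.induction_on (p := fun S => ∃ ε > 0, ∀ x ∈ S, ∃ γ : ℝ → M, γ 0 = x ∧
      IsMIntegralCurveOn γ v (Ioo (-ε) ε)) ⟨1, one_pos, by simp⟩ ?_ ?_ ?_
    · rintro S T hST ⟨ε, hε, h⟩
      exact ⟨ε, hε, fun x hx => h x (hST hx)⟩
    · rintro S T ⟨ε, hε, h⟩ ⟨ε', hε', h'⟩
      refine ⟨min ε ε', by positivity, fun x hx => ?_⟩
      rcases hx with hx | hx
      · obtain ⟨γ, h0, hγ⟩ := h x hx
        exact ⟨γ, h0, hγ.mono (Ioo_subset_Ioo (neg_le_neg (min_le_left _ _)) (min_le_left _ _))⟩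
      · obtain ⟨γ, h0, hγ⟩ := h' x hx
        exact ⟨γ, h0, hγ.mono (Ioo_subset_Ioo (neg_le_neg (min_le_right _ _)) (min_le_right _ _))⟩
    · intro q _
      obtain ⟨A, -, U, hU, ε, hε, hAU⟩ := exists_contMDiffAt_localFlow hv q
      exact ⟨U, mem_nhdsWithin_of_mem_nhds hU, ε, hε, 
        fun x hx => ⟨fun t => A (x, t), hAU x hx⟩⟩
  obtain ⟨ε, hε, h⟩ := hunif
  refine exists_isMIntegralCurve_of_isMIntegralCurveOn hv1 hε (fun x => ?_) x
  by_cases hx : x ∈ K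
  · exact h x hx
  · exact ⟨fun _ => x, rfl, (isMIntegralCurve_const (hvK x hx)).isMIntegralCurveOn _⟩

end ManifoldFlow

/-! ### Nondegenerate bilinear forms -/

lemma isInvertible_of_nondegenerate {V : Type*} [NormedAddCommGroup V] [NormedSpace ℝ V]
    [FiniteDimensional ℝ V] (G : V →L[ℝ] V →L[ℝ] ℝ) (hG : ∀ v, G v = 0 → v = 0) :
    G.IsInvertible := by
  have hinj : Function.Injective (G : V →ₗ[ℝ] V →L[ℝ] ℝ) :=
    (injective_iff_map_eq_zero _).mpr hG
  have hrank : Module.finrank ℝ V = Module.finrank ℝ (V →L[ℝ] ℝ) := by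
    rw [← (LinearMap.toContinuousLinearMap (𝕜 := ℝ) (E := V) (F' := ℝ)).finrank_eq]
    exact (Subspace.dual_finrank_eq (K := ℝ) (V := V)).symm
  exact ⟨(LinearEquiv.ofInjectiveOfFinrankEq (G : V →ₗ[ℝ] V →L[ℝ] ℝ) hinj
    hrank).toContinuousLinearEquiv, by ext; rfl⟩

variable (d : ℕ) in
/-- The standard symplectic form on `ℝᵈ × (ℝᵈ)*`. -/
def stdSymplectic : (Model d × CoModel d) →L[ℝ] (Model d × CoModel d) →L[ℝ] ℝ :=
  LinearMap.mkContinuous₂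
    (LinearMap.mk₂ ℝ (fun v w : Model d × CoModel d => w.2 v.1 - v.2 w.1)
      (fun v v' w => by simp; ring) (fun c v w => by simp; ring)
      (fun v w w' => by simp; ring) (fun c v w => by simp; ring)) 2
    (fun v w => by
      simp only [LinearMap.mk₂_apply]
      have h1 := w.2.le_of_opNorm_le_of_le (norm_snd_le w) (norm_fst_le v)
      have h2 := v.2.le_of_opNorm_le_of_le (norm_snd_le v) (norm_fst_le w)
      have h3 := norm_sub_le (w.2 v.1) (v.2 w.1)
      nlinarith)

lemma stdSymplectic_apply {d : ℕ} (v w : Model d × CoModel d) :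
    stdSymplectic d v w = w.2 v.1 - v.2 w.1 := rfl

lemma stdSymplectic_nondegenerate {d : ℕ} (v : Model d × CoModel d)
    (hv : stdSymplectic d v = 0) : v = 0 := by
  have h1 : v.1 = 0 := by
    by_contra hne
    obtain ⟨ξ, -, hξ⟩ := exists_dual_vector ℝ v.1 (norm_ne_zero_iff.mpr hne)
    have := DFunLike.congr_fun hv ((0 : Model d), ξ)
    simp only [stdSymplectic_apply, map_zero, sub_zero, hξ, zero_apply] at this
    exact hne (by simpa using this)
  have h2 : v.2 = 0 := by
    ext w
    have := DFunLike.congr_fun hv (w, (0 : CoModel d))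
    simpa [stdSymplectic_apply] using this
  exact Prod.ext h1 h2

lemma isInvertible_stdSymplectic (d : ℕ) : (stdSymplectic d).IsInvertible :=
  isInvertible_of_nondegenerate _ stdSymplectic_nondegenerate

set_option synthInstance.maxHeartbeats 200000 in
/-- A `C²` map that preserves the Liouville form `ξ · dy` near `z` is symplectic at `z`. -/
lemma stdSymplectic_fderiv_of_liouville {d : ℕ}
    {Ψ : Model d × CoModel d → Model d × CoModel d} {z : Model d × CoModel d}
    (hΨ : ContDiffAt ℝ 2 Ψ z)
    (hL : ∀ᶠ x in 𝓝 z, ∀ w, (Ψ x).2 (fderiv ℝ Ψ x w).1 = x.2 w.1)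
    (v w : Model d × CoModel d) :
    stdSymplectic d (fderiv ℝ Ψ z v) (fderiv ℝ Ψ z w) = stdSymplectic d v w := by
  have hD : HasFDerivAt Ψ (fderiv ℝ Ψ z) z := (hΨ.differentiableAt (by norm_num)).hasFDerivAt
  have hD2 : HasFDerivAt (fderiv ℝ Ψ) (fderiv ℝ (fderiv ℝ Ψ) z) z :=
    ((hΨ.fderiv_right (m := 1) (by norm_num)).differentiableAt (by norm_num)).hasFDerivAt
  have hsymm : IsSymmSndFDerivAt ℝ Ψ z := hΨ.isSymmSndFDerivAt (by simp)
  -- The Liouville identity with `b` fixed is differentiated in direction `a`. Antisymmetrizing in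
  -- `a, b` removes the second derivative of `Ψ` and leaves the symplectic form.
  have key : ∀ a b, (fderiv ℝ Ψ z a).2 (fderiv ℝ Ψ z b).1 +
      (Ψ z).2 (fderiv ℝ (fderiv ℝ Ψ) z a b).1 = a.2 b.1 := by
    intro a b
    have h1 : HasFDerivAt (fun x => (Ψ x).2 (fderiv ℝ Ψ x b).1)
        (((Ψ z).2 ∘L (ContinuousLinearMap.fst ℝ _ _ ∘L
          (fderiv ℝ (fderiv ℝ Ψ) z).flip b)) +
          ((ContinuousLinearMap.snd ℝ _ _ ∘L fderiv ℝ Ψ z).flip (fderiv ℝ Ψ z b).1)) z := by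
      have hb : HasFDerivAt (fun x => fderiv ℝ Ψ x b) ((fderiv ℝ (fderiv ℝ Ψ) z).flip b) z := by
        simpa using hD2.clm_apply (hasFDerivAt_const b z)
      exact hD.snd.clm_apply hb.fst
    have h2 : HasFDerivAt (fun x : Model d × CoModel d => x.2 b.1)
        ((ContinuousLinearMap.snd ℝ (Model d) (CoModel d)).flip b.1) z := by
      simpa using (hasFDerivAt_snd (𝕜 := ℝ) (p := z)).clm_apply (hasFDerivAt_const b.1 z)
    have h3 := h1.unique (h2.congr_of_eventuallyEq (hL.mono fun x hx => hx b))
    have h4 := DFunLike.congr_fun h3 a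
    simp only [add_apply, ContinuousLinearMap.comp_apply,
      ContinuousLinearMap.flip_apply, ContinuousLinearMap.coe_fst',
      ContinuousLinearMap.coe_snd'] at h4
    linarith
  have h1 := key v w
  have h2 := key w v
  rw [hsymm.eq v w] at h1
  rw [stdSymplectic_apply, stdSymplectic_apply]
  linarith

/-! ### Canonical coordinates on the cotangent bundle. -/

section Coordinates

variable {d : ℕ} {Y : Type*} [TopologicalSpace Y] [ChartedSpace (Model d) Y]
  [IsManifold (𝓡 d) ∞ Y]

/-- The total space of the cotangent bundle of a Hausdorff manifold is Hausdorff. -/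
instance [T2Space Y] : T2Space (Cotangent d Y) := by
  refine ⟨fun p q hpq => ?_⟩
  by_cases h : p.proj = q.proj
  · let e := trivializationAt (CoModel d) (CotangentFibre d Y) p.proj
    have hp : p ∈ e.source := FiberBundle.mem_trivializationAt_proj_source
    have hq : q ∈ e.source := by
      rw [e.mem_source, ← h]; exact FiberBundle.mem_baseSet_trivializationAt' _
    have hne : e p ≠ e q := fun he => hpq (e.injOn hp hq he)
    obtain ⟨u, v, hu, hv, hpu, hqv, huv⟩ := t2_separation hne
    exact ⟨e.source ∩ e ⁻¹' u, e.source ∩ e ⁻¹' v,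
      e.toOpenPartialHomeomorph.isOpen_inter_preimage hu,
      e.toOpenPartialHomeomorph.isOpen_inter_preimage hv, ⟨hp, hpu⟩, ⟨hq, hqv⟩,
      (huv.preimage e).mono inter_subset_right inter_subset_right⟩
  · have hc : Continuous (TotalSpace.proj : Cotangent d Y → Y) :=
      FiberBundle.continuous_proj _ _
    obtain ⟨u, v, hu, hv, hpu, hqv, huv⟩ := t2_separation h
    exact ⟨_, _, hu.preimage hc, hv.preimage hc, hpu, hqv, huv.preimage _⟩

lemma inCoordinates_cotangent (y₀ y : Y) (ξ : CotangentFibre d Y y) :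
    ContinuousLinearMap.inCoordinates (Model d) (TangentSpace (𝓡 d)) ℝ (Bundle.Trivial Y ℝ)
      y₀ y y₀ y ξ =
      ξ.comp ((trivializationAt (Model d) (TangentSpace (𝓡 d)) y₀).symmL ℝ y) := by
  ext v
  simp [ContinuousLinearMap.inCoordinates]

lemma extChartAt_cotangent_apply (p q : Cotangent d Y) :
    extChartAt (cotModel d) p q = (extChartAt (𝓡 d) p.proj q.proj,
      q.snd.comp ((trivializationAt (Model d) (TangentSpace (𝓡 d)) p.proj).symmL ℝ q.proj)) := by
  have h := hom_trivializationAt_apply (RingHom.id ℝ) (F₁ := Model d)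
    (E₁ := (TangentSpace (𝓡 d) : Y → Type _)) (F₂ := ℝ) (E₂ := Bundle.Trivial Y ℝ) p.proj q
  rw [FiberBundle.extChartAt]
  change (extChartAt (𝓡 d) p.proj
      (trivializationAt (CoModel d) (CotangentFibre d Y) p.proj q).1,
    (trivializationAt (CoModel d) (CotangentFibre d Y) p.proj q).2) = _
  rw [h, inCoordinates_cotangent]

lemma mem_extChartAt_cotangent_source {p q : Cotangent d Y} :
    q ∈ (extChartAt (cotModel d) p).source ↔ q.proj ∈ (extChartAt (𝓡 d) p.proj).source := by
  have h := hom_trivializationAt_apply (RingHom.id ℝ) (F₁ := Model d)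
    (E₁ := (TangentSpace (𝓡 d) : Y → Type _)) (F₂ := ℝ) (E₂ := Bundle.Trivial Y ℝ) p.proj q
  rw [extChartAt_source, FiberBundle.chartedSpace_chartAt, extChartAt_source]
  simp only [mfld_simps]
  refine ⟨fun h => h.1.1, fun h' => ⟨⟨h', mem_univ _⟩, ?_⟩⟩
  rw [h]
  exact h'

lemma contMDiff_proj : ContMDiff (cotModel d) (𝓡 d) ∞ (TotalSpace.proj : Cotangent d Y → Y) :=
  Bundle.contMDiff_proj _

lemma contMDiff_fibreSmul :
    ContMDiff (𝓘(ℝ, ℝ).prod (cotModel d)) (cotModel d) ∞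
      (fun z : ℝ × Cotangent d Y => fibreSmul z.1 z.2) := by
  intro z₀
  have hid : ContMDiffAt (𝓘(ℝ, ℝ).prod (cotModel d)) (cotModel d) ∞
    (fun z : ℝ × Cotangent d Y => z.2) z₀ := contMDiffAt_snd
  have hid' := (contMDiffAt_hom_bundle _).mp hid
  refine (contMDiffAt_hom_bundle _).mpr ⟨hid'.1, ?_⟩
  have h := (contMDiffAt_fst (I := 𝓘(ℝ, ℝ)) (J := cotModel d) (p := z₀) (n := ∞)).smul hid'.2
  refine h.congr_of_eventuallyEq (Eventually.of_forall fun z => ?_)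
  simp only [fibreSmul, inCoordinates_cotangent]
  rfl

/-! ### Chart changes of the cotangent bundle are symplectic -/

lemma proj_extChartAt_cotangent_symm {p : Cotangent d Y} {z : Model d × CoModel d}
    (hz : z ∈ (extChartAt (cotModel d) p).target) :
    ((extChartAt (cotModel d) p).symm z).proj = (extChartAt (𝓡 d) p.proj).symm z.1 := by
  have h1 := (extChartAt (cotModel d) p).right_inv hz
  rw [extChartAt_cotangent_apply] at h1
  have h2 := mem_extChartAt_cotangent_source.mp ((extChartAt (cotModel d) p).map_target hz)
  rw [← congrArg Prod.fst h1, (extChartAt (𝓡 d) p.proj).left_inv h2]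

lemma hasFDerivAt_coordChange {E : Type*} [NormedAddCommGroup E] [NormedSpace ℝ E]
    {H : Type*} [TopologicalSpace H] {I : ModelWithCorners ℝ E H} [I.Boundaryless]
    {M : Type*} [TopologicalSpace M] [ChartedSpace H M] [IsManifold I 1 M] {p q : M} {z : E}
    (hz : z ∈ (extChartAt I p).target) (hq : (extChartAt I p).symm z ∈ (extChartAt I q).source) :
    HasFDerivAt (extChartAt I q ∘ (extChartAt I p).symm)
      (tangentCoordChange I p q ((extChartAt I p).symm z)) z := by
  have h := hasFDerivWithinAt_tangentCoordChange (I := I) (x := p) (y := q)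
    (z := (extChartAt I p).symm z) ⟨(extChartAt I p).map_target hz, hq⟩
  rwa [I.range_eq_univ, hasFDerivWithinAt_univ, (extChartAt I p).right_inv hz] at h

lemma isOpen_coordChange_domain {E : Type*} [NormedAddCommGroup E] [NormedSpace ℝ E]
    {H : Type*} [TopologicalSpace H] {I : ModelWithCorners ℝ E H} [I.Boundaryless]
    {M : Type*} [TopologicalSpace M] [ChartedSpace H M] (p q : M) :
    IsOpen ((extChartAt I p).target ∩ (extChartAt I p).symm ⁻¹' (extChartAt I q).source) :=
  (continuousOn_extChartAt_symm p).isOpen_inter_preimage (isOpen_extChartAt_target p)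
    (isOpen_extChartAt_source q)

/-- The base component of a chart change depends only on the base coordinate, so its derivative
ignores the fibre direction. -/
lemma tangentCoordChange_cotangent_fst {p q : Cotangent d Y} {z : Model d × CoModel d}
    (hz : z ∈ (extChartAt (cotModel d) p).target)
    (hq : (extChartAt (cotModel d) p).symm z ∈ (extChartAt (cotModel d) q).source)
    (w : Model d × CoModel d) :
    (tangentCoordChange (cotModel d) p q ((extChartAt (cotModel d) p).symm z) w).1 =
      tangentCoordChange (𝓡 d) p.proj q.proj ((extChartAt (𝓡 d) p.proj).symm z.1) w.1 := by
  have h1 := (hasFDerivAt_coordChange (I := cotModel d) hz hq).fst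
  have hsrc := mem_extChartAt_cotangent_source.mp ((extChartAt (cotModel d) p).map_target hz)
  have hz1 : z.1 ∈ (extChartAt (𝓡 d) p.proj).target := by
    have h2 := (extChartAt (𝓡 d) p.proj).map_source hsrc
    have h3 := (extChartAt (cotModel d) p).right_inv hz
    rw [extChartAt_cotangent_apply] at h3
    have h4 := congrArg Prod.fst h3
    dsimp only at h4
    rwa [h4] at h2
  have hq1 := mem_extChartAt_cotangent_source.mp hq
  rw [proj_extChartAt_cotangent_symm hz] at hq1
  have h2 := (hasFDerivAt_coordChange (I := 𝓡 d) hz1 hq1).comp z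
    (hasFDerivAt_fst (𝕜 := ℝ) (p := z))
  have h3 : (fun x => ((extChartAt (cotModel d) q ∘ (extChartAt (cotModel d) p).symm) x).1)
      =ᶠ[𝓝 z] (extChartAt (𝓡 d) q.proj ∘ (extChartAt (𝓡 d) p.proj).symm) ∘ Prod.fst := by
    filter_upwards [(isOpen_extChartAt_target (I := cotModel d) p).mem_nhds hz] with x hx
    simp only [Function.comp_apply]
    rw [extChartAt_cotangent_apply, proj_extChartAt_cotangent_symm hx]
  have h4 := h1.unique (h2.congr_of_eventuallyEq h3)
  exact DFunLike.congr_fun h4 w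

/-- The pairing of a covector with the base component of a velocity does not depend on the chart. -/
lemma liouville_coordChange {p q : Cotangent d Y} {z : Model d × CoModel d}
    (hz : z ∈ (extChartAt (cotModel d) p).target)
    (hq : (extChartAt (cotModel d) p).symm z ∈ (extChartAt (cotModel d) q).source)
    (w : Model d × CoModel d) :
    (extChartAt (cotModel d) q ((extChartAt (cotModel d) p).symm z)).2
      (fderiv ℝ (extChartAt (cotModel d) q ∘ (extChartAt (cotModel d) p).symm) z w).1 =
      z.2 w.1 := by
  rw [(hasFDerivAt_coordChange (I := cotModel d) hz hq).fderiv]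
  rw [tangentCoordChange_cotangent_fst hz hq, ← proj_extChartAt_cotangent_symm hz]
  set r := (extChartAt (cotModel d) p).symm z with hr
  have hz' : z = extChartAt (cotModel d) p r := ((extChartAt (cotModel d) p).right_inv hz).symm
  have hp1 := mem_extChartAt_cotangent_source.mp ((extChartAt (cotModel d) p).map_target hz)
  have hq1 := mem_extChartAt_cotangent_source.mp hq
  rw [hz', extChartAt_cotangent_apply, extChartAt_cotangent_apply]
  rw [TangentBundle.symmL_trivializationAt_eq_core (extChartAt_source (𝓡 d) q.proj ▸ hq1),
    TangentBundle.symmL_trivializationAt_eq_core (extChartAt_source (𝓡 d) p.proj ▸ hp1)]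
  change r.snd (tangentCoordChange (𝓡 d) q.proj r.proj r.proj
    (tangentCoordChange (𝓡 d) p.proj q.proj r.proj w.1)) =
    r.snd (tangentCoordChange (𝓡 d) p.proj r.proj r.proj w.1)
  rw [tangentCoordChange_comp ⟨⟨hp1, hq1⟩, mem_extChartAt_source _⟩]

lemma contDiffAt_coordChange {E : Type*} [NormedAddCommGroup E] [NormedSpace ℝ E]
    {H : Type*} [TopologicalSpace H] {I : ModelWithCorners ℝ E H} [I.Boundaryless]
    {M : Type*} [TopologicalSpace M] [ChartedSpace H M] [IsManifold I ∞ M] {p q : M} {z : E}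
    (hz : z ∈ (extChartAt I p).target) (hq : (extChartAt I p).symm z ∈ (extChartAt I q).source) :
    ContDiffAt ℝ ∞ (extChartAt I q ∘ (extChartAt I p).symm) z := by
  have h := contDiffWithinAt_ext_coord_change (I := I) (n := ∞) q p (y := z)
    (by rw [PartialEquiv.trans_source]; exact ⟨hz, hq⟩)
  rwa [I.range_eq_univ, contDiffWithinAt_univ] at h

/-- The chart changes of the cotangent bundle are symplectic. -/
lemma stdSymplectic_tangentCoordChange {p q r : Cotangent d Y}
    (hp : r ∈ (extChartAt (cotModel d) p).source) (hq : r ∈ (extChartAt (cotModel d) q).source)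
    (v w : Model d × CoModel d) :
    stdSymplectic d (tangentCoordChange (cotModel d) p q r v)
      (tangentCoordChange (cotModel d) p q r w) = stdSymplectic d v w := by
  have hr := (extChartAt (cotModel d) p).left_inv hp
  have hz := (extChartAt (cotModel d) p).map_source hp
  have hq' : (extChartAt (cotModel d) p).symm (extChartAt (cotModel d) p r) ∈
    (extChartAt (cotModel d) q).source := by rwa [hr]
  have h := (hasFDerivAt_coordChange (I := cotModel d) hz hq').fderiv
  rw [hr] at h
  rw [← h]
  refine stdSymplectic_fderiv_of_liouville
    ((contDiffAt_coordChange hz hq').of_le (WithTop.coe_le_coe.mpr (le_top : (2 : ℕ∞) ≤ ⊤))) ?_ v w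
  filter_upwards [(isOpen_coordChange_domain (I := cotModel d) p q).mem_nhds ⟨hz, hq'⟩] with x hx
  exact liouville_coordChange hx.1 hx.2

end Coordinates

/-! ### Hamilton vector fields -/

section Hamilton

set_option synthInstance.maxHeartbeats 200000

variable {d : ℕ} {Y : Type*} [TopologicalSpace Y] [ChartedSpace (Model d) Y]
  [IsManifold (𝓡 d) ∞ Y]

/-- The Hamilton vector field of `f`. -/
def hamField (f : Cotangent d Y → ℝ) (p : Cotangent d Y) : TangentSpace (cotModel d) p :=
  let L : (Model d × CoModel d) →L[ℝ] ℝ := mfderiv (cotModel d) 𝓘(ℝ, ℝ) f p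
  (stdSymplectic d).inverse L

lemma stdSymplectic_inverse (L : (Model d × CoModel d) →L[ℝ] ℝ) :
    stdSymplectic d ((stdSymplectic d).inverse L) = L :=
  (isInvertible_stdSymplectic d).self_apply_inverse L

lemma stdSymplectic_injective : Function.Injective (stdSymplectic d) :=
  (injective_iff_map_eq_zero _).mpr stdSymplectic_nondegenerate

lemma isHamiltonField_hamField (f : Cotangent d Y → ℝ) : IsHamiltonField f (hamField f) := by
  intro p w
  exact (DFunLike.congr_fun (stdSymplectic_inverse (d := d)
    (mfderiv (cotModel d) 𝓘(ℝ, ℝ) f p)) w).symm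

/-- Nondegeneracy makes the Hamilton field unique, so the field hidden in `IsBicharacteristic` can
be replaced by `hamField`. -/
lemma IsHamiltonField.eq_hamField {f : Cotangent d Y → ℝ}
    {V : (p : Cotangent d Y) → TangentSpace (cotModel d) p} (hV : IsHamiltonField f V) :
    V = hamField f := by
  funext p
  refine stdSymplectic_injective (d := d) ?_
  refine ContinuousLinearMap.ext fun w => ?_
  exact (hV p w).symm.trans (isHamiltonField_hamField f p w)

/-- The differential at `p` is read in the chart at `p`. This expresses it in one fixed chart, as
smoothness statements require. -/
lemma mfderiv_cotangent_eq {f : Cotangent d Y → ℝ} (hf : ContMDiff (cotModel d) 𝓘(ℝ, ℝ) ∞ f)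
    {p₀ p : Cotangent d Y} (hp : p ∈ (extChartAt (cotModel d) p₀).source)
    (w : Model d × CoModel d) :
    mfderiv (cotModel d) 𝓘(ℝ, ℝ) f p w =
      fderiv ℝ (f ∘ (extChartAt (cotModel d) p₀).symm) (extChartAt (cotModel d) p₀ p)
        (tangentCoordChange (cotModel d) p p₀ p w) := by
  have hpp := mem_extChartAt_source (I := cotModel d) p
  have hleft := (extChartAt (cotModel d) p).left_inv hpp
  have hz := (extChartAt (cotModel d) p).map_source hpp
  have h1 : mfderiv (cotModel d) 𝓘(ℝ, ℝ) f p w =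
      fderiv ℝ (f ∘ (extChartAt (cotModel d) p).symm) (extChartAt (cotModel d) p p) w := by
    rw [(hf.mdifferentiableAt (by simp)).mfderiv, (cotModel d).range_eq_univ, fderivWithin_univ]
    rfl
  have hΨ := hasFDerivAt_coordChange (I := cotModel d) (p := p) (q := p₀) hz (by rwa [hleft])
  rw [hleft] at hΨ
  have hg : DifferentiableAt ℝ (f ∘ (extChartAt (cotModel d) p₀).symm)
      (extChartAt (cotModel d) p₀ p) := by
    have h2 := (hf.comp_contMDiffOn (contMDiffOn_extChartAt_symm (I := cotModel d) p₀)).contMDiffAt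
      ((isOpen_extChartAt_target p₀).mem_nhds ((extChartAt (cotModel d) p₀).map_source hp))
    exact h2.contDiffAt.differentiableAt (by simp)
  have hg' : DifferentiableAt ℝ (f ∘ (extChartAt (cotModel d) p₀).symm)
      ((extChartAt (cotModel d) p₀ ∘ (extChartAt (cotModel d) p).symm)
        (extChartAt (cotModel d) p p)) := by
    rwa [Function.comp_apply, hleft]
  have h3 := hg'.hasFDerivAt.comp _ hΨ
  have h4 : f ∘ (extChartAt (cotModel d) p).symm =ᶠ[𝓝 (extChartAt (cotModel d) p p)]
      (f ∘ (extChartAt (cotModel d) p₀).symm) ∘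
        (extChartAt (cotModel d) p₀ ∘ (extChartAt (cotModel d) p).symm) := by
    filter_upwards [(isOpen_coordChange_domain (I := cotModel d) p p₀).mem_nhds
      ⟨hz, by rwa [mem_preimage, hleft]⟩] with x hx
    simp only [Function.comp_apply]
    rw [(extChartAt (cotModel d) p₀).left_inv hx.2]
  rw [h1, (h3.congr_of_eventuallyEq h4).fderiv, Function.comp_apply, hleft]
  rfl

/-- `hamField` is built at each point in that point's own chart. Since chart changes are symplectic,
it has the usual Hamiltonian formula in every fixed chart, and smoothness follows. -/
lemma chartField_hamField {f : Cotangent d Y → ℝ} (hf : ContMDiff (cotModel d) 𝓘(ℝ, ℝ) ∞ f)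
    (p₀ : Cotangent d Y) {z : Model d × CoModel d}
    (hz : z ∈ (extChartAt (cotModel d) p₀).target) :
    chartField (hamField f) p₀ z =
      (stdSymplectic d).inverse (fderiv ℝ (f ∘ (extChartAt (cotModel d) p₀).symm) z) := by
  set p := (extChartAt (cotModel d) p₀).symm z with hp
  have hps : p ∈ (extChartAt (cotModel d) p₀).source := (extChartAt (cotModel d) p₀).map_target hz
  have hpp := mem_extChartAt_source (I := cotModel d) p
  have hzp : extChartAt (cotModel d) p₀ p = z := (extChartAt (cotModel d) p₀).right_inv hz
  refine stdSymplectic_injective (d := d) ?_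
  rw [stdSymplectic_inverse]
  refine ContinuousLinearMap.ext fun w => ?_
  obtain ⟨w', rfl⟩ : ∃ w', tangentCoordChange (cotModel d) p p₀ p w' = w :=
    ⟨tangentCoordChange (cotModel d) p₀ p p w, by
      rw [tangentCoordChange_comp ⟨⟨hps, hpp⟩, hps⟩, tangentCoordChange_self hps]⟩
  have h1 := mfderiv_cotangent_eq hf hps w'
  rw [hzp] at h1
  rw [← h1]
  refine (stdSymplectic_tangentCoordChange hpp hps (hamField f p) w').trans ?_
  exact (isHamiltonField_hamField f p w').symm

lemma contMDiff_hamField {f : Cotangent d Y → ℝ} (hf : ContMDiff (cotModel d) 𝓘(ℝ, ℝ) ∞ f) :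
    ContMDiff (cotModel d) (cotModel d).tangent ∞
      (fun p => (⟨p, hamField f p⟩ : TangentBundle (cotModel d) (Cotangent d Y))) := by
  intro p₀
  refine (contMDiffAt_section p₀).mpr ?_
  have hsm : ContDiffOn ℝ ∞ (f ∘ (extChartAt (cotModel d) p₀).symm)
      (extChartAt (cotModel d) p₀).target :=
    contMDiffOn_iff_contDiffOn.mp
      (hf.comp_contMDiffOn (contMDiffOn_extChartAt_symm (I := cotModel d) p₀))
  have htgt := isOpen_extChartAt_target (I := cotModel d) p₀
  have h1 : ContDiffAt ℝ ∞ (fun z => (stdSymplectic d).inverse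
      (fderiv ℝ (f ∘ (extChartAt (cotModel d) p₀).symm) z)) (extChartAt (cotModel d) p₀ p₀) :=
    ContDiffAt.comp (extChartAt (cotModel d) p₀ p₀)
      (ContinuousLinearMap.contDiff _).contDiffAt
      ((hsm.fderiv_of_isOpen (m := ∞) htgt (by simp)).contDiffAt
        (htgt.mem_nhds (mem_extChartAt_target p₀)))
  have h2 := h1.contMDiffAt.comp p₀ (contMDiffAt_extChartAt (I := cotModel d) (n := ∞) (x := p₀))
  refine h2.congr_of_eventuallyEq ?_
  filter_upwards [extChartAt_source_mem_nhds (I := cotModel d) p₀] with p hp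
  have h3 := chartField_hamField hf p₀ ((extChartAt (cotModel d) p₀).map_source hp)
  rw [Function.comp_apply, ← h3, chartField, (extChartAt (cotModel d) p₀).left_inv hp]
  rfl

/-- A function is constant along the integral curves of its Hamilton vector field. -/
lemma eq_of_isMIntegralCurve_hamField {f : Cotangent d Y → ℝ}
    (hf : ContMDiff (cotModel d) 𝓘(ℝ, ℝ) ∞ f) {c : Cotangent d Y → ℝ} {γ : ℝ → Cotangent d Y}
    (hγ : IsMIntegralCurve γ (fun p => c p • hamField f p)) (s t : ℝ) : f (γ s) = f (γ t) := by
  have hder : ∀ t, HasDerivAt (f ∘ γ) 0 t := by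
    intro t
    have h1 := ((hf.mdifferentiableAt (by simp) (x := γ t)).hasMFDerivAt.comp t (hγ t))
    have h2 : ∃ L : ℝ →L[ℝ] ℝ, HasFDerivAt (f ∘ γ) L t ∧
        L 1 = mfderiv (cotModel d) 𝓘(ℝ, ℝ) f (γ t) ((1 : ℝ) • c (γ t) • hamField f (γ t)) :=
      ⟨_, hasMFDerivAt_iff_hasFDerivAt.mp h1, rfl⟩
    obtain ⟨L, hL, hL1⟩ := h2
    have h3 : mfderiv (cotModel d) 𝓘(ℝ, ℝ) f (γ t) (hamField f (γ t)) = (0 : ℝ) :=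
      (isHamiltonField_hamField f _ _).trans (sub_self _)
    have h4 : mfderiv (cotModel d) 𝓘(ℝ, ℝ) f (γ t) ((1 : ℝ) • c (γ t) • hamField f (γ t)) =
        c (γ t) • mfderiv (cotModel d) 𝓘(ℝ, ℝ) f (γ t) (hamField f (γ t)) := by
      rw [one_smul, map_smul]
    have h5 : L 1 = (0 : ℝ) :=
      hL1.trans (h4.trans ((congrArg (fun x : ℝ => c (γ t) * x) h3).trans (mul_zero _)))
    exact h5 ▸ hL.hasDerivAt
  exact is_const_of_deriv_eq_zero (fun t => (hder t).differentiableAt)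
    (fun t => (hder t).deriv) s t

end Hamilton

/-! ### The dual norm -/

section DualNorm

set_option synthInstance.maxHeartbeats 200000

variable {d : ℕ} {Y : Type*} [TopologicalSpace Y] [ChartedSpace (Model d) Y]
  [IsManifold (𝓡 d) ∞ Y] (h : SmoothMetric d Y)

lemma isInvertible_inner (y : Y) : (h.inner y).IsInvertible := by
  refine isInvertible_of_nondegenerate (V := Model d) (h.inner y) fun v hv => ?_
  by_contra hne
  have h1 := h.pos y v hne
  have h2 : h.inner y v v = 0 := DFunLike.congr_fun hv v
  exact h1.ne' h2

lemma dualNormSq_eq {p : Cotangent d Y} {v : TangentSpace (𝓡 d) p.proj}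
    (hv : h.inner p.proj v = p.snd) : dualNormSq h p = p.snd v := by
  rw [dualNormSq, ← hv]
  congr 1
  exact (isInvertible_inner h p.proj).inverse_apply_self v

lemma exists_inner_eq (p : Cotangent d Y) : ∃ v, h.inner p.proj v = p.snd :=
  ⟨_, (isInvertible_inner h p.proj).self_apply_inverse p.snd⟩

lemma dualNormSq_fibreSmul (c : ℝ) (p : Cotangent d Y) :
    dualNormSq h (fibreSmul c p) = c ^ 2 * dualNormSq h p := by
  obtain ⟨v, hv⟩ := exists_inner_eq h p
  have h1 : h.inner (fibreSmul c p).proj (c • v) = (fibreSmul c p).snd := by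
    change h.inner p.proj (c • v) = c • p.snd
    rw [map_smul, hv]
  rw [dualNormSq_eq h hv, dualNormSq_eq h h1]
  change (c • p.snd) (c • v) = _
  rw [smul_apply, map_smul, smul_eq_mul, smul_eq_mul]
  ring

lemma dualNormSq_nonneg (p : Cotangent d Y) : 0 ≤ dualNormSq h p := by
  obtain ⟨v, hv⟩ := exists_inner_eq h p
  rw [dualNormSq_eq h hv, ← hv]
  by_cases h0 : v = 0
  · simp [h0]
  · exact (h.pos _ v h0).le

lemma dualNormSq_eq_zero {p : Cotangent d Y} : dualNormSq h p = 0 ↔ p.snd = 0 := by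
  obtain ⟨v, hv⟩ := exists_inner_eq h p
  rw [dualNormSq_eq h hv, ← hv]
  constructor
  · intro h0
    by_contra hne
    exact (h.pos _ v (fun hv0 => hne (by rw [hv0, map_zero]))).ne' h0
  · intro h0
    rw [h0]
    rfl

/-- The metric in the trivialization at `y₀`. -/
def metricInCoordinates (y₀ y : Y) : Model d →L[ℝ] CoModel d :=
  ContinuousLinearMap.inCoordinates (Model d) (TangentSpace (𝓡 d)) (CoModel d) (CotangentFibre d Y)
    y₀ y y₀ y (h.inner y)

lemma contMDiffAt_metricInCoordinates (y₀ : Y) :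
    ContMDiffAt (𝓡 d) 𝓘(ℝ, Model d →L[ℝ] CoModel d) ∞ (metricInCoordinates h y₀) y₀ :=
  ((contMDiffAt_hom_bundle _).mp (h.contMDiff y₀)).2

lemma metricInCoordinates_apply {y₀ y : Y} (hy : y ∈ (chartAt (Model d) y₀).source)
    (v w : Model d) :
    metricInCoordinates h y₀ y v w =
      h.inner y ((trivializationAt (Model d) (TangentSpace (𝓡 d)) y₀).symmL ℝ y v)
        ((trivializationAt (Model d) (TangentSpace (𝓡 d)) y₀).symmL ℝ y w) := by
  have hb : y ∈ (trivializationAt (CoModel d) (CotangentFibre d Y) y₀).baseSet :=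
    ⟨hy, mem_univ _⟩
  have h1 := hom_trivializationAt_apply (RingHom.id ℝ) (F₁ := Model d)
    (E₁ := (TangentSpace (𝓡 d) : Y → Type _)) (F₂ := ℝ) (E₂ := Bundle.Trivial Y ℝ) y₀
    ⟨y, h.inner y ((trivializationAt (Model d) (TangentSpace (𝓡 d)) y₀).symmL ℝ y v)⟩
  rw [metricInCoordinates, ContinuousLinearMap.inCoordinates]
  simp only [ContinuousLinearMap.comp_apply]
  rw [Trivialization.continuousLinearMapAt_apply_of_mem (R := ℝ) _ (hb := hb), h1, inCoordinates_cotangent]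
  rfl

lemma symmL_injective {y₀ y : Y} (hy : y ∈ (chartAt (Model d) y₀).source) {v : Model d}
    (hv : (trivializationAt (Model d) (TangentSpace (𝓡 d)) y₀).symmL ℝ y v = 0) : v = 0 := by
  have h1 := Trivialization.continuousLinearMapAt_symmL (R := ℝ)
    (trivializationAt (Model d) (TangentSpace (𝓡 d)) y₀) (b := y) hy v
  rw [← h1, hv, map_zero]

lemma metricInCoordinates_pos {y₀ y : Y} (hy : y ∈ (chartAt (Model d) y₀).source)
    {v : Model d} (hv : v ≠ 0) : 0 < metricInCoordinates h y₀ y v v := by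
  rw [metricInCoordinates_apply h hy]
  exact h.pos y _ fun h0 => hv (symmL_injective hy h0)

lemma isInvertible_metricInCoordinates {y₀ y : Y} (hy : y ∈ (chartAt (Model d) y₀).source) :
    (metricInCoordinates h y₀ y).IsInvertible := by
  refine isInvertible_of_nondegenerate _ fun v hv => ?_
  by_contra hne
  have h1 := metricInCoordinates_pos h hy hne
  rw [hv] at h1
  exact lt_irrefl _ h1

/-- The covector `p` in the trivialization at `y₀`. -/
def covectorInCoordinates (y₀ : Y) (p : Cotangent d Y) : CoModel d :=
  p.snd.comp ((trivializationAt (Model d) (TangentSpace (𝓡 d)) y₀).symmL ℝ p.proj)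

lemma contMDiffAt_covectorInCoordinates (p : Cotangent d Y) :
    ContMDiffAt (cotModel d) 𝓘(ℝ, CoModel d) ∞ (covectorInCoordinates p.proj) p := by
  have h1 := ((contMDiffAt_hom_bundle _).mp (contMDiffAt_id (I := cotModel d) (n := ∞) (x := p))).2
  refine h1.congr_of_eventuallyEq (Eventually.of_forall fun q => ?_)
  exact (inCoordinates_cotangent _ _ _).symm

lemma dualNormSq_eq_inCoordinates {y₀ : Y} {p : Cotangent d Y}
    (hp : p.proj ∈ (chartAt (Model d) y₀).source) :
    dualNormSq h p = covectorInCoordinates y₀ p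
      ((metricInCoordinates h y₀ p.proj).inverse (covectorInCoordinates y₀ p)) := by
  set e := trivializationAt (Model d) (TangentSpace (𝓡 d)) y₀ with he
  set v := (metricInCoordinates h y₀ p.proj).inverse (covectorInCoordinates y₀ p) with hvdef
  have hv : metricInCoordinates h y₀ p.proj v = covectorInCoordinates y₀ p :=
    (isInvertible_metricInCoordinates h hp).self_apply_inverse _
  refine dualNormSq_eq h (v := e.symmL ℝ p.proj v) ?_
  refine ContinuousLinearMap.ext fun w => ?_
  have h1 := e.symmL_continuousLinearMapAt (R := ℝ) (b := p.proj) hp w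
  have h2 := DFunLike.congr_fun hv (e.continuousLinearMapAt ℝ p.proj w)
  rw [metricInCoordinates_apply h hp, h1] at h2
  refine h2.trans ?_
  change p.snd (e.symmL ℝ p.proj (e.continuousLinearMapAt ℝ p.proj w)) = p.snd w
  rw [h1]

/-- In a trivialization the dual norm is `ξ(G⁻¹ξ)`, and inversion of operators is smooth at
invertible ones. -/
lemma contMDiff_dualNormSq : ContMDiff (cotModel d) 𝓘(ℝ, ℝ) ∞ (dualNormSq h) := by
  intro p
  have hsrc : p.proj ∈ (chartAt (Model d) p.proj).source := mem_chart_source _ _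
  have hξ := contMDiffAt_covectorInCoordinates p
  obtain ⟨e, he⟩ := isInvertible_metricInCoordinates h hsrc
  have hinv : ContMDiffAt 𝓘(ℝ, Model d →L[ℝ] CoModel d) 𝓘(ℝ, CoModel d →L[ℝ] Model d) ∞
      ContinuousLinearMap.inverse (metricInCoordinates h p.proj p.proj) := by
    rw [← he]
    exact (contDiffAt_map_inverse e).contMDiffAt
  have hG : ContMDiffAt (cotModel d) 𝓘(ℝ, CoModel d →L[ℝ] Model d) ∞
      (fun q : Cotangent d Y => (metricInCoordinates h p.proj q.proj).inverse) p :=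
    hinv.comp p ((contMDiffAt_metricInCoordinates h p.proj).comp p contMDiff_proj.contMDiffAt)
  have h1 := hξ.clm_apply (hG.clm_apply hξ)
  refine h1.congr_of_eventuallyEq ?_
  have hopen : TotalSpace.proj ⁻¹' (chartAt (Model d) p.proj).source ∈ 𝓝 p :=
    contMDiff_proj.continuous.continuousAt.preimage_mem_nhds
      ((chartAt (Model d) p.proj).open_source.mem_nhds hsrc)
  filter_upwards [hopen] with q hq
  exact dualNormSq_eq_inCoordinates h hq

lemma contMDiff_kineticEnergy : ContMDiff (cotModel d) 𝓘(ℝ, ℝ) ∞ (kineticEnergy h) :=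
  ((contDiff_const (c := (1 / 2 : ℝ))).mul contDiff_id).contMDiff.comp (contMDiff_dualNormSq h)

/-- With `v = G⁻¹ξ`, Cauchy–Schwarz gives `ξ(w)² ≤ ξ(v) G(w, w) ≤ ξ(v) ‖G‖ ‖w‖²`. Thus the dual norm
controls the coordinates of a covector, which is used for compactness of the energy sublevels. -/
lemma norm_covectorInCoordinates_sq_le {y₀ : Y} {p : Cotangent d Y}
    (hp : p.proj ∈ (chartAt (Model d) y₀).source) :
    ‖covectorInCoordinates y₀ p‖ ^ 2 ≤ ‖metricInCoordinates h y₀ p.proj‖ * dualNormSq h p := by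
  rw [dualNormSq_eq_inCoordinates h hp]
  set G := metricInCoordinates h y₀ p.proj with hG
  set ξ := covectorInCoordinates y₀ p with hξ
  set v := G.inverse ξ with hv
  have hGv : G v = ξ := (isInvertible_metricInCoordinates h hp).self_apply_inverse _
  have hsymm : ∀ a b, G a b = G b a := fun a b => by
    rw [hG, metricInCoordinates_apply h hp, metricInCoordinates_apply h hp, h.symm]
  have hnn : ∀ a, 0 ≤ G a a := fun a => by
    by_cases h0 : a = 0
    · simp [h0]
    · exact (metricInCoordinates_pos h hp h0).le
  have hvv : ξ v = G v v := by rw [hGv]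
  -- the Cauchy-Schwarz inequality
  have hcs : ∀ w, ξ w ^ 2 ≤ ξ v * G w w := by
    intro w
    have hq : ∀ t : ℝ, 0 ≤ G w w * (t * t) + 2 * G v w * t + G v v := fun t => by
      have := hnn (v + t • w)
      simp only [map_add, map_smul, add_apply, smul_apply, smul_eq_mul, hsymm w v] at this
      linarith
    have := discrim_le_zero hq
    rw [discrim] at this
    rw [hvv, ← hGv]
    nlinarith
  have hv0 : 0 ≤ ‖G‖ * ξ v := mul_nonneg (ContinuousLinearMap.opNorm_nonneg G) (hvv ▸ hnn v)
  have hnorm : ‖ξ‖ ≤ Real.sqrt (‖G‖ * ξ v) := by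
    refine ξ.opNorm_le_bound (Real.sqrt_nonneg _) fun w => ?_
    rw [Real.norm_eq_abs]
    refine abs_le_of_sq_le_sq ?_ (by positivity)
    rw [mul_pow, Real.sq_sqrt hv0]
    have h1 : G w w ≤ ‖G‖ * ‖w‖ ^ 2 := by
      have := (le_abs_self _).trans ((G w).le_of_opNorm_le (G.le_opNorm w) w)
      nlinarith
    have h2 := hcs w
    have h3 : 0 ≤ ξ v := hvv ▸ hnn v
    nlinarith
  calc ‖ξ‖ ^ 2 ≤ Real.sqrt (‖G‖ * ξ v) ^ 2 := by gcongr
    _ = _ := Real.sq_sqrt hv0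

/-- An ultrafilter on the sublevel converges in the compact base. In the trivialization at the limit
point its covectors are eventually bounded, so they converge too. -/
lemma isCompact_dualNormSq_le [CompactSpace Y] (R : ℝ) :
    IsCompact {p : Cotangent d Y | dualNormSq h p ≤ R} := by
  rw [isCompact_iff_ultrafilter_le_nhds]
  intro F hF
  have hF' : ∀ᶠ p : Cotangent d Y in F, dualNormSq h p ≤ R := le_principal_iff.mp hF
  obtain ⟨y₀, -, hy₀⟩ := isCompact_univ.ultrafilter_le_nhds (F.map TotalSpace.proj)
    (by simp)
  have hproj : Tendsto (TotalSpace.proj : Cotangent d Y → Y) F (𝓝 y₀) := hy₀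
  set e := trivializationAt (CoModel d) (CotangentFibre d Y) y₀ with he
  have hsrc : ∀ᶠ p : Cotangent d Y in F, p.proj ∈ (chartAt (Model d) y₀).source :=
    hproj.eventually ((chartAt (Model d) y₀).open_source.mem_nhds (mem_chart_source _ _))
  have hcont : ContinuousAt (fun y => ‖metricInCoordinates h y₀ y‖) y₀ :=
    ContinuousAt.comp (g := fun G : Model d →L[ℝ] CoModel d => ‖G‖)
      (continuous_norm (E := Model d →L[ℝ] CoModel d)).continuousAt
      (contMDiffAt_metricInCoordinates h y₀).continuousAt
  have hnb : ∀ᶠ p : Cotangent d Y in F, ‖metricInCoordinates h y₀ p.proj‖ <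
      ‖metricInCoordinates h y₀ y₀‖ + 1 :=
    hproj.eventually (hcont.eventually (gt_mem_nhds (lt_add_one _)))
  set C := Real.sqrt ((‖metricInCoordinates h y₀ y₀‖ + 1) * R) with hC
  have hball : ∀ᶠ p : Cotangent d Y in F, covectorInCoordinates y₀ p ∈ Metric.closedBall (0 : CoModel d) C := by
    filter_upwards [hF', hsrc, hnb] with p h1 h2 h3
    rw [mem_closedBall_zero_iff]
    refine Real.le_sqrt_of_sq_le ((norm_covectorInCoordinates_sq_le h h2).trans ?_)
    exact mul_le_mul h3.le h1 (dualNormSq_nonneg h p) (by positivity)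
  obtain ⟨ξ, -, hξ⟩ := (isCompact_closedBall (0 : CoModel d) C).ultrafilter_le_nhds
    (F.map (covectorInCoordinates y₀)) (le_principal_iff.mpr hball)
  have hξ' : Tendsto (covectorInCoordinates (d := d) y₀) F (𝓝 ξ) := hξ
  have hpair : Tendsto (fun p : Cotangent d Y => (p.proj, covectorInCoordinates y₀ p)) F
      (𝓝 (y₀, ξ)) := hproj.prodMk_nhds hξ'
  have hbase : y₀ ∈ e.baseSet := FiberBundle.mem_baseSet_trivializationAt' _
  have hmem : (y₀, ξ) ∈ e.target := e.mem_target.mpr hbase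
  have hcont : ContinuousAt e.toOpenPartialHomeomorph.symm (y₀, ξ) :=
    e.toOpenPartialHomeomorph.continuousAt_symm hmem
  have hlim : Tendsto (fun p : Cotangent d Y => p) F
      (𝓝 (e.toOpenPartialHomeomorph.symm (y₀, ξ))) := by
    refine (hcont.tendsto.comp hpair).congr' ?_
    filter_upwards [hsrc] with p hp
    have h1 := hom_trivializationAt_apply (RingHom.id ℝ) (F₁ := Model d)
      (E₁ := (TangentSpace (𝓡 d) : Y → Type _)) (F₂ := ℝ) (E₂ := Bundle.Trivial Y ℝ) y₀ p
    rw [inCoordinates_cotangent] at h1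
    have h2 : p ∈ e.source := e.mem_source.mpr ⟨hp, mem_univ _⟩
    have h3 := e.toOpenPartialHomeomorph.left_inv h2
    rw [Function.comp_apply]
    refine Eq.trans ?_ h3
    congr 1
    exact h1.symm
  refine ⟨_, ?_, hlim⟩
  exact isClosed_le (contMDiff_dualNormSq h).continuous continuous_const |>.mem_of_tendsto hlim hF'

end DualNorm

/-! ### The cogeodesic flow -/

section GeodesicFlow

set_option synthInstance.maxHeartbeats 200000

variable {d : ℕ} {Y : Type*} [TopologicalSpace Y] [ChartedSpace (Model d) Y]
  [IsManifold (𝓡 d) ∞ Y] (h : SmoothMetric d Y)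

lemma isBicharacteristic_iff {γ : ℝ → Cotangent d Y} :
    IsBicharacteristic h γ ↔
      IsMIntegralCurve (I := cotModel d) γ (hamField (kineticEnergy h)) := by
  constructor
  · rintro ⟨V, hV, hγ⟩
    rwa [hV.eq_hamField] at hγ
  · exact fun hγ => ⟨_, isHamiltonField_hamField _, hγ⟩

lemma contMDiff_geodesicField : ContMDiff (cotModel d) (cotModel d).tangent ∞
    (fun p => (⟨p, hamField (kineticEnergy h) p⟩ : TangentBundle (cotModel d) (Cotangent d Y))) :=
  contMDiff_hamField (contMDiff_kineticEnergy h)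

lemma dualNormSq_eq_of_kineticEnergy_eq {p q : Cotangent d Y}
    (hpq : kineticEnergy h p = kineticEnergy h q) : dualNormSq h p = dualNormSq h q := by
  unfold kineticEnergy at hpq
  linarith

/-- The field is cut off outside a compact energy sublevel, which makes it complete. Energy is also
conserved by the cut-off field, so the integral curve stays where the cut-off equals `1` and solves
the original equation. -/
lemma exists_geodesic [T2Space Y] [CompactSpace Y] (p : Cotangent d Y) :
    ∃ γ : ℝ → Cotangent d Y, γ 0 = p ∧
      IsMIntegralCurve (I := cotModel d) γ (hamField (kineticEnergy h)) := by
  set N := dualNormSq h p with hN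
  -- `χ` is `1` where `|μ|² ≤ N + 1` and `0` where `|μ|² ≥ N + 2`.
  let χ : Cotangent d Y → ℝ := fun q => Real.smoothTransition (N + 2 - dualNormSq h q)
  have hχ : ContMDiff (cotModel d) 𝓘(ℝ, ℝ) ∞ χ := by
    have h1 : ContDiff ℝ ∞ fun x : ℝ => Real.smoothTransition (N + 2 - x) :=
      Real.smoothTransition.contDiff.comp (contDiff_const.sub contDiff_id)
    exact h1.contMDiff.comp (contMDiff_dualNormSq h)
  obtain ⟨γ, hγ0, hγ⟩ := exists_isMIntegralCurve_of_compact_support (I := cotModel d)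
    (v := fun q => χ q • hamField (kineticEnergy h) q)
    (hχ.smul_section (contMDiff_geodesicField h)) (isCompact_dualNormSq_le h (N + 2))
    (fun q hq => by
      have h1 : χ q = 0 := Real.smoothTransition.zero_of_nonpos (by
        have : N + 2 < dualNormSq h q := not_le.mp hq
        linarith)
      change χ q • hamField (kineticEnergy h) q = 0
      rw [h1, zero_smul]) p
  refine ⟨γ, hγ0, fun t => ?_⟩
  have h1 : dualNormSq h (γ t) = N := by
    have := eq_of_isMIntegralCurve_hamField (contMDiff_kineticEnergy h) hγ t 0
    rw [dualNormSq_eq_of_kineticEnergy_eq h this, hγ0]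
  have h2 : χ (γ t) = 1 := Real.smoothTransition.one_of_one_le (by rw [h1]; linarith)
  have h3 := hγ t
  simp only [h2, one_smul] at h3
  exact h3

lemma IsBicharacteristic.dualNormSq_eq {h : SmoothMetric d Y} {γ : ℝ → Cotangent d Y}
    (hγ : IsBicharacteristic h γ) (s t : ℝ) : dualNormSq h (γ s) = dualNormSq h (γ t) := by
  have h1 : IsMIntegralCurve (I := cotModel d) γ
      (fun p => (1 : ℝ) • hamField (kineticEnergy h) p) := by
    simpa using (isBicharacteristic_iff h).mp hγ
  exact dualNormSq_eq_of_kineticEnergy_eq h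
    (eq_of_isMIntegralCurve_hamField (c := fun _ => 1) (contMDiff_kineticEnergy h) h1 s t)

/-- The dilation of the fibre directions by `c`. -/
def fibreDilation (c : ℝ) : (Model d × CoModel d) →L[ℝ] (Model d × CoModel d) :=
  (ContinuousLinearMap.id ℝ (Model d)).prodMap (c • ContinuousLinearMap.id ℝ (CoModel d))

lemma stdSymplectic_fibreDilation (c : ℝ) (v w : Model d × CoModel d) :
    stdSymplectic d (fibreDilation c (c • v)) (fibreDilation c w) =
      c ^ 2 * stdSymplectic d v w := by
  change (c • w.2) (c • v.1) - (c • c • v.2) w.1 = c ^ 2 * (w.2 v.1 - v.2 w.1)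
  simp only [smul_apply, map_smul, smul_eq_mul]
  ring

/-- In canonical coordinates, fibre multiplication is itself the linear map `fibreDilation c`. -/
lemma hasMFDerivAt_fibreSmul (c : ℝ) (p : Cotangent d Y) :
    HasMFDerivAt (cotModel d) (cotModel d) (fibreSmul c) p (fibreDilation c) := by
  have hcont : Continuous (fibreSmul (d := d) (Y := Y) c) :=
    contMDiff_fibreSmul.continuous.comp (Continuous.prodMk_right c)
  refine ⟨hcont.continuousAt, ?_⟩
  have h1 : HasFDerivAt (fun z => extChartAt (cotModel d) (fibreSmul c p)
      (fibreSmul c ((extChartAt (cotModel d) p).symm z))) (fibreDilation (d := d) c)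
      (extChartAt (cotModel d) p p) := by
    refine (fibreDilation (d := d) c).hasFDerivAt.congr_of_eventuallyEq ?_
    filter_upwards [(isOpen_extChartAt_target (I := cotModel d) p).mem_nhds
      (mem_extChartAt_target p)] with z hz
    have h2 := (extChartAt (cotModel d) p).right_inv hz
    rw [extChartAt_cotangent_apply] at h2 ⊢
    exact congrArg (fibreDilation (d := d) c) h2
  exact h1.hasFDerivWithinAt

/-- Under dilation by `c` the energy scales by `c²` and the symplectic form by `c`. The Hamilton
field is therefore pushed forward with one remaining factor `c`. -/
lemma hamField_fibreSmul {c : ℝ} (hc : c ≠ 0) (p : Cotangent d Y) :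
    (hamField (kineticEnergy h) (fibreSmul c p) : Model d × CoModel d) =
      fibreDilation c (c • (hamField (kineticEnergy h) p : Model d × CoModel d)) := by
  have hE := (contMDiff_kineticEnergy h).mdifferentiable (by simp)
  have hcomp : kineticEnergy h ∘ fibreSmul c = fun q => c ^ 2 * kineticEnergy h q := by
    funext q
    simp only [Function.comp_apply, kineticEnergy, dualNormSq_fibreSmul]
    ring
  have h1 := (hE (fibreSmul c p)).hasMFDerivAt.comp p (hasMFDerivAt_fibreSmul c p)
  have h2 := (hE p).hasMFDerivAt.const_smul (c ^ 2)
  rw [hcomp] at h1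
  have h3 := hasMFDerivAt_unique h1 h2
  refine stdSymplectic_injective (d := d) (ContinuousLinearMap.ext fun w => ?_)
  obtain ⟨w', rfl⟩ : ∃ w', fibreDilation (d := d) c w' = w :=
    ⟨fibreDilation c⁻¹ w, by
      refine Prod.ext rfl ?_
      change c • c⁻¹ • w.2 = w.2
      rw [smul_inv_smul₀ hc]⟩
  have h4 : stdSymplectic d (hamField (kineticEnergy h) (fibreSmul c p)) (fibreDilation c w') =
      c ^ 2 * stdSymplectic d (hamField (kineticEnergy h) p) w' := by
    refine (isHamiltonField_hamField (kineticEnergy h) (fibreSmul c p) _).symm.trans ?_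
    refine (DFunLike.congr_fun h3 w').trans ?_
    exact congrArg (fun x : ℝ => c ^ 2 * x) (isHamiltonField_hamField (kineticEnergy h) p w')
  exact h4.trans (stdSymplectic_fibreDilation c _ w').symm

/-- The energy attains its minimum on the zero section, so its differential vanishes there. -/
lemma hamField_eq_zero {p : Cotangent d Y} (hp : p.snd = 0) :
    hamField (kineticEnergy h) p = 0 := by
  have h1 : mfderiv (cotModel d) 𝓘(ℝ, ℝ) (kineticEnergy h) p = 0 := by
    refine ContinuousLinearMap.ext fun w => ?_
    refine (mfderiv_cotangent_eq (contMDiff_kineticEnergy h) (mem_extChartAt_source p) w).trans ?_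
    have hmin : IsLocalMin (kineticEnergy h ∘ (extChartAt (cotModel d) p).symm)
        (extChartAt (cotModel d) p p) := by
      refine Eventually.of_forall fun z => ?_
      simp only [Function.comp_apply, extChartAt_to_inv, kineticEnergy]
      rw [(dualNormSq_eq_zero h).mpr hp]
      have := dualNormSq_nonneg h ((extChartAt (cotModel d) p).symm z)
      linarith
    rw [hmin.fderiv_eq_zero]
    rfl
  change (stdSymplectic d).inverse (mfderiv (cotModel d) 𝓘(ℝ, ℝ) (kineticEnergy h) p) = 0
  rw [h1]
  exact map_zero (stdSymplectic d).inverse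

variable [T2Space Y] [CompactSpace Y]

/-- The cogeodesic flow `exp (t H)`, `H` the Hamilton vector field of `½ |μ|²`. -/
def geodesicFlow (t : ℝ) (p : Cotangent d Y) : Cotangent d Y :=
  (exists_geodesic h p).choose t

lemma geodesicFlow_zero (p : Cotangent d Y) : geodesicFlow h 0 p = p :=
  (exists_geodesic h p).choose_spec.1

lemma isMIntegralCurve_geodesicFlow (p : Cotangent d Y) :
    IsMIntegralCurve (I := cotModel d) (fun t => geodesicFlow h t p)
      (hamField (kineticEnergy h)) :=
  (exists_geodesic h p).choose_spec.2

lemma isBicharacteristic_geodesicFlow (p : Cotangent d Y) :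
    IsBicharacteristic h (fun t => geodesicFlow h t p) :=
  (isBicharacteristic_iff h).mpr (isMIntegralCurve_geodesicFlow h p)

lemma contMDiff_geodesicFlow : ContMDiff (𝓘(ℝ, ℝ).prod (cotModel d)) (cotModel d) ∞
    (fun z : ℝ × Cotangent d Y => geodesicFlow h z.1 z.2) :=
  contMDiff_flow (contMDiff_geodesicField h) (geodesicFlow h) (geodesicFlow_zero h)
    (isMIntegralCurve_geodesicFlow h)

lemma IsBicharacteristic.eq_geodesicFlow {h} {γ : ℝ → Cotangent d Y}
    (hγ : IsBicharacteristic h γ) (s t : ℝ) : γ (s + t) = geodesicFlow h s (γ t) := by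
  have h1 : IsMIntegralCurve (I := cotModel d) (fun s => γ (s + t)) (hamField (kineticEnergy h)) :=
    ((isBicharacteristic_iff h).mp hγ).comp_add t
  exact congrFun (isMIntegralCurve_Ioo_eq_of_contMDiff_boundaryless (t₀ := 0)
    ((contMDiff_geodesicField h).of_le (mod_cast le_top)) h1
    (isMIntegralCurve_geodesicFlow h (γ t)) (by simp [geodesicFlow_zero])) s

lemma geodesicFlow_of_snd_eq_zero {p : Cotangent d Y} (hp : p.snd = 0) (t : ℝ) :
    geodesicFlow h t p = p := by
  have h1 : IsBicharacteristic h (fun _ => p) :=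
    (isBicharacteristic_iff h).mpr (isMIntegralCurve_const (hamField_eq_zero h hp))
  exact (h1.eq_geodesicFlow t 0).symm

/-- Homogeneity of the cogeodesic flow. -/
lemma geodesicFlow_fibreSmul {c : ℝ} (hc : c ≠ 0) (t : ℝ) (p : Cotangent d Y) :
    geodesicFlow h t (fibreSmul c p) = fibreSmul c (geodesicFlow h (t * c) p) := by
  have h1 : IsBicharacteristic h (fun t => fibreSmul c (geodesicFlow h (t * c) p)) := by
    refine (isBicharacteristic_iff h).mpr fun t => ?_
    have h2 := (isMIntegralCurve_geodesicFlow h p).comp_mul c t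
    have h3 := (hasMFDerivAt_fibreSmul c (geodesicFlow h (t * c) p)).comp t h2
    refine h3.congr_mfderiv ?_
    refine ContinuousLinearMap.ext fun (a : ℝ) => ?_
    exact (map_smul (fibreDilation (d := d) c) a _).trans
      (congrArg (fun x : Model d × CoModel d => a • x) (hamField_fibreSmul h hc _).symm)
  have h4 := h1.eq_geodesicFlow t 0
  simp only [add_zero, zero_mul, geodesicFlow_zero] at h4
  exact h4.symm

end GeodesicFlow

/-- Near `0`, `arcsin x = x a(x²)` with a smooth function `a`. -/
lemma exists_arcsin_eq_mul : ∃ a : ℝ → ℝ, ContDiff ℝ ∞ a ∧ ∃ δ > 0, δ ≤ 1 ∧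
    ∀ x : ℝ, x ^ 2 < δ → Real.arcsin x = x * a (x ^ 2) := by
  have hf : ContDiffOn ℝ ∞ (fun x : ℝ => 1 / Real.sqrt (1 - x)) (Iio 1) := by
    intro x hx
    have hpos : 0 < 1 - x := sub_pos.mpr hx
    have h1 : ContDiffAt ℝ ∞ (fun x : ℝ => Real.sqrt (1 - x)) x :=
      (contDiffAt_const.sub contDiffAt_id).sqrt hpos.ne'
    exact (contDiffAt_const.div h1 (Real.sqrt_ne_zero'.mpr hpos)).contDiffWithinAt
  obtain ⟨g, hg, hgf⟩ := exists_contDiff_eventuallyEq (Iio_mem_nhds zero_lt_one) hf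
  obtain ⟨δ, hδ, hball⟩ := Metric.eventually_nhds_iff.mp hgf
  let sq : C(unitInterval, ℝ) := ⟨fun t => (t : ℝ) ^ 2, by fun_prop⟩
  -- From `arcsin x = ∫₀¹ x (1 - x²t²)^(-1/2) dt` one reads off `a(u) = ∫₀¹ g(u t²) dt`, where `g`
  -- is a smooth extension of `(1 - x)^(-1/2)` from a neighbourhood of `0`. Smoothness follows by
  -- composing with the superposition operator.
  let a : ℝ → ℝ := fun u =>
    (ContinuousMap.evalCLM ℝ (1 : unitInterval) : C(unitInterval, ℝ) →L[ℝ] ℝ)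
      (primitive ℝ (superpose g hg.continuous (u • sq)))
  refine ⟨a, ?_, min δ 1, by positivity, min_le_right _ _, fun x hx => ?_⟩
  · exact (ContinuousMap.evalCLM ℝ (1 : unitInterval) : C(unitInterval, ℝ) →L[ℝ] ℝ).contDiff.comp
      ((primitive ℝ).contDiff.comp ((contDiff_superpose g hg).comp
        (contDiff_id.smul contDiff_const)))
  · obtain ⟨hxδ, hx1⟩ := lt_min_iff.mp hx
    have hlt : ∀ t ∈ uIcc (0 : ℝ) 1, (x * t) ^ 2 ≤ x ^ 2 := fun t ht => by
      rw [uIcc_of_le zero_le_one] at ht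
      rw [mul_pow]
      have : t ^ 2 ≤ 1 := pow_le_one₀ ht.1 ht.2
      nlinarith [sq_nonneg x]
    have hd : ∀ t ∈ uIcc (0 : ℝ) 1,
        HasDerivAt (fun t => Real.arcsin (x * t)) (x * (1 / Real.sqrt (1 - (x * t) ^ 2))) t := by
      intro t ht
      have h1 : |x * t| < 1 := (sq_lt_one_iff_abs_lt_one _).mp ((hlt t ht).trans_lt hx1)
      rw [abs_lt] at h1
      have h2 : HasDerivAt (fun t : ℝ => x * t) x t := by
        simpa using (hasDerivAt_id t).const_mul x
      have h3 := (Real.hasDerivAt_arcsin h1.1.ne' h1.2.ne).comp t h2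
      rw [mul_comm x]
      exact h3
    have hcont : ContinuousOn (fun t => x * (1 / Real.sqrt (1 - (x * t) ^ 2))) (uIcc 0 1) := by
      refine continuousOn_const.mul (continuousOn_const.div (by fun_prop) fun t ht => ?_)
      have := hlt t ht
      exact Real.sqrt_ne_zero'.mpr (by linarith)
    have hint := intervalIntegral.integral_eq_sub_of_hasDerivAt hd hcont.intervalIntegrable
    rw [mul_one, mul_zero, Real.arcsin_zero, sub_zero] at hint
    rw [← hint, intervalIntegral.integral_const_mul]
    congr 1
    change _ = ∫ u in (0 : ℝ)..(1 : unitInterval),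
      g (x ^ 2 * ((projIcc (0 : ℝ) 1 zero_le_one u : unitInterval) : ℝ) ^ 2)
    refine intervalIntegral.integral_congr fun t ht => ?_
    have h1 := hlt t ht
    rw [uIcc_of_le zero_le_one] at ht
    rw [projIcc_of_mem zero_le_one ht]
    change 1 / Real.sqrt (1 - (x * t) ^ 2) = g (x ^ 2 * t ^ 2)
    rw [← mul_pow, hball (y := (x * t) ^ 2)]
    rw [Real.dist_eq, sub_zero, abs_of_nonneg (sq_nonneg _)]
    linarith

/-! ### Submanifolds given as graphs -/

section Curves

variable {E : Type*} [NormedAddCommGroup E] [NormedSpace ℝ E] {H : Type*} [TopologicalSpace H]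
  {I : ModelWithCorners ℝ E H} {M : Type*} [TopologicalSpace M] [ChartedSpace H M]
  {W : Type*} [NormedAddCommGroup W] [NormedSpace ℝ W]

/-- The differential of `F` takes the value of the derivative of `F` along a curve. -/
lemma exists_hasDerivAt_comp_curve {F : M → W} {q : M} (hF : MDifferentiableAt I 𝓘(ℝ, W) F q)
    {β : ℝ → M} (hβ : MDifferentiableAt 𝓘(ℝ, ℝ) I β 0) (h0 : β 0 = q) :
    ∃ u : TangentSpace I q, HasDerivAt (F ∘ β) (mfderiv I 𝓘(ℝ, W) F q u) 0 := by
  subst h0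
  refine ⟨mfderiv 𝓘(ℝ, ℝ) I β 0 (1 : ℝ), ?_⟩
  have h1 := hF.hasMFDerivAt.comp 0 hβ.hasMFDerivAt
  have h2 : ∃ L : ℝ →L[ℝ] W, HasFDerivAt (F ∘ β) L 0 ∧
      L 1 = mfderiv I 𝓘(ℝ, W) F (β 0) (mfderiv 𝓘(ℝ, ℝ) I β 0 (1 : ℝ)) :=
    ⟨_, hasMFDerivAt_iff_hasFDerivAt.mp h1, rfl⟩
  obtain ⟨L, hL, hL1⟩ := h2
  exact hL1 ▸ hL.hasDerivAt

lemma hasMFDerivAt_prodMk_space {W' : Type*} [NormedAddCommGroup W'] [NormedSpace ℝ W']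
    {f : M → W} {g : M → W'} {q : M} {f' : TangentSpace I q →L[ℝ] W}
    {g' : TangentSpace I q →L[ℝ] W'} (hf : HasMFDerivAt I 𝓘(ℝ, W) f q f')
    (hg : HasMFDerivAt I 𝓘(ℝ, W') g q g') :
    HasMFDerivAt I 𝓘(ℝ, W × W') (fun x => (f x, g x)) q (f'.prod g') :=
  ⟨hf.1.prodMk hg.1, hf.2.prodMk hg.2⟩

end Curves

section Graph

set_option synthInstance.maxHeartbeats 200000

variable {d : ℕ} {Y : Type*} [TopologicalSpace Y] [ChartedSpace (Model d) Y]
  [IsManifold (𝓡 d) ∞ Y]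

/-- Replace the last component of a point of the phase space. -/
def setLast (q : PhaseSpace d Y) (t : Cotangent d Y) : PhaseSpace d Y :=
  (q.1, q.2.1, (q.2.2.1, t))

variable {C : Type*} [NormedAddCommGroup C] [NormedSpace ℝ C] [FiniteDimensional ℝ C]

lemma contMDiff_last : ContMDiff (phaseModel d) (cotModel d) ∞
    (fun q : PhaseSpace d Y => q.2.2.2) :=
  contMDiff_snd.comp (contMDiff_snd.comp contMDiff_snd)

set_option maxHeartbeats 1000000 in
/-- A subset of the phase space is a submanifold if it is given by equations `c = 0` for the other
components and a formula `q.2.2.2 = g q` for the last one. -/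
lemma isSubmanifoldAt_of_graph {k : ℕ} (hk : Module.finrank ℝ C + 2 * d = k)
    {S U : Set (PhaseSpace d Y)} {p : PhaseSpace d Y} (hU : IsOpen U) (hpU : p ∈ U) (hpS : p ∈ S)
    {c : PhaseSpace d Y → C} {g : PhaseSpace d Y → Cotangent d Y}
    (hc : ContMDiffOn (phaseModel d) 𝓘(ℝ, C) ∞ c U)
    (hg : ContMDiffOn (phaseModel d) (cotModel d) ∞ g U)
    (hc' : ∀ q t, c (setLast q t) = c q) (hg' : ∀ q t, g (setLast q t) = g q)
    (hsurj : ∀ q ∈ U, ∀ a : C, ∃ u, mfderiv (phaseModel d) 𝓘(ℝ, C) c q u = a)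
    (hS : ∀ q ∈ U, q ∈ S ↔ c q = 0 ∧ q.2.2.2 = g q) :
    IsSubmanifoldAt (phaseModel d) k S p := by
  set κ := extChartAt (cotModel d) p.2.2.2 with hκ
  have hsrc : IsOpen κ.source := isOpen_extChartAt_source _
  have hgp : g p = p.2.2.2 := ((hS p hpU).mp hpS).2.symm
  let U' : Set (PhaseSpace d Y) := (U ∩ g ⁻¹' κ.source) ∩ (fun q => q.2.2.2) ⁻¹' κ.source
  have hU' : IsOpen U' := (hg.continuousOn.isOpen_inter_preimage hU hsrc).inter
    (hsrc.preimage contMDiff_last.continuous)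
  let F₂ : PhaseSpace d Y → Model d × CoModel d := fun q => κ q.2.2.2 - κ (g q)
  have hκs : ContMDiffOn (cotModel d) 𝓘(ℝ, Model d × CoModel d) ∞ κ κ.source := by
    rw [hκ, extChartAt_source]
    exact contMDiffOn_extChartAt
  have hF₂ : ContMDiffOn (phaseModel d) 𝓘(ℝ, Model d × CoModel d) ∞ F₂ U' :=
    (hκs.comp contMDiff_last.contMDiffOn (fun q hq => hq.2)).sub
      (hκs.comp (hg.mono fun q hq => hq.1.1) (fun q hq => hq.1.2))
  have hF : ContMDiffOn (phaseModel d) 𝓘(ℝ, C × (Model d × CoModel d)) ∞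
      (fun q => (c q, F₂ q)) U' := (hc.mono fun q hq => hq.1.1).prodMk_space hF₂
  have hrank : Module.finrank ℝ (C × (Model d × CoModel d)) =
      Module.finrank ℝ (EuclideanSpace ℝ (Fin k)) := by
    have h1 : Module.finrank ℝ (CoModel d) = d := by
      rw [← (LinearMap.toContinuousLinearMap (𝕜 := ℝ) (E := Model d) (F' := ℝ)).finrank_eq]
      exact (Subspace.dual_finrank_eq (K := ℝ) (V := Model d)).trans finrank_euclideanSpace_fin
    rw [Module.finrank_prod, Module.finrank_prod, h1, finrank_euclideanSpace_fin,
      finrank_euclideanSpace_fin]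
    omega
  let e : (C × (Model d × CoModel d)) ≃L[ℝ] EuclideanSpace ℝ (Fin k) :=
    ContinuousLinearEquiv.ofFinrankEq hrank
  refine ⟨U', hU', ⟨⟨hpU, ?_⟩, mem_extChartAt_source _⟩, fun q => e (c q, F₂ q), ?_, ?_, ?_⟩
  · rw [mem_preimage, hgp]
    exact mem_extChartAt_source _
  · exact e.contDiff.contMDiff.comp_contMDiffOn hF
  · intro q hq
    have hnhds := hU'.mem_nhds hq
    have hcq : MDifferentiableAt (phaseModel d) 𝓘(ℝ, C) c q :=
      ((hc.mono fun q hq => hq.1.1).contMDiffAt hnhds).mdifferentiableAt (by simp)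
    have hF₂q : MDifferentiableAt (phaseModel d) 𝓘(ℝ, Model d × CoModel d) F₂ q :=
      (hF₂.contMDiffAt hnhds).mdifferentiableAt (by simp)
    have hD : HasMFDerivAt (phaseModel d) 𝓘(ℝ, EuclideanSpace ℝ (Fin k))
        (fun q => e (c q, F₂ q)) q ((e : (C × (Model d × CoModel d)) →L[ℝ] EuclideanSpace ℝ (Fin k)).comp
          ((mfderiv (phaseModel d) 𝓘(ℝ, C) c q).prod
            (mfderiv (phaseModel d) 𝓘(ℝ, Model d × CoModel d) F₂ q))) :=
      (e.hasFDerivAt.hasMFDerivAt).comp q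
        (hasMFDerivAt_prodMk_space hcq.hasMFDerivAt hF₂q.hasMFDerivAt)
    rw [hD.mfderiv]
    intro w
    -- The differential is triangular. `u₁` produces the `C` component, and a vector moving only the
    -- last component of the phase space then corrects the second one. Neither `c` nor `g` sees that
    -- motion.
    obtain ⟨u₁, hu₁⟩ := hsurj q hq.1.1 (e.symm w).1
    set b : Model d × CoModel d := mfderiv (phaseModel d) 𝓘(ℝ, Model d × CoModel d) F₂ q u₁
      with hb
    -- a curve that moves only the last component
    let β : ℝ → PhaseSpace d Y := fun s =>
      setLast q (κ.symm (κ q.2.2.2 + s • ((e.symm w).2 - b)))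
    have hx : κ q.2.2.2 ∈ κ.target := κ.map_source hq.2
    have hopen : IsOpen κ.target := isOpen_extChartAt_target _
    have hline : ContDiff ℝ ∞ fun s : ℝ => κ q.2.2.2 + s • ((e.symm w).2 - b) :=
      contDiff_const.add (contDiff_id.smul contDiff_const)
    have hmem : ∀ᶠ s in 𝓝 (0 : ℝ), κ q.2.2.2 + s • ((e.symm w).2 - b) ∈ κ.target :=
      hline.continuous.continuousAt.eventually_mem (hopen.mem_nhds (by simpa using hx))
    have hβ0 : β 0 = q := by
      simp only [β, zero_smul, add_zero, κ.left_inv hq.2]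
      rfl
    have hβ : MDifferentiableAt 𝓘(ℝ, ℝ) (phaseModel d) β 0 := by
      have h1 : ContMDiffAt 𝓘(ℝ, ℝ) (cotModel d) ∞
          (fun s : ℝ => κ.symm (κ q.2.2.2 + s • ((e.symm w).2 - b))) 0 :=
        ((contMDiffOn_extChartAt_symm _).contMDiffAt (hopen.mem_nhds (by simpa using hx))).comp
          (0 : ℝ) hline.contMDiff.contMDiffAt
      have h2 : ContMDiffAt 𝓘(ℝ, ℝ) (phaseModel d) ∞ β 0 :=
        contMDiffAt_const.prodMk (contMDiffAt_const.prodMk (contMDiffAt_const.prodMk h1))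
      exact h2.mdifferentiableAt (by simp)
    have hFq : MDifferentiableAt (phaseModel d) 𝓘(ℝ, C × (Model d × CoModel d))
        (fun q => (c q, F₂ q)) q := (hF.contMDiffAt hnhds).mdifferentiableAt (by simp)
    obtain ⟨u, hu⟩ := exists_hasDerivAt_comp_curve hFq hβ hβ0
    have hval : HasDerivAt ((fun q => (c q, F₂ q)) ∘ β) ((0 : C), (e.symm w).2 - b) 0 := by
      have h3 : HasDerivAt (fun s : ℝ => κ q.2.2.2 + s • ((e.symm w).2 - b) - κ (g q))
          ((e.symm w).2 - b) 0 := by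
        have := (((hasDerivAt_id (0 : ℝ)).smul_const ((e.symm w).2 - b)).const_add
          (κ q.2.2.2)).sub_const (κ (g q))
        rwa [one_smul] at this
      refine ((hasDerivAt_const (0 : ℝ) (c q)).prodMk h3).congr_of_eventuallyEq ?_
      filter_upwards [hmem] with s hs
      refine Prod.ext (hc' _ _) ?_
      change κ (κ.symm _) - κ (g (setLast _ _)) = _
      rw [κ.right_inv hs, hg']
    have huu : mfderiv (phaseModel d) 𝓘(ℝ, C × (Model d × CoModel d))
        (fun q => (c q, F₂ q)) q u = ((0 : C), (e.symm w).2 - b) := hu.unique hval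
    have hprod : ∀ v : TangentSpace (phaseModel d) q, mfderiv (phaseModel d)
        𝓘(ℝ, C × (Model d × CoModel d)) (fun q => (c q, F₂ q)) q v =
        ((mfderiv (phaseModel d) 𝓘(ℝ, C) c q v : C),
          (mfderiv (phaseModel d) 𝓘(ℝ, Model d × CoModel d) F₂ q v : Model d × CoModel d)) :=
      fun v => DFunLike.congr_fun
        (hasMFDerivAt_prodMk_space hcq.hasMFDerivAt hF₂q.hasMFDerivAt).mfderiv v
    have hcu : (mfderiv (phaseModel d) 𝓘(ℝ, C) c q u : C) = 0 :=
      congrArg Prod.fst ((hprod u).symm.trans huu)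
    have hFu : (mfderiv (phaseModel d) 𝓘(ℝ, Model d × CoModel d) F₂ q u : Model d × CoModel d)
        = (e.symm w).2 - b := congrArg Prod.snd ((hprod u).symm.trans huu)
    refine ⟨u₁ + u, ?_⟩
    have h4 : (mfderiv (phaseModel d) 𝓘(ℝ, C) c q (u₁ + u) : C) = (e.symm w).1 :=
      (map_add _ u₁ u).trans ((congrArg₂ (· + ·) hu₁ hcu).trans (add_zero _))
    have h5 : (mfderiv (phaseModel d) 𝓘(ℝ, Model d × CoModel d) F₂ q (u₁ + u) :
        Model d × CoModel d) = (e.symm w).2 :=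
      (map_add _ u₁ u).trans ((congrArg₂ (fun x y : Model d × CoModel d => x + y) hb.symm hFu).trans
        (add_sub_cancel _ _))
    have h6 : e ((mfderiv (phaseModel d) 𝓘(ℝ, C) c q (u₁ + u) : C),
        (mfderiv (phaseModel d) 𝓘(ℝ, Model d × CoModel d) F₂ q (u₁ + u) :
          Model d × CoModel d)) = w := by
      rw [h4, h5]
      exact e.apply_symm_apply w
    exact h6
  · ext q
    simp only [mem_inter_iff, mem_ofPred_eq]
    rw [and_comm]
    refine and_congr_right fun hq => ?_
    rw [hS q hq.1.1, e.map_eq_zero_iff, Prod.mk_eq_zero]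
    refine and_congr_right fun _ => ?_
    rw [sub_eq_zero]
    exact ⟨fun h => congrArg κ h, fun h => κ.injOn hq.2 hq.1.2 h⟩

end Graph

lemma arccos_mem_Ioo {x : ℝ} (hx : |x| < 1) : Real.arccos x ∈ Ioo 0 Real.pi := by
  rw [abs_lt] at hx
  refine ⟨Real.arccos_pos.mpr hx.2, (Real.arccos_le_pi _).lt_of_ne fun he => ?_⟩
  rw [Real.arccos_eq_pi] at he
  linarith

/-! ### Membership criteria for `L`, its flow part and the conormal boundary. -/

section Legendrian

variable {d : ℕ} {Y : Type*} [TopologicalSpace Y] [ChartedSpace (Model d) Y]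

lemma fibreSmul_fibreSmul (a b : ℝ) (p : Cotangent d Y) :
    fibreSmul a (fibreSmul b p) = fibreSmul (a * b) p := by
  exact congrArg (TotalSpace.mk p.proj) (smul_smul a b p.snd)

lemma fibreSmul_one (p : Cotangent d Y) : fibreSmul 1 p = p := by
  simp only [fibreSmul, one_smul]

lemma fibreSmul_mk_zero (a : ℝ) (y : Y) :
    fibreSmul a (⟨y, 0⟩ : Cotangent d Y) = ⟨y, 0⟩ := by
  simp only [fibreSmul, smul_zero]

variable [IsManifold (𝓡 d) ∞ Y]

lemma dualNormSq_mk_zero (h : SmoothMetric d Y) (y : Y) :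
    dualNormSq h (⟨y, 0⟩ : Cotangent d Y) = 0 :=
  (dualNormSq_eq_zero h).mpr rfl

lemma eq_mk_zero_of_dualNormSq_eq_zero {h : SmoothMetric d Y} {p : Cotangent d Y}
    (hp : dualNormSq h p = 0) : p = ⟨p.proj, 0⟩ := by
  have := (dualNormSq_eq_zero h).mp hp
  obtain ⟨y, v⟩ := p
  exact congrArg (TotalSpace.mk y) this

/-- All points of `L` lie on the radial set `τ'² + |μ'|² = lam²`. -/
lemma sq_add_dualNormSq_of_mem_Leg {h : SmoothMetric d Y} {lam : ℝ} [T2Space Y] [CompactSpace Y]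
    {q : PhaseSpace d Y} (hq : q ∈ Leg h lam) :
    q.2.1.1 ^ 2 + dualNormSq h q.2.1.2 = lam ^ 2 := by
  rcases hq with (⟨_, γ, s, s', hγ, h0, _, _, _, _, h1, _⟩ | ⟨_, y, h1, _⟩) | ⟨_, y, h1, _⟩
  · rw [h1]
    simp only [dualNormSq_fibreSmul, hγ.dualNormSq_eq s' 0, h0]
    linear_combination lam ^ 2 * Real.sin_sq_add_cos_sq s'
  · rw [h1]
    simp only [dualNormSq_mk_zero, add_zero]
  · rw [h1]
    simp only [dualNormSq_mk_zero, add_zero, neg_sq]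

variable [T2Space Y]

/-- The closure of the conormal bundle of the diagonal meets the boundary where `θ = π/4`, `y' = y''`,
`τ' = -τ''` and `μ' = -μ''`. -/
lemma mem_scConormalDiag_iff {q : PhaseSpace d Y} :
    q ∈ scConormalDiag d Y ↔
      q.1 = Real.pi / 4 ∧ q.2.2.1 = -q.2.1.1 ∧ q.2.2.2 = fibreSmul (-1) q.2.1.2 := by
  have hfib : Continuous fun p : Cotangent d Y => fibreSmul (-1) p :=
    contMDiff_fibreSmul.continuous.comp (continuous_const.prodMk continuous_id)
  let N : Set (PhaseSpace d Y) :=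
    {q | q.1 = Real.pi / 4 ∧ q.2.2.1 = -q.2.1.1 ∧ q.2.2.2 = fibreSmul (-1) q.2.1.2}
  have hN : IsClosed N := by
    refine (isClosed_eq (by fun_prop) (by fun_prop)).inter
      ((isClosed_eq (by fun_prop) (by fun_prop)).inter (isClosed_eq (by fun_prop) ?_))
    exact hfib.comp (by fun_prop)
  -- The conormal conditions do not involve `x` beyond `x > 0`, so the set is a product with a
  -- closed factor and its closure is immediate.
  have hset : conormalDiag (d := d) (Y := Y) = Ioi 0 ×ˢ N := by
    ext ⟨x, θ, ⟨t', p'⟩, ⟨t'', p''⟩⟩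
    simp only [conormalDiag, mem_ofPred_eq, mem_prod, mem_Ioi, N]
    refine and_congr_right fun hx => ?_
    constructor
    · rintro ⟨hθ, hxx, y, a', a'', μ', μ'', h1, h2, h3⟩
      have hsin : 0 < Real.sin θ := Real.sin_pos_of_pos_of_lt_pi hθ.1 (by linarith [hθ.2, hθ.1])
      have hcos : 0 < Real.cos θ := Real.cos_pos_of_mem_Ioo ⟨by linarith [hθ.1, hθ.2], hθ.2⟩
      have hsc : Real.sin θ = Real.cos θ := by
        field_simp at hxx
        linarith
      have hθ4 : θ = Real.pi / 4 := by
        have : Real.sin (θ - Real.pi / 4) = 0 := by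
          rw [Real.sin_sub, Real.sin_pi_div_four, Real.cos_pi_div_four, hsc, sub_self]
        have := (Real.sin_eq_zero_iff_of_lt_of_lt (by linarith [hθ.1, Real.pi_pos])
          (by linarith [hθ.2, Real.pi_pos])).mp this
        linarith
      simp only [Prod.mk.injEq] at h1 h2
      obtain ⟨rfl, rfl⟩ := h1
      obtain ⟨rfl, rfl⟩ := h2
      have hxp : 0 < x / Real.cos θ := div_pos hx hcos
      refine ⟨hθ4, ?_, ?_⟩
      -- Testing on `∂_x` isolates `τ' + τ''`, and testing on vectors tangent to `Y` isolates `μ' +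
      -- μ''`. The two boundary defining functions are equal here, so their powers factor out.
      · have := h3 1 0
        simp only [scPairing, map_zero, zero_div, add_zero, hsc] at this
        rw [← add_mul] at this
        have := (mul_eq_zero.mp this).resolve_right (by positivity)
        linarith
      · refine congrArg (TotalSpace.mk y) ?_
        ext v
        have := h3 0 v
        simp only [scPairing, zero_div, mul_zero, zero_add, hsc] at this
        rw [← add_div] at this
        have h5 : μ' v + μ'' v = 0 := (div_eq_zero_iff.mp this).resolve_right hxp.ne'
        have h6 : ((-1 : ℝ) • μ') v = -μ' v := by
          rw [smul_apply, neg_one_smul]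
        exact (eq_neg_of_add_eq_zero_right h5).trans h6.symm
    · rintro ⟨rfl, rfl, rfl⟩
      obtain ⟨y, μ⟩ := p'
      refine ⟨⟨by positivity, by linarith [Real.pi_pos]⟩,
        by rw [Real.sin_pi_div_four, Real.cos_pi_div_four],
        y, t', -t', μ, (-1 : ℝ) • μ, rfl, rfl, fun a v => ?_⟩
      have h6 : ((-1 : ℝ) • μ) v = -μ v := by
        rw [smul_apply, neg_one_smul]
      simp only [scPairing, Real.sin_pi_div_four, Real.cos_pi_div_four]
      rw [h6]
      ring
  change ((0 : ℝ), q) ∈ closure _ ↔ _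
  rw [hset, closure_prod_eq, closure_Ioi, hN.closure_eq]
  exact ⟨fun hq => hq.2, fun hq => ⟨self_mem_Ici, hq⟩⟩

variable [CompactSpace Y]

/-- Over the interior of the front face, the points of `flowPart` in terms of their left
component. -/
lemma mem_flowPart_iff {h : SmoothMetric d Y} {lam : ℝ} (hlam : 0 < lam) {q : PhaseSpace d Y}
    (hθ : q.1 ∈ Ioo 0 (Real.pi / 2)) :
    q ∈ flowPart h lam ↔ ∃ s ∈ Ioo 0 Real.pi, ∃ s' ∈ Ioo 0 Real.pi,
      Real.sin q.1 * Real.sin s = Real.cos q.1 * Real.sin s' ∧ q.2.1.1 = lam * Real.cos s' ∧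
      dualNormSq h q.2.1.2 = (lam * Real.sin s') ^ 2 ∧ q.2.2.1 = -lam * Real.cos s ∧
      q.2.2.2 = fibreSmul (-lam * Real.sin s)
        (geodesicFlow h (s - s') (fibreSmul (lam * Real.sin s')⁻¹ q.2.1.2)) := by
  have hsin : 0 < Real.sin q.1 := Real.sin_pos_of_pos_of_lt_pi hθ.1 (by linarith [hθ.2, hθ.1])
  have hcos : 0 < Real.cos q.1 := Real.cos_pos_of_mem_Ioo ⟨by linarith [hθ.1, hθ.2], hθ.2⟩
  constructor
  · rintro ⟨_, γ, s, s', hγ, h0, hs, hs', hpos, hts, h1, h2⟩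
    have hmem : ∀ t ∈ Icc 0 Real.pi, Real.sin t ≠ 0 → t ∈ Ioo 0 Real.pi := fun t ht hne =>
      ⟨ht.1.lt_of_ne (by rintro rfl; exact hne Real.sin_zero),
        ht.2.lt_of_ne (by rintro rfl; exact hne Real.sin_pi)⟩
    -- Since `sin θ` and `cos θ` are positive, the vanishing of one of `sin s`, `sin s'` would force
    -- that of the other, contrary to `hpos`.
    have hne : Real.sin s ≠ 0 := by
      intro hz
      rw [hz, mul_zero] at hts
      have := (mul_eq_zero.mp hts.symm).resolve_left hcos.ne'
      simp [hz, this] at hpos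
    have hne' : Real.sin s' ≠ 0 := by
      intro hz
      rw [hz, mul_zero] at hts
      exact hne ((mul_eq_zero.mp hts).resolve_left hsin.ne')
    refine ⟨s, hmem s hs hne, s', hmem s' hs' hne', hts, by rw [h1], ?_, by rw [h2], ?_⟩
    · rw [h1, dualNormSq_fibreSmul, hγ.dualNormSq_eq s' 0, h0, mul_one]
    · rw [h2, h1]
      simp only
      rw [fibreSmul_fibreSmul, inv_mul_cancel₀ (mul_ne_zero hlam.ne' hne'), fibreSmul_one,
        ← hγ.eq_geodesicFlow, sub_add_cancel]
  · rintro ⟨s, hs, s', hs', hts, h1, h2, h3, h4⟩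
    have hs'pos : 0 < Real.sin s' := Real.sin_pos_of_mem_Ioo hs'
    have hne : lam * Real.sin s' ≠ 0 := (mul_pos hlam hs'pos).ne'
    set w := fibreSmul (lam * Real.sin s')⁻¹ q.2.1.2 with hw
    -- The normalized left covector `w` is the point at time `s'`. Flowing back by `s'` gives the
    -- initial point of the bicharacteristic.
    set v := geodesicFlow h (-s') w with hv
    have hb := isBicharacteristic_geodesicFlow h v
    have hb' := isBicharacteristic_geodesicFlow h w
    have hv' : ∀ t, geodesicFlow h t v = geodesicFlow h (t - s') w := fun t => by
      rw [hv, ← hb'.eq_geodesicFlow t (-s'), sub_eq_add_neg]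
    refine ⟨Ioo_subset_Icc_self hθ, fun t => geodesicFlow h t v, s, s', hb, ?_,
      Ioo_subset_Icc_self hs, Ioo_subset_Icc_self hs', by positivity, hts, ?_, ?_⟩
    · simp only [hv']
      rw [hb'.dualNormSq_eq (0 - s') 0, geodesicFlow_zero, hw, dualNormSq_fibreSmul, h2, inv_pow,
        inv_mul_cancel₀ (pow_ne_zero 2 hne)]
    · refine Prod.ext h1 ?_
      simp only [hv', sub_self, geodesicFlow_zero]
      rw [hw, fibreSmul_fibreSmul, mul_inv_cancel₀ hne, fibreSmul_one]
    · refine Prod.ext h3 ?_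
      simp only [hv']
      exact h4

/-- On `L`, the function `τ` vanishes exactly on the boundary of the conormal bundle. -/
lemma mem_Leg_and_tau_eq_zero_iff {h : SmoothMetric d Y} {lam : ℝ} (hlam : 0 < lam)
    {q : PhaseSpace d Y} : q ∈ Leg h lam ∧ tau q = 0 ↔
      (q.1 = Real.pi / 4 ∧ q.2.2.1 = -q.2.1.1 ∧ q.2.2.2 = fibreSmul (-1) q.2.1.2) ∧
        q.2.1.1 ^ 2 + dualNormSq h q.2.1.2 = lam ^ 2 := by
  have hquarter : ∀ θ ∈ Icc 0 (Real.pi / 2), Real.cos θ ^ 2 = Real.sin θ ^ 2 →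
      θ = Real.pi / 4 := by
    intro θ hθ hsq
    have hcos : 0 ≤ Real.cos θ := Real.cos_nonneg_of_mem_Icc ⟨by linarith [hθ.1, hθ.2], hθ.2⟩
    have hsin : 0 ≤ Real.sin θ := Real.sin_nonneg_of_nonneg_of_le_pi hθ.1 (by linarith [hθ.1, hθ.2])
    have hcs : Real.cos θ = Real.sin θ := (pow_left_inj₀ hcos hsin two_ne_zero).mp hsq
    have h1 : Real.sin (θ - Real.pi / 4) = 0 := by
      rw [Real.sin_sub, Real.sin_pi_div_four, Real.cos_pi_div_four, hcs, sub_self]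
    have := (Real.sin_eq_zero_iff_of_lt_of_lt (by linarith [hθ.1, Real.pi_pos])
      (by linarith [hθ.2, Real.pi_pos])).mp h1
    linarith
  have hdiag : ∀ c : ℝ, c ≠ 0 → q ∈ diagonalPart c → tau q = 0 →
      q.1 = Real.pi / 4 ∧ q.2.2.1 = -q.2.1.1 ∧ q.2.2.2 = fibreSmul (-1) q.2.1.2 := by
    rintro c hc ⟨hθ, y, h1, h2⟩ hτ
    rw [tau, h1, h2] at hτ
    refine ⟨hquarter _ hθ ?_, by rw [h1, h2], by rw [h1, h2, fibreSmul_mk_zero]⟩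
    have : c * (Real.cos q.1 - Real.sin q.1) = 0 := by linear_combination hτ
    rw [sub_eq_zero.mp ((mul_eq_zero.mp this).resolve_left hc)]
  constructor
  · rintro ⟨hq, hτ⟩
    refine ⟨?_, sq_add_dualNormSq_of_mem_Leg hq⟩
    rcases hq with (⟨hθ, γ, s, s', hγ, h0, hs, hs', hpos, hts, h1, h2⟩ | hq) | hq
    · rw [tau, h1, h2] at hτ
      have hc : Real.cos q.1 * Real.cos s' = Real.sin q.1 * Real.cos s := by
        have : lam * (Real.cos q.1 * Real.cos s' - Real.sin q.1 * Real.cos s) = 0 := by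
          linear_combination hτ
        exact sub_eq_zero.mp ((mul_eq_zero.mp this).resolve_left hlam.ne')
      -- Squaring `hc` and `hts` and adding them gives `cos² θ = sin² θ`.
      have h4 : q.1 = Real.pi / 4 := by
        refine hquarter _ hθ ?_
        have e1 := Real.sin_sq_add_cos_sq s
        have e2 := Real.sin_sq_add_cos_sq s'
        linear_combination (Real.cos q.1 * Real.cos s' + Real.sin q.1 * Real.cos s) * hc
          - (Real.sin q.1 * Real.sin s + Real.cos q.1 * Real.sin s') * hts
          - Real.cos q.1 ^ 2 * e2 + Real.sin q.1 ^ 2 * e1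
      have hss : s' = s := by
        refine Real.injOn_cos hs' hs ?_
        rw [h4, Real.cos_pi_div_four, Real.sin_pi_div_four] at hc
        exact mul_left_cancel₀ (by positivity) hc
      subst hss
      refine ⟨h4, by rw [h1, h2]; simp only; ring, ?_⟩
      rw [h1, h2]
      simp only [fibreSmul_fibreSmul, one_mul, neg_mul]
    · exact hdiag lam hlam.ne' hq hτ
    · exact hdiag (-lam) (neg_ne_zero.mpr hlam.ne') hq hτ
  · rintro ⟨⟨h4, h5, h6⟩, h7⟩
    have hθ : q.1 ∈ Ioo 0 (Real.pi / 2) := by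
      rw [h4]
      exact ⟨by positivity, by linarith [Real.pi_pos]⟩
    refine ⟨?_, ?_⟩
    -- If `μ' = 0`, then `τ' = ±λ` and the point lies in a diagonal part. Otherwise it lies in the
    -- flow part with `s = s' = arccos(τ'/λ)`.
    · by_cases hz : dualNormSq h q.2.1.2 = 0
      · have hp := eq_mk_zero_of_dualNormSq_eq_zero hz
        have key : ∀ c, q.2.1.1 = c → q ∈ diagonalPart c := fun c hc =>
          ⟨Ioo_subset_Icc_self hθ, q.2.1.2.proj, Prod.ext hc hp, Prod.ext (by rw [h5, hc])
            (by rw [h6, hp]; exact fibreSmul_mk_zero _ _)⟩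
        rw [hz, add_zero, sq_eq_sq_iff_eq_or_eq_neg] at h7
        rcases h7 with h7 | h7
        · exact Or.inl (Or.inr (key _ h7))
        · exact Or.inr (key _ h7)
      · have hzpos : 0 < dualNormSq h q.2.1.2 := (dualNormSq_nonneg h _).lt_of_ne' hz
        have habs : |q.2.1.1 / lam| < 1 := by
          rw [abs_div, abs_of_pos hlam, div_lt_one hlam]
          exact abs_lt_of_sq_lt_sq (by linarith) hlam.le
        have hs := arccos_mem_Ioo habs
        have hcos : Real.cos (Real.arccos (q.2.1.1 / lam)) = q.2.1.1 / lam :=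
          Real.cos_arccos (abs_lt.mp habs).1.le (abs_lt.mp habs).2.le
        have hsin : 0 < Real.sin (Real.arccos (q.2.1.1 / lam)) := Real.sin_pos_of_mem_Ioo hs
        refine Or.inl (Or.inl ((mem_flowPart_iff hlam hθ).mpr ⟨_, hs, _, hs, ?_, ?_, ?_, ?_, ?_⟩))
        · rw [h4, Real.cos_pi_div_four, Real.sin_pi_div_four]
        · rw [hcos, mul_div_cancel₀ _ hlam.ne']
        · rw [mul_pow, Real.sin_sq, hcos]
          field_simp
          linarith
        · rw [hcos, h5, neg_mul, mul_div_cancel₀ _ hlam.ne']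
        · rw [sub_self, geodesicFlow_zero, fibreSmul_fibreSmul, h6]
          congr 1
          field_simp
    · rw [tau, h4, h5, Real.cos_pi_div_four, Real.sin_pi_div_four]
      ring

end Legendrian

/-! ### Submanifolds cut out by scalar equations and the flow. -/

section Scalars

set_option synthInstance.maxHeartbeats 200000

variable {d : ℕ} {Y : Type*} [TopologicalSpace Y] [ChartedSpace (Model d) Y]
  [IsManifold (𝓡 d) ∞ Y]

/-- The functions `(θ, τ', |μ'|², τ'')` on the phase space. -/
def scalars (h : SmoothMetric d Y) (q : PhaseSpace d Y) : ℝ × ℝ × ℝ × ℝ :=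
  (q.1, q.2.1.1, dualNormSq h q.2.1.2, q.2.2.1)

lemma contMDiff_leftCovector : ContMDiff (phaseModel d) (cotModel d) ∞
    (fun q : PhaseSpace d Y => q.2.1.2) :=
  contMDiff_snd.comp (contMDiff_fst.comp contMDiff_snd)

lemma contMDiff_scalars (h : SmoothMetric d Y) :
    ContMDiff (phaseModel d) 𝓘(ℝ, ℝ × ℝ × ℝ × ℝ) ∞ (scalars h) := by
  have h1 : ContMDiff (phaseModel d) 𝓘(ℝ, ℝ) ∞ (fun q : PhaseSpace d Y => q.1) := contMDiff_fst
  have h2 : ContMDiff (phaseModel d) 𝓘(ℝ, ℝ) ∞ (fun q : PhaseSpace d Y => q.2.1.1) :=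
    contMDiff_fst.comp (contMDiff_fst.comp contMDiff_snd)
  have h3 : ContMDiff (phaseModel d) 𝓘(ℝ, ℝ) ∞
      (fun q : PhaseSpace d Y => dualNormSq h q.2.1.2) :=
    (contMDiff_dualNormSq h).comp contMDiff_leftCovector
  have h4 : ContMDiff (phaseModel d) 𝓘(ℝ, ℝ) ∞ (fun q : PhaseSpace d Y => q.2.2.1) :=
    contMDiff_fst.comp (contMDiff_snd.comp contMDiff_snd)
  exact h1.prodMk_space (h2.prodMk_space (h3.prodMk_space h4))

/-- Move `(θ, τ', τ'')` linearly and `μ'` radially. -/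
def scalarCurve (q : PhaseSpace d Y) (w : ℝ × ℝ × ℝ × ℝ) (t : ℝ) : PhaseSpace d Y :=
  (q.1 + t * w.1, (q.2.1.1 + t * w.2.1, fibreSmul (1 + t * w.2.2.1) q.2.1.2),
    (q.2.2.1 + t * w.2.2.2, q.2.2.2))

lemma contMDiff_scalarCurve (q : PhaseSpace d Y) (w : ℝ × ℝ × ℝ × ℝ) :
    ContMDiff 𝓘(ℝ, ℝ) (phaseModel d) ∞ (scalarCurve q w) := by
  have hlin : ∀ a b : ℝ, ContMDiff 𝓘(ℝ, ℝ) 𝓘(ℝ, ℝ) ∞ (fun t : ℝ => a + t * b) := fun a b =>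
    ContDiff.contMDiff (by fun_prop)
  exact (hlin _ _).prodMk (((hlin _ _).prodMk (contMDiff_fibreSmul.comp
    ((hlin _ _).prodMk contMDiff_const))).prodMk ((hlin _ _).prodMk contMDiff_const))

variable [T2Space Y] [CompactSpace Y]
  {C : Type*} [NormedAddCommGroup C] [NormedSpace ℝ C] [FiniteDimensional ℝ C]

/-- A subset of the phase space is a submanifold if it is given by equations for the scalar functions
`(θ, τ', |μ'|², τ'')`, and the right covector is obtained by the flow from the left one. -/
lemma isSubmanifoldAt_of_scalars (h : SmoothMetric d Y) {k : ℕ}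
    (hk : Module.finrank ℝ C + 2 * d = k)
    {S : Set (PhaseSpace d Y)} {V : Set (ℝ × ℝ × ℝ × ℝ)} {p : PhaseSpace d Y} (hV : IsOpen V)
    (hpV : scalars h p ∈ V) (hpS : p ∈ S)
    {G : ℝ × ℝ × ℝ × ℝ → C} {A B D : ℝ × ℝ × ℝ × ℝ → ℝ}
    (hG : ∀ x ∈ V, ContDiffAt ℝ ∞ G x) (hA : ∀ x ∈ V, ContDiffAt ℝ ∞ A x)
    (hB : ∀ x ∈ V, ContDiffAt ℝ ∞ B x) (hD : ∀ x ∈ V, ContDiffAt ℝ ∞ D x)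
    -- The third slot is `|(1 + tw)μ'|²`: the norm of `μ'` is varied by radial scaling, which has no
    -- effect where `μ' = 0`.
    (hsurj : ∀ x ∈ V, ∀ a : C, ∃ w : ℝ × ℝ × ℝ × ℝ, HasDerivAt (fun t : ℝ =>
      G (x.1 + t * w.1, x.2.1 + t * w.2.1, (1 + t * w.2.2.1) ^ 2 * x.2.2.1,
        x.2.2.2 + t * w.2.2.2)) a 0)
    (hS : ∀ q, scalars h q ∈ V → (q ∈ S ↔ G (scalars h q) = 0 ∧ q.2.2.2 =
      fibreSmul (A (scalars h q)) (geodesicFlow h (B (scalars h q))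
        (fibreSmul (D (scalars h q)) q.2.1.2)))) :
    IsSubmanifoldAt (phaseModel d) k S p := by
  have hcomp : ∀ {W : Type _} [NormedAddCommGroup W] [NormedSpace ℝ W]
      {f : ℝ × ℝ × ℝ × ℝ → W}, (∀ x ∈ V, ContDiffAt ℝ ∞ f x) →
      ContMDiffOn (phaseModel d) 𝓘(ℝ, W) ∞ (fun q => f (scalars h q)) (scalars h ⁻¹' V) :=
    fun hf q hq => ((hf _ hq).contMDiffAt.comp q
      (contMDiff_scalars h).contMDiffAt).contMDiffWithinAt
  have hcompR : ∀ {f : ℝ × ℝ × ℝ × ℝ → ℝ}, (∀ x ∈ V, ContDiffAt ℝ ∞ f x) →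
      ContMDiffOn (phaseModel d) 𝓘(ℝ, ℝ) ∞ (fun q => f (scalars h q)) (scalars h ⁻¹' V) :=
    fun hf q hq => ((hf _ hq).contMDiffAt.comp q
      (contMDiff_scalars h).contMDiffAt).contMDiffWithinAt
  refine isSubmanifoldAt_of_graph (C := C) hk (hV.preimage (contMDiff_scalars h).continuous)
    hpV hpS (c := fun q => G (scalars h q))
    (g := fun q => fibreSmul (A (scalars h q)) (geodesicFlow h (B (scalars h q))
        (fibreSmul (D (scalars h q)) q.2.1.2)))
    (hcomp hG) ?_ (fun q t => rfl) (fun q t => rfl) ?_ hS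
  · exact contMDiff_fibreSmul.comp_contMDiffOn ((hcompR hA).prodMk
      ((contMDiff_geodesicFlow h).comp_contMDiffOn ((hcompR hB).prodMk
        (contMDiff_fibreSmul.comp_contMDiffOn ((hcompR hD).prodMk
          contMDiff_leftCovector.contMDiffOn)))))
  · intro q hq a
    obtain ⟨w, hw⟩ := hsurj _ hq a
    have h0 : scalarCurve q w 0 = q := by
      simp only [scalarCurve, zero_mul, add_zero, fibreSmul_one]
    obtain ⟨u, hu⟩ := exists_hasDerivAt_comp_curve
      (((hcomp hG).contMDiffAt ((hV.preimage (contMDiff_scalars h).continuous).mem_nhds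
        hq)).mdifferentiableAt (by simp))
      ((contMDiff_scalarCurve q w).contMDiffAt.mdifferentiableAt (by simp)) h0
    refine ⟨u, hu.unique ?_⟩
    have heq : (fun q => G (scalars h q)) ∘ scalarCurve q w = fun t : ℝ =>
        G ((scalars h q).1 + t * w.1, (scalars h q).2.1 + t * w.2.1,
          (1 + t * w.2.2.1) ^ 2 * (scalars h q).2.2.1, (scalars h q).2.2.2 + t * w.2.2.2) := by
      funext t
      simp only [Function.comp_apply, scalarCurve, scalars, dualNormSq_fibreSmul]
    rw [heq]
    exact hw

end Scalars

/-! ### The intersection of `L` with the conormal boundary. -/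

section Conormal

variable {d : ℕ} {Y : Type*} [TopologicalSpace Y] [ChartedSpace (Model d) Y]
  [IsManifold (𝓡 d) ∞ Y] [T2Space Y] [CompactSpace Y]

lemma Leg_inter_tau_eq (h : SmoothMetric d Y) {lam : ℝ} (hlam : 0 < lam) :
    Leg h lam ∩ {p | tau p = 0} = Leg h lam ∩ scConormalDiag d Y := by
  ext q
  constructor
  · exact fun hq => ⟨hq.1, mem_scConormalDiag_iff.mpr
      ((mem_Leg_and_tau_eq_zero_iff hlam).mp hq).1⟩
  · exact fun hq => (mem_Leg_and_tau_eq_zero_iff hlam).mpr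
      ⟨mem_scConormalDiag_iff.mp hq.2, sq_add_dualNormSq_of_mem_Leg hq.1⟩

/-- The intersection is the graph of fibrewise negation over `τ'² + |μ'|² = λ²`, with the further
equations `θ = π/4` and `τ'' = -τ'`. These are three scalar conditions, and the flow time is `0`. -/
lemma isSubmanifoldAt_inter_conormal (h : SmoothMetric d Y) {lam : ℝ} (hlam : 0 < lam)
    {p : PhaseSpace d Y} (hp : p ∈ Leg h lam ∩ scConormalDiag d Y) :
    IsSubmanifoldAt (phaseModel d) (2 * d + 2 + 1) (Leg h lam ∩ scConormalDiag d Y) p := by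
  refine isSubmanifoldAt_of_scalars (C := ℝ × ℝ × ℝ) h ?_
    -- The excluded set is `τ' = 0, μ' = 0`, where the differential of `τ'² + |μ'|²` vanishes.
    (V := {x | 0 < x.2.1 ^ 2 + x.2.2.1}) (isOpen_lt (by fun_prop) (by fun_prop)) ?_ hp
    (G := fun x => (x.2.1 ^ 2 + x.2.2.1 - lam ^ 2, x.1 - Real.pi / 4, x.2.2.2 + x.2.1))
    (A := fun _ => -1) (B := fun _ => 0) (D := fun _ => 1)
    (fun x _ => by fun_prop) (fun x _ => by fun_prop) (fun x _ => by fun_prop)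
    (fun x _ => by fun_prop) ?_ ?_
  · simp only [Module.finrank_prod, Module.finrank_self]
    omega
  · have := sq_add_dualNormSq_of_mem_Leg hp.1
    change 0 < p.2.1.1 ^ 2 + dualNormSq h p.2.1.2
    rw [this]
    positivity
  · rintro ⟨θ, t, N, t'⟩ hx ⟨a, b, c⟩
    simp only [mem_ofPred_eq] at hx ⊢
    -- Scaling `(τ', μ')` at rate `ρ` changes `τ'² + |μ'|²` at rate `2ρ(τ'² + |μ'|²) = a`. The rate
    -- of `τ''` compensates for the induced change of `τ'`.
    set ρ := a / (2 * (t ^ 2 + N)) with hρ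
    refine ⟨(b, ρ * t, ρ, c - ρ * t), ?_⟩
    refine HasDerivAt.prodMk ?_ (HasDerivAt.prodMk ?_ ?_)
    · have h1 : HasDerivAt (fun s : ℝ => (t + s * (ρ * t)) ^ 2 + (1 + s * ρ) ^ 2 * N - lam ^ 2)
          (2 * (t + 0 * (ρ * t)) * (ρ * t) + 2 * (1 + 0 * ρ) * ρ * N) 0 := by
        have e1 : HasDerivAt (fun s : ℝ => t + s * (ρ * t)) (ρ * t) 0 := by
          simpa using ((hasDerivAt_id (0 : ℝ)).mul_const (ρ * t)).const_add t
        have e2 : HasDerivAt (fun s : ℝ => 1 + s * ρ) ρ 0 := by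
          simpa using ((hasDerivAt_id (0 : ℝ)).mul_const ρ).const_add 1
        simpa using ((e1.pow 2).add ((e2.pow 2).mul_const N)).sub_const (lam ^ 2)
      refine h1.congr_deriv ?_
      rw [hρ]
      field_simp
      ring
    · simpa using (((hasDerivAt_id (0 : ℝ)).mul_const b).const_add θ).sub_const (Real.pi / 4)
    · have e1 : HasDerivAt (fun s : ℝ => t' + s * (c - ρ * t) + (t + s * (ρ * t)))
          (1 * (c - ρ * t) + 1 * (ρ * t)) 0 :=
        (((hasDerivAt_id (0 : ℝ)).mul_const (c - ρ * t)).const_add t').add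
          (((hasDerivAt_id (0 : ℝ)).mul_const (ρ * t)).const_add t)
      exact e1.congr_deriv (by ring)
  · intro q _
    rw [← Leg_inter_tau_eq h hlam, geodesicFlow_zero, fibreSmul_one]
    refine (mem_Leg_and_tau_eq_zero_iff hlam).trans ?_
    simp only [scalars, Prod.mk_eq_zero, sub_eq_zero, add_eq_zero_iff_eq_neg]
    tauto

end Conormal

/-! ### `L` away from the radial points. -/

section FlowPart

variable {d : ℕ} {Y : Type*} [TopologicalSpace Y] [ChartedSpace (Model d) Y]
  [IsManifold (𝓡 d) ∞ Y] [T2Space Y] [CompactSpace Y]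

/-- For `|τ'|, |τ''| < λ` the parameters are smooth functions of the scalars: `s' = arccos(τ'/λ)`,
`s = arccos(-τ''/λ)`, `λ sin s' = √(λ² - τ'²)`, `λ sin s = √(λ² - τ''²)`. Substituting them into
`mem_flowPart_iff` gives the equations. -/
lemma isSubmanifoldAt_of_mem_flowPart (h : SmoothMetric d Y) {lam : ℝ} (hlam : 0 < lam)
    {p : PhaseSpace d Y} (hp : p ∈ flowPart h lam) (hθp : p.1 ∈ Ioo 0 (Real.pi / 2)) :
    IsSubmanifoldAt (phaseModel d) (2 * d + 2) (Leg h lam) p := by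
  have hpos : ∀ t : ℝ, |t| < lam → 0 < lam ^ 2 - t ^ 2 := fun t ht => by
    have := sq_lt_sq' (abs_lt.mp ht).1 (abs_lt.mp ht).2
    linarith
  have hdiv : ∀ t : ℝ, |t| < lam → |t / lam| < 1 := fun t ht => by
    rwa [abs_div, abs_of_pos hlam, div_lt_one hlam]
  have hcosabs : ∀ s ∈ Ioo 0 Real.pi, |lam * Real.cos s| < lam := fun s hs => by
    have h1 := Real.sin_pos_of_mem_Ioo hs
    refine abs_lt_of_sq_lt_sq ?_ hlam.le
    have := Real.sin_sq_add_cos_sq s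
    have h2 : 0 < lam ^ 2 * Real.sin s ^ 2 := by positivity
    nlinarith
  have hsqrt : ∀ s ∈ Ioo 0 Real.pi,
      Real.sqrt (lam ^ 2 - (lam * Real.cos s) ^ 2) = lam * Real.sin s := fun s hs => by
    have h1 := Real.sin_pos_of_mem_Ioo hs
    rw [← Real.sqrt_sq (mul_pos hlam h1).le]
    congr 1
    linear_combination (-lam ^ 2) * Real.sin_sq_add_cos_sq s
  have hcosdiff : ∀ {x : ℝ × ℝ × ℝ × ℝ} {f : ℝ × ℝ × ℝ × ℝ → ℝ}, ContDiffAt ℝ ∞ f x →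
      |f x| < lam → ContDiffAt ℝ ∞ (fun y => Real.arccos (f y / lam)) x := fun {x f} hf hx => by
    have h1 := abs_lt.mp (hdiv _ hx)
    exact ContDiffAt.comp (g := Real.arccos) x (Real.contDiffAt_arccos h1.1.ne' h1.2.ne)
      (hf.div_const lam)
  have hsqrtdiff : ∀ {x : ℝ × ℝ × ℝ × ℝ} {f : ℝ × ℝ × ℝ × ℝ → ℝ}, ContDiffAt ℝ ∞ f x →
      |f x| < lam → ContDiffAt ℝ ∞ (fun y => Real.sqrt (lam ^ 2 - f y ^ 2)) x :=
    fun hf hx => (contDiffAt_const.sub (hf.pow 2)).sqrt (hpos _ hx).ne'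
  refine isSubmanifoldAt_of_scalars (C := ℝ × ℝ) h ?_
    -- The condition `|μ'|² > 0` keeps the diagonal parts out of this neighbourhood.
    (V := {x | (x.1 ∈ Ioo 0 (Real.pi / 2) ∧ 0 < x.2.2.1) ∧ |x.2.1| < lam ∧ |x.2.2.2| < lam})
    ?_ ?_ (Or.inl (Or.inl hp))
    (G := fun x => (x.2.1 ^ 2 + x.2.2.1 - lam ^ 2, x.1 -
      Real.arctan (Real.sqrt (lam ^ 2 - x.2.1 ^ 2) / Real.sqrt (lam ^ 2 - x.2.2.2 ^ 2))))
    (A := fun x => -Real.sqrt (lam ^ 2 - x.2.2.2 ^ 2))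
    (B := fun x => Real.arccos (-x.2.2.2 / lam) - Real.arccos (x.2.1 / lam))
    (D := fun x => (Real.sqrt (lam ^ 2 - x.2.1 ^ 2))⁻¹)
    ?_ ?_ ?_ ?_ ?_ ?_
  · simp only [Module.finrank_prod, Module.finrank_self]
    omega
  · have h1 : Continuous fun x : ℝ × ℝ × ℝ × ℝ => x.2.1 := by fun_prop
    have h2 : Continuous fun x : ℝ × ℝ × ℝ × ℝ => x.2.2.1 := by fun_prop
    have h3 : Continuous fun x : ℝ × ℝ × ℝ × ℝ => x.2.2.2 := by fun_prop
    exact ((isOpen_Ioo.preimage continuous_fst).inter (isOpen_lt continuous_const h2)).inter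
      ((isOpen_lt h1.abs continuous_const).inter (isOpen_lt h3.abs continuous_const))
  · obtain ⟨s, hs, s', hs', -, h1, h2, h3, -⟩ := (mem_flowPart_iff hlam hθp).mp hp
    refine ⟨⟨hθp, ?_⟩, ?_, ?_⟩
    · have := Real.sin_pos_of_mem_Ioo hs'
      simp only [scalars, h2]
      positivity
    · simp only [scalars, h1]
      exact hcosabs s' hs'
    · simp only [scalars, h3, neg_mul, abs_neg]
      exact hcosabs s hs
  · rintro x ⟨-, hx1, hx2⟩
    refine ContDiffAt.prodMk (by fun_prop) (ContDiffAt.sub (by fun_prop) ?_)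
    exact Real.contDiff_arctan.contDiffAt.comp x ((hsqrtdiff (by fun_prop) hx1).div
      (hsqrtdiff (by fun_prop) hx2) (Real.sqrt_pos.mpr (hpos _ hx2)).ne')
  · rintro x ⟨-, hx1, hx2⟩
    exact (hsqrtdiff (by fun_prop) hx2).neg
  · rintro x ⟨-, hx1, hx2⟩
    exact (hcosdiff (f := fun x => -x.2.2.2) (by fun_prop) (by rwa [abs_neg])).sub
      (hcosdiff (by fun_prop) hx1)
  · rintro x ⟨-, hx1, hx2⟩
    exact (hsqrtdiff (by fun_prop) hx1).inv (Real.sqrt_pos.mpr (hpos _ hx1)).ne'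
  · rintro ⟨θ, t, N, t'⟩ ⟨⟨-, hN⟩, -⟩ ⟨a, b⟩
    simp only at hN
    -- With `τ'` and `τ''` fixed, radial scaling of `μ'` moves only the first equation and `θ` moves
    -- only the second.
    refine ⟨(b, 0, a / (2 * N), 0), ?_⟩
    simp only [mul_zero, add_zero]
    refine HasDerivAt.prodMk ?_ ?_
    · have e2 : HasDerivAt (fun s : ℝ => 1 + s * (a / (2 * N))) (a / (2 * N)) 0 := by
        simpa using ((hasDerivAt_id (0 : ℝ)).mul_const (a / (2 * N))).const_add 1
      have h1 : HasDerivAt (fun s : ℝ => t ^ 2 + (1 + s * (a / (2 * N))) ^ 2 * N - lam ^ 2)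
          (2 * (a / (2 * N)) * N) 0 := by
        simpa using (((e2.pow 2).mul_const N).const_add (t ^ 2)).sub_const (lam ^ 2)
      exact h1.congr_deriv (by field_simp)
    · simpa using (((hasDerivAt_id (0 : ℝ)).mul_const b).const_add θ).sub_const
        (Real.arctan (Real.sqrt (lam ^ 2 - t ^ 2) / Real.sqrt (lam ^ 2 - t' ^ 2)))
  · rintro q ⟨⟨hθ, hN⟩, hq1, hq2⟩
    simp only [scalars] at hθ hN hq1 hq2
    have hsin : 0 < Real.sin q.1 := Real.sin_pos_of_pos_of_lt_pi hθ.1 (by linarith [hθ.2, hθ.1])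
    have hcos : 0 < Real.cos q.1 := Real.cos_pos_of_mem_Ioo ⟨by linarith [hθ.1, hθ.2], hθ.2⟩
    have hmem : q ∈ Leg h lam ↔ q ∈ flowPart h lam := by
      refine ⟨?_, fun hq => Or.inl (Or.inl hq)⟩
      rintro ((hq | ⟨_, y, h1, _⟩) | ⟨_, y, h1, _⟩)
      · exact hq
      all_goals
        rw [h1, dualNormSq_mk_zero] at hN
        exact absurd hN (lt_irrefl _)
    have htan : ∀ s ∈ Ioo 0 Real.pi, ∀ s' : ℝ,
        Real.sin q.1 * Real.sin s = Real.cos q.1 * Real.sin s' ↔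
          q.1 = Real.arctan (lam * Real.sin s' / (lam * Real.sin s)) := fun s hs s' => by
      have h1 := Real.sin_pos_of_mem_Ioo hs
      rw [mul_div_mul_left _ _ hlam.ne']
      constructor
      · intro h2
        have : Real.sin s' / Real.sin s = Real.tan q.1 := by
          rw [Real.tan_eq_sin_div_cos, div_eq_div_iff h1.ne' hcos.ne']
          linarith
        rw [this, Real.arctan_tan (by linarith [hθ.1, hθ.2]) hθ.2]
      · intro h2
        have : Real.tan q.1 = Real.sin s' / Real.sin s := by rw [h2, Real.tan_arctan]
        rw [Real.tan_eq_sin_div_cos, div_eq_div_iff hcos.ne' h1.ne'] at this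
        linarith
    rw [hmem, mem_flowPart_iff hlam hθ]
    simp only [scalars, Prod.mk_eq_zero, sub_eq_zero]
    constructor
    · rintro ⟨s, hs, s', hs', hts, h1, h2, h3, h4⟩
      have hs2 : Real.sqrt (lam ^ 2 - q.2.2.1 ^ 2) = lam * Real.sin s := by
        rw [h3, neg_mul, neg_sq]
        exact hsqrt s hs
      have hs1 : Real.sqrt (lam ^ 2 - q.2.1.1 ^ 2) = lam * Real.sin s' := by
        rw [h1]
        exact hsqrt s' hs'
      have ha : Real.arccos (-q.2.2.1 / lam) = s := by
        rw [h3, neg_mul, neg_neg, mul_div_cancel_left₀ _ hlam.ne',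
          Real.arccos_cos hs.1.le hs.2.le]
      have ha' : Real.arccos (q.2.1.1 / lam) = s' := by
        rw [h1, mul_div_cancel_left₀ _ hlam.ne', Real.arccos_cos hs'.1.le hs'.2.le]
      rw [hs1, hs2, ha, ha']
      refine ⟨⟨?_, (htan s hs s').mp hts⟩, ?_⟩
      · rw [h1, h2]
        linear_combination lam ^ 2 * Real.sin_sq_add_cos_sq s'
      · rw [← neg_mul]
        exact h4
    · rintro ⟨⟨h1, h2⟩, h3⟩
      have hx1 := hdiv _ hq1
      have hx2 : |-q.2.2.1 / lam| < 1 := hdiv _ (by rwa [abs_neg])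
      set s' := Real.arccos (q.2.1.1 / lam) with hs'
      set s := Real.arccos (-q.2.2.1 / lam) with hs
      have hsm : s ∈ Ioo 0 Real.pi := arccos_mem_Ioo hx2
      have hsm' : s' ∈ Ioo 0 Real.pi := arccos_mem_Ioo hx1
      have e1 : q.2.1.1 = lam * Real.cos s' := by
        rw [hs', Real.cos_arccos (abs_lt.mp hx1).1.le (abs_lt.mp hx1).2.le,
          mul_div_cancel₀ _ hlam.ne']
      have e2 : q.2.2.1 = -lam * Real.cos s := by
        rw [hs, Real.cos_arccos (abs_lt.mp hx2).1.le (abs_lt.mp hx2).2.le, neg_mul,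
          mul_div_cancel₀ _ hlam.ne', neg_neg]
      have hs2 : Real.sqrt (lam ^ 2 - q.2.2.1 ^ 2) = lam * Real.sin s := by
        rw [e2, neg_mul, neg_sq]
        exact hsqrt s hsm
      have hs1 : Real.sqrt (lam ^ 2 - q.2.1.1 ^ 2) = lam * Real.sin s' := by
        rw [e1]
        exact hsqrt s' hsm'
      rw [hs1, hs2] at h2
      rw [hs1, hs2] at h3
      refine ⟨s, hsm, s', hsm', (htan s hsm s').mpr h2, e1, ?_, e2, ?_⟩
      · rw [e1] at h1
        linear_combination h1 - lam ^ 2 * Real.sin_sq_add_cos_sq s'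
      · rw [neg_mul]
        exact h3

end FlowPart

/-! ### Near the radial points -/

section RadialAngle

variable {e : ℝ}

lemma sq_eq_one_of_eq_or_eq_neg (he : e = 1 ∨ e = -1) : e ^ 2 = 1 := by
  rcases he with rfl | rfl <;> norm_num

/-- The angle in `[0, π]` with sine `x` whose cosine has the sign of `e = ± 1`. -/
def radialAngle (e x : ℝ) : ℝ := Real.pi / 2 * (1 - e) + e * Real.arcsin x

lemma radialAngle_one (x : ℝ) : radialAngle 1 x = Real.arcsin x := by
  simp only [radialAngle]
  ring

lemma radialAngle_neg_one (x : ℝ) : radialAngle (-1) x = Real.pi - Real.arcsin x := by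
  simp only [radialAngle]
  ring

lemma sin_radialAngle (he : e = 1 ∨ e = -1) {x : ℝ} (hx : x ∈ Icc (-1) 1) :
    Real.sin (radialAngle e x) = x := by
  rcases he with rfl | rfl
  · rw [radialAngle_one, Real.sin_arcsin hx.1 hx.2]
  · rw [radialAngle_neg_one, Real.sin_pi_sub, Real.sin_arcsin hx.1 hx.2]

lemma cos_radialAngle (he : e = 1 ∨ e = -1) (x : ℝ) :
    Real.cos (radialAngle e x) = e * Real.sqrt (1 - x ^ 2) := by
  rcases he with rfl | rfl
  · rw [radialAngle_one, Real.cos_arcsin, one_mul]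
  · rw [radialAngle_neg_one, Real.cos_pi_sub, Real.cos_arcsin, neg_one_mul]

lemma radialAngle_mem_Ioo (he : e = 1 ∨ e = -1) {x : ℝ} (hx : 0 < x) :
    radialAngle e x ∈ Ioo 0 Real.pi := by
  have h1 := Real.arcsin_pos.mpr hx
  have h2 := Real.arcsin_le_pi_div_two x
  have h3 := Real.pi_pos
  rcases he with rfl | rfl
  · rw [radialAngle_one]
    exact ⟨h1, by linarith⟩
  · rw [radialAngle_neg_one]
    exact ⟨by linarith, by linarith⟩

lemma radialAngle_sin (he : e = 1 ∨ e = -1) {s : ℝ} (hs : s ∈ Ioo 0 Real.pi)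
    (hcos : 0 < e * Real.cos s) : radialAngle e (Real.sin s) = s := by
  rcases he with rfl | rfl
  · have h1 : s < Real.pi / 2 := by
      by_contra! hle
      have := Real.cos_nonpos_of_pi_div_two_le_of_le hle (by linarith [hs.2, Real.pi_pos])
      linarith
    rw [radialAngle_one, Real.arcsin_sin (by linarith [hs.1, Real.pi_pos]) h1.le]
  · have h1 : Real.pi / 2 < s := by
      by_contra! hle
      have := Real.cos_nonneg_of_mem_Icc ⟨by linarith [hs.1, Real.pi_pos], hle⟩
      linarith
    rw [radialAngle_neg_one, ← Real.sin_pi_sub,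
      Real.arcsin_sin (by linarith [hs.2]) (by linarith)]
    ring

end RadialAngle

section Diagonal

variable {d : ℕ} {Y : Type*} [TopologicalSpace Y] [ChartedSpace (Model d) Y]
  [IsManifold (𝓡 d) ∞ Y] [T2Space Y] [CompactSpace Y]

set_option maxHeartbeats 800000 in
-- Put `r = |μ'|²/λ²`, which is `sin² s'` on the flow part, and `κ = cot θ`. The equations `τ' =
-- eλ√(1 - r)`, `τ'' = -eλ√(1 - κ²r)` and `μ'' = -κ exp(T H) μ'`, with `T = (e/λ)(κ a(κ²r) - a(r))`,
-- are smooth through `r = 0`. For `r > 0` they describe the flow part, and for `r = 0` the diagonal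
-- part.
lemma isSubmanifoldAt_of_mem_diagonalPart (h : SmoothMetric d Y) {lam : ℝ} (hlam : 0 < lam)
    {e : ℝ} (he : e = 1 ∨ e = -1) {p : PhaseSpace d Y} (hp : p ∈ diagonalPart (e * lam))
    (hθp : p.1 ∈ Ioo 0 (Real.pi / 2)) :
    IsSubmanifoldAt (phaseModel d) (2 * d + 2) (Leg h lam) p := by
  obtain ⟨a, ha, δ, hδ, hδ1, harcsin⟩ := exists_arcsin_eq_mul
  have hesq := sq_eq_one_of_eq_or_eq_neg he
  have hediag : ∀ q : PhaseSpace d Y, q ∈ diagonalPart (e * lam) → q ∈ Leg h lam := by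
    intro q hq
    rcases he with rfl | rfl
    · rw [one_mul] at hq
      exact Or.inl (Or.inr hq)
    · rw [neg_one_mul] at hq
      exact Or.inr hq
  have hsinpos : ∀ θ ∈ Ioo 0 (Real.pi / 2), 0 < Real.sin θ := fun θ hθ =>
    Real.sin_pos_of_pos_of_lt_pi hθ.1 (by linarith [hθ.2, hθ.1])
  have hcospos : ∀ θ ∈ Ioo 0 (Real.pi / 2), 0 < Real.cos θ := fun θ hθ =>
    Real.cos_pos_of_mem_Ioo ⟨by linarith [hθ.1, hθ.2], hθ.2⟩
  -- The signs select the end `0` or `π` for both angles. The last two bounds say `r < δ` and `κ²r <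
  -- δ`, the second cleared of its denominator, so that the expansion of `arcsin` holds for both
  -- sines.
  let V : Set (ℝ × ℝ × ℝ × ℝ) := {x | (x.1 ∈ Ioo 0 (Real.pi / 2) ∧ 0 < e * x.2.1 ∧
    e * x.2.2.2 < 0) ∧ x.2.2.1 / lam ^ 2 < δ ∧
      Real.cos x.1 ^ 2 * (x.2.2.1 / lam ^ 2) < δ * Real.sin x.1 ^ 2}
  have hV2 : ∀ x ∈ V, (Real.cos x.1 / Real.sin x.1) ^ 2 * (x.2.2.1 / lam ^ 2) < δ := by
    rintro x ⟨⟨hθ, -⟩, -, h2⟩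
    have := hsinpos _ hθ
    rw [div_pow, div_mul_eq_mul_div, div_lt_iff₀ (by positivity)]
    exact h2
  have hcot : ∀ x ∈ V, ContDiffAt ℝ ∞
      (fun x : ℝ × ℝ × ℝ × ℝ => Real.cos x.1 / Real.sin x.1) x := fun x hx =>
    ContDiffAt.div (by fun_prop) (by fun_prop) (hsinpos _ hx.1.1).ne'
  have hr : ∀ x : ℝ × ℝ × ℝ × ℝ, ContDiffAt ℝ ∞
      (fun x : ℝ × ℝ × ℝ × ℝ => x.2.2.1 / lam ^ 2) x := fun x => by fun_prop
  have hcotr : ∀ x ∈ V, ContDiffAt ℝ ∞ (fun x : ℝ × ℝ × ℝ × ℝ =>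
      (Real.cos x.1 / Real.sin x.1) ^ 2 * (x.2.2.1 / lam ^ 2)) x := fun x hx =>
    ((hcot x hx).pow 2).mul (hr x)
  refine isSubmanifoldAt_of_scalars (C := ℝ × ℝ) h ?_ (V := V) ?_ ?_ (hediag p hp)
    (G := fun x => (x.2.1 - e * lam * Real.sqrt (1 - x.2.2.1 / lam ^ 2), x.2.2.2 + e * lam *
      Real.sqrt (1 - (Real.cos x.1 / Real.sin x.1) ^ 2 * (x.2.2.1 / lam ^ 2))))
    (A := fun x => -(Real.cos x.1 / Real.sin x.1))
    (B := fun x => e / lam * (Real.cos x.1 / Real.sin x.1 *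
      a ((Real.cos x.1 / Real.sin x.1) ^ 2 * (x.2.2.1 / lam ^ 2)) - a (x.2.2.1 / lam ^ 2)))
    (D := fun _ => 1)
    ?_ ?_ ?_ (fun x _ => contDiffAt_const) ?_ ?_
  · simp only [Module.finrank_prod, Module.finrank_self]
    omega
  · have h1 : Continuous fun x : ℝ × ℝ × ℝ × ℝ => e * x.2.1 := by fun_prop
    have h2 : Continuous fun x : ℝ × ℝ × ℝ × ℝ => e * x.2.2.2 := by fun_prop
    have h3 : Continuous fun x : ℝ × ℝ × ℝ × ℝ => x.2.2.1 / lam ^ 2 := by fun_prop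
    have h4 : Continuous fun x : ℝ × ℝ × ℝ × ℝ =>
      Real.cos x.1 ^ 2 * (x.2.2.1 / lam ^ 2) := by fun_prop
    have h5 : Continuous fun x : ℝ × ℝ × ℝ × ℝ => δ * Real.sin x.1 ^ 2 := by fun_prop
    exact ((isOpen_Ioo.preimage continuous_fst).inter ((isOpen_lt continuous_const h1).inter
      (isOpen_lt h2 continuous_const))).inter
        ((isOpen_lt h3 continuous_const).inter (isOpen_lt h4 h5))
  · obtain ⟨-, y, h1, h2⟩ := hp
    have h3 := hsinpos _ hθp
    simp only [V, scalars, mem_ofPred_eq, h1, h2, dualNormSq_mk_zero, zero_div, mul_zero]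
    refine ⟨⟨hθp, ?_, ?_⟩, hδ, by positivity⟩
    · rw [← mul_assoc, ← sq, hesq, one_mul]
      exact hlam
    · rw [mul_neg, ← mul_assoc, ← sq, hesq, one_mul]
      exact neg_lt_zero.mpr hlam
  · intro x hx
    have h1 : 1 - x.2.2.1 / lam ^ 2 ≠ 0 := by linarith [hx.2.1]
    have h2 : 1 - (Real.cos x.1 / Real.sin x.1) ^ 2 * (x.2.2.1 / lam ^ 2) ≠ 0 := by
      linarith [hV2 x hx]
    exact ContDiffAt.prodMk
      (ContDiffAt.sub (by fun_prop) (contDiffAt_const.mul ((contDiffAt_const.sub (hr x)).sqrt h1)))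
      (ContDiffAt.add (by fun_prop)
        (contDiffAt_const.mul ((contDiffAt_const.sub (hcotr x hx)).sqrt h2)))
  · exact fun x hx => (hcot x hx).neg
  · exact fun x hx => contDiffAt_const.mul (((hcot x hx).mul
      (ha.contDiffAt.comp x (hcotr x hx))).sub (ha.contDiffAt.comp x (hr x)))
  · rintro ⟨θ, t, N, t'⟩ - ⟨b, c⟩
    -- The equations are solved for `τ'` and `τ''`, so these two move freely. No variation of
    -- `|μ'|²` is needed, which matters as it may vanish here.
    refine ⟨(0, b, 0, c), ?_⟩
    simp only [mul_zero, add_zero, one_pow, one_mul]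
    refine HasDerivAt.prodMk ?_ ?_
    · simpa using (((hasDerivAt_id (0 : ℝ)).mul_const b).const_add t).sub_const
        (e * lam * Real.sqrt (1 - N / lam ^ 2))
    · simpa using (((hasDerivAt_id (0 : ℝ)).mul_const c).const_add t').add_const
        (e * lam * Real.sqrt (1 - (Real.cos θ / Real.sin θ) ^ 2 * (N / lam ^ 2)))
  · intro q hq
    have hκr := hV2 _ hq
    obtain ⟨⟨hθ, hτ', hτ''⟩, hr1, -⟩ := hq
    simp only [scalars] at hθ hτ' hτ'' hr1 hκr ⊢
    have hsin := hsinpos _ hθ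
    have hcos := hcospos _ hθ
    set κ := Real.cos q.1 / Real.sin q.1 with hκ
    have hκpos : 0 < κ := div_pos hcos hsin
    set r := dualNormSq h q.2.1.2 / lam ^ 2 with hr
    have hts : ∀ s s' : ℝ, Real.sin q.1 * Real.sin s = Real.cos q.1 * Real.sin s' ↔
        Real.sin s = κ * Real.sin s' := fun s s' => by
      rw [hκ, div_mul_eq_mul_div, eq_div_iff hsin.ne', mul_comm (Real.sin s)]
    -- the two expressions for the right covector agree
    have key : ∀ s ∈ Ioo 0 Real.pi, ∀ s' ∈ Ioo 0 Real.pi, Real.sin s = κ * Real.sin s' →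
        r = Real.sin s' ^ 2 → radialAngle e (Real.sin s) = s →
        radialAngle e (Real.sin s') = s' →
        fibreSmul (-lam * Real.sin s)
          (geodesicFlow h (s - s') (fibreSmul (lam * Real.sin s')⁻¹ q.2.1.2)) =
        fibreSmul (-κ) (geodesicFlow h (e / lam * (κ * a (κ ^ 2 * r) - a r))
          (fibreSmul 1 q.2.1.2)) := by
      intro s hs s' hs' hss hrs has has'
      have hpos := Real.sin_pos_of_mem_Ioo hs'
      have hκs : κ ^ 2 * r = Real.sin s ^ 2 := by rw [hss, hrs]; ring
      have e1 : Real.arcsin (Real.sin s) = Real.sin s * a (κ ^ 2 * r) := by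
        rw [hκs]
        exact harcsin _ (hκs ▸ hκr)
      have e2 : Real.arcsin (Real.sin s') = Real.sin s' * a r := by
        rw [hrs]
        exact harcsin _ (hrs ▸ hr1)
      -- Both angles lie on the same branch, so the constant `π/2 (1 - e)` cancels. What remains is
      -- a multiple of `sin s'`, which absorbs the division by `λ sin s'` coming from homogeneity.
      have hdiff : s - s' = e * (Real.sin s' * (κ * a (κ ^ 2 * r) - a r)) := by
        rw [radialAngle, e1, hss] at has
        rw [radialAngle, e2] at has'
        linear_combination has' - has
      rw [geodesicFlow_fibreSmul h (inv_ne_zero (mul_pos hlam hpos).ne'), fibreSmul_fibreSmul,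
        fibreSmul_one]
      congr 1
      · rw [hss]
        field_simp
      · congr 1
        rw [hdiff]
        field_simp
    rw [Prod.mk_eq_zero, sub_eq_zero]
    constructor
    · have hdiag : ∀ c : ℝ, c ^ 2 = lam ^ 2 → q ∈ diagonalPart c →
          (q.2.1.1 = e * lam * Real.sqrt (1 - r) ∧
            q.2.2.1 + e * lam * Real.sqrt (1 - κ ^ 2 * r) = 0) ∧
          q.2.2.2 = fibreSmul (-κ) (geodesicFlow h (e / lam * (κ * a (κ ^ 2 * r) - a r))
            (fibreSmul 1 q.2.1.2)) := by
        rintro c hc ⟨-, y, h1, h2⟩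
        have hr0 : r = 0 := by rw [hr, h1, dualNormSq_mk_zero, zero_div]
        rw [h1] at hτ'
        simp only at hτ'
        -- The sign of `τ'` leaves only `c = eλ`: the other diagonal part does not meet this
        -- neighbourhood.
        have hec : e * c = lam := by
          refine (pow_left_inj₀ hτ'.le hlam.le two_ne_zero).mp ?_
          rw [mul_pow, hesq, one_mul, hc]
        have hce : c = e * lam := by
          rw [← hec, ← mul_assoc, ← sq, hesq, one_mul]
        rw [hr0, mul_zero, sub_zero, Real.sqrt_one, mul_one, h1, h2]
        refine ⟨⟨hce, by rw [← hce]; exact neg_add_cancel c⟩, ?_⟩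
        simp only [fibreSmul_mk_zero]
        rw [geodesicFlow_of_snd_eq_zero h rfl, fibreSmul_mk_zero]
      rintro ((hq | hq) | hq)
      · obtain ⟨s, hs, s', hs', hss, h1, h2, h3, h4⟩ := (mem_flowPart_iff hlam hθ).mp hq
        rw [hts] at hss
        have hrs : r = Real.sin s' ^ 2 := by
          rw [hr, h2]
          field_simp
        have hc' : 0 < e * Real.cos s' := by
          rw [h1] at hτ'
          refine pos_of_mul_pos_right (a := lam) ?_ hlam.le
          linarith
        have hc : 0 < e * Real.cos s := by
          rw [h3] at hτ''
          refine pos_of_mul_pos_right (a := lam) ?_ hlam.le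
          linarith
        have hsq : ∀ x : ℝ, 0 < e * Real.cos x →
            Real.sqrt (1 - Real.sin x ^ 2) = e * Real.cos x := fun x hx => by
          rw [← Real.sqrt_sq hx.le, mul_pow, hesq, one_mul, Real.cos_sq']
        have hκs : κ ^ 2 * r = Real.sin s ^ 2 := by rw [hss, hrs]; ring
        refine ⟨⟨?_, ?_⟩, h4.trans (key s hs s' hs' hss hrs (radialAngle_sin he hs hc)
          (radialAngle_sin he hs' hc'))⟩
        · rw [hrs, hsq s' hc', h1]
          linear_combination (-lam * Real.cos s') * hesq
        · rw [hκs, hsq s hc, h3]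
          linear_combination (lam * Real.cos s) * hesq
      · exact hdiag lam rfl hq
      · exact hdiag (-lam) (neg_sq lam) hq
    · rintro ⟨⟨h1, h2⟩, h3⟩
      by_cases hz : dualNormSq h q.2.1.2 = 0
      · have hpz := eq_mk_zero_of_dualNormSq_eq_zero hz
        have hr0 : r = 0 := by rw [hr, hz, zero_div]
        rw [hr0, sub_zero, Real.sqrt_one, mul_one] at h1
        rw [hr0, mul_zero, sub_zero, Real.sqrt_one, mul_one] at h2
        refine hediag q ⟨Ioo_subset_Icc_self hθ, q.2.1.2.proj, Prod.ext h1 hpz,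
          Prod.ext (eq_neg_of_add_eq_zero_left h2) ?_⟩
        rw [h3, hpz, fibreSmul_mk_zero, geodesicFlow_of_snd_eq_zero h rfl, fibreSmul_mk_zero]
      · have hNpos : 0 < dualNormSq h q.2.1.2 := (dualNormSq_nonneg h _).lt_of_ne' hz
        have hrpos : 0 < r := by positivity
        have hx' : 0 < Real.sqrt r := Real.sqrt_pos.mpr hrpos
        have hx : 0 < κ * Real.sqrt r := mul_pos hκpos hx'
        have hsq : Real.sqrt r ^ 2 = r := Real.sq_sqrt hrpos.le
        have hsqκ : (κ * Real.sqrt r) ^ 2 = κ ^ 2 * r := by rw [mul_pow, hsq]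
        -- The angles are recovered from `sin s' = √r` and `sin s = κ√r`, on the branch given by
        -- `e`.
        have hs' := sin_radialAngle he (x := Real.sqrt r)
          ⟨by linarith, le_of_abs_le (abs_le_of_sq_le_sq (by rw [hsq]; linarith) zero_le_one)⟩
        have hs := sin_radialAngle he (x := κ * Real.sqrt r)
          ⟨by linarith, le_of_abs_le (abs_le_of_sq_le_sq (by rw [hsqκ]; linarith) zero_le_one)⟩
        have hss : Real.sin (radialAngle e (κ * Real.sqrt r)) =
            κ * Real.sin (radialAngle e (Real.sqrt r)) := by rw [hs, hs']
        have hrs : r = Real.sin (radialAngle e (Real.sqrt r)) ^ 2 := by rw [hs', hsq]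
        have hm := radialAngle_mem_Ioo he hx
        have hm' := radialAngle_mem_Ioo he hx'
        refine Or.inl (Or.inl ((mem_flowPart_iff hlam hθ).mpr ⟨_, hm, _, hm', (hts _ _).mpr hss,
          ?_, ?_, ?_, h3.trans (key _ hm _ hm' hss hrs (by rw [hs]) (by rw [hs'])).symm⟩))
        · rw [cos_radialAngle he, hsq, h1]
          ring
        · rw [mul_pow, ← hrs, hr, mul_div_cancel₀ _ (pow_ne_zero 2 hlam.ne')]
        · rw [cos_radialAngle he, hsqκ]
          linear_combination h2

end Diagonal

/-! ### The differential of `τ` on `L` -/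

section Tau

variable {d : ℕ} {Y : Type*} [TopologicalSpace Y] [ChartedSpace (Model d) Y]
  [IsManifold (𝓡 d) ∞ Y]

lemma contMDiff_tau : ContMDiff (phaseModel d) 𝓘(ℝ, ℝ) ∞ (tau (d := d) (Y := Y)) := by
  have h1 : ContMDiff (phaseModel d) 𝓘(ℝ, ℝ) ∞ (fun q : PhaseSpace d Y => q.1) := contMDiff_fst
  have h2 : ContMDiff (phaseModel d) 𝓘(ℝ, ℝ) ∞ (fun q : PhaseSpace d Y => q.2.1.1) :=
    contMDiff_fst.comp (contMDiff_fst.comp contMDiff_snd)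
  have h3 : ContMDiff (phaseModel d) 𝓘(ℝ, ℝ) ∞ (fun q : PhaseSpace d Y => q.2.2.1) :=
    contMDiff_fst.comp (contMDiff_snd.comp contMDiff_snd)
  have h4 : ContDiff ℝ ∞ fun x : ℝ × ℝ × ℝ => x.2.1 * Real.cos x.1 + x.2.2 * Real.sin x.1 := by
    fun_prop
  exact h4.contMDiff.comp (h1.prodMk_space (h2.prodMk_space h3))

lemma exists_tangentVector_of_curve {S : Set (PhaseSpace d Y)} {p : PhaseSpace d Y}
    {β : ℝ → PhaseSpace d Y} (hβ : ContMDiffAt 𝓘(ℝ, ℝ) (phaseModel d) ∞ β 0)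
    (hS : ∀ᶠ t in 𝓝 0, β t ∈ S) (h0 : β 0 = p) {D : ℝ}
    (hD : HasDerivAt (fun t => tau (β t)) D 0) (hD0 : D ≠ 0) :
    ∃ v ∈ tangentVectors (phaseModel d) S p,
      mfderiv (phaseModel d) 𝓘(ℝ, ℝ) (tau (d := d) (Y := Y)) p v ≠ 0 := by
  subst h0
  refine ⟨mfderiv 𝓘(ℝ, ℝ) (phaseModel d) β 0 (1 : ℝ), ⟨β, hβ, hS, rfl⟩, fun hz => hD0 ?_⟩
  have h1 := (contMDiff_tau.contMDiffAt.mdifferentiableAt (by simp)).hasMFDerivAt.comp 0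
    (hβ.mdifferentiableAt (by simp)).hasMFDerivAt
  have h2 : ∃ L : ℝ →L[ℝ] ℝ, HasFDerivAt (fun t => tau (β t)) L 0 ∧ L 1 = 0 :=
    ⟨_, hasMFDerivAt_iff_hasFDerivAt.mp h1, hz⟩
  obtain ⟨L, hL, hL1⟩ := h2
  exact hD.unique (hL1 ▸ hL.hasDerivAt)

/-- Moving `θ` alone stays in the set. There `τ = c(cos θ - sin θ)`, with derivative `-c√2` at
`π/4`. -/
lemma exists_tangentVector_of_mem_diagonalPart {S : Set (PhaseSpace d Y)} {c : ℝ} (hc : c ≠ 0)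
    (hS : diagonalPart c ⊆ S) {p : PhaseSpace d Y} (hp : p ∈ diagonalPart c)
    (hθ : p.1 = Real.pi / 4) :
    ∃ v ∈ tangentVectors (phaseModel d) S p,
      mfderiv (phaseModel d) 𝓘(ℝ, ℝ) (tau (d := d) (Y := Y)) p v ≠ 0 := by
  obtain ⟨-, y, h1, h2⟩ := hp
  have hlin : ContDiff ℝ ∞ fun t : ℝ => Real.pi / 4 + t := by fun_prop
  refine exists_tangentVector_of_curve (β := fun t => (Real.pi / 4 + t, p.2))
    (hlin.contMDiff.contMDiffAt.prodMk contMDiffAt_const) ?_ ?_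
    (D := c * -Real.sin (Real.pi / 4) + -c * Real.cos (Real.pi / 4)) ?_ ?_
  · have hmem : ∀ᶠ t in 𝓝 (0 : ℝ), Real.pi / 4 + t ∈ Ioo 0 (Real.pi / 2) :=
      hlin.continuous.continuousAt.eventually_mem (Ioo_mem_nhds
        (by rw [add_zero]; positivity) (by rw [add_zero]; linarith [Real.pi_pos]))
    filter_upwards [hmem] with t ht
    exact hS ⟨Ioo_subset_Icc_self ht, y, h1, h2⟩
  · exact Prod.ext (by rw [add_zero, hθ]) rfl
  · simp only [tau, h1, h2]
    have e1 : HasDerivAt (fun t : ℝ => Real.pi / 4 + t) 1 0 := (hasDerivAt_id 0).const_add _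
    have e2 := (e1.cos.const_mul c).add (e1.sin.const_mul (-c))
    exact e2.congr_deriv (by simp only [add_zero, mul_one])
  · rw [Real.cos_pi_div_four, Real.sin_pi_div_four]
    have : c * -(Real.sqrt 2 / 2) + -c * (Real.sqrt 2 / 2) = -(c * Real.sqrt 2) := by ring
    rw [this]
    exact neg_ne_zero.mpr (mul_ne_zero hc (by positivity))

variable [T2Space Y] [CompactSpace Y]

/-- The bicharacteristic and `s'` are fixed while `s` varies, with `θ = arctan(sin s'/sin s)`. At `s
= s'` one has `dθ/ds = -cot(s')/2`, and `τ` has derivative `λ/(√2 sin s')`, which is positive. -/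
lemma exists_tangentVector_of_mem_flowPart (h : SmoothMetric d Y) {lam : ℝ} (hlam : 0 < lam)
    {p : PhaseSpace d Y} (hp : p ∈ flowPart h lam) (hθ : p.1 = Real.pi / 4)
    (hτ : p.2.2.1 = -p.2.1.1) :
    ∃ v ∈ tangentVectors (phaseModel d) (Leg h lam) p,
      mfderiv (phaseModel d) 𝓘(ℝ, ℝ) (tau (d := d) (Y := Y)) p v ≠ 0 := by
  obtain ⟨-, γ, s, s', hγ, h0, hs, hs', hpos, hts, h1, h2⟩ := hp
  have hss : s' = s := by
    refine Real.injOn_cos hs' hs ?_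
    rw [h1, h2] at hτ
    refine mul_left_cancel₀ hlam.ne' ?_
    simp only at hτ
    linarith
  subst hss
  have hsin : 0 < Real.sin s' := by
    refine (Real.sin_nonneg_of_mem_Icc hs).lt_of_ne' fun hz => ?_
    simp [hz] at hpos
  have hsI : s' ∈ Ioo 0 Real.pi :=
    ⟨hs.1.lt_of_ne (by rintro rfl; simp at hsin), hs.2.lt_of_ne (by rintro rfl; simp at hsin)⟩
  have hshift : ContDiff ℝ ∞ fun t : ℝ => s' + t := by fun_prop
  have hquot : ContDiffAt ℝ ∞ (fun t : ℝ => Real.sin s' / Real.sin (s' + t)) 0 :=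
    ContDiffAt.div (by fun_prop) (by fun_prop) (by rw [add_zero]; exact hsin.ne')
  have hγs : ContMDiff 𝓘(ℝ, ℝ) (cotModel d) ∞ fun t : ℝ => γ (s' + t) := by
    have : (fun t : ℝ => γ (s' + t)) = fun t => geodesicFlow h t (γ s') := by
      funext t
      rw [add_comm, hγ.eq_geodesicFlow]
    rw [this]
    exact (contMDiff_geodesicFlow h).comp (contMDiff_id.prodMk contMDiff_const)
  have hcosd : ContDiff ℝ ∞ fun t : ℝ => -lam * Real.cos (s' + t) := by fun_prop
  have hsind : ContDiff ℝ ∞ fun t : ℝ => -lam * Real.sin (s' + t) := by fun_prop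
  refine exists_tangentVector_of_curve
    (β := fun t => (Real.arctan (Real.sin s' / Real.sin (s' + t)), p.2.1,
      (-lam * Real.cos (s' + t), fibreSmul (-lam * Real.sin (s' + t)) (γ (s' + t)))))
    ?_ ?_ ?_ (D := lam * (Real.sqrt 2 / 2) / Real.sin s') ?_ ?_
  · exact (Real.contDiff_arctan.contDiffAt.comp (0 : ℝ) hquot).contMDiffAt.prodMk
      (contMDiffAt_const.prodMk (hcosd.contMDiff.contMDiffAt.prodMk
        (contMDiff_fibreSmul.comp (hsind.contMDiff.prodMk hγs)).contMDiffAt))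
  · have hmem : ∀ᶠ t in 𝓝 (0 : ℝ), s' + t ∈ Ioo 0 Real.pi :=
      hshift.continuous.continuousAt.eventually_mem (Ioo_mem_nhds
        (by rw [add_zero]; exact hsI.1) (by rw [add_zero]; exact hsI.2))
    filter_upwards [hmem] with t ht
    have hsint := Real.sin_pos_of_mem_Ioo ht
    refine Or.inl (Or.inl ⟨⟨(Real.arctan_pos.mpr (by positivity)).le,
      (Real.arctan_lt_pi_div_two _).le⟩, γ, s' + t, s', hγ, h0, Ioo_subset_Icc_self ht, hs',
      by positivity, ?_, h1, rfl⟩)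
    have hc := Real.cos_arctan_pos (Real.sin s' / Real.sin (s' + t))
    have htan := Real.tan_arctan (Real.sin s' / Real.sin (s' + t))
    rw [Real.tan_eq_sin_div_cos, div_eq_div_iff hc.ne' hsint.ne'] at htan
    simp only
    linarith
  · refine Prod.ext ?_ (Prod.ext rfl ?_)
    · simp only [add_zero, div_self hsin.ne', Real.arctan_one, hθ]
    · simp only [add_zero, h2]
  · simp only [tau, h1]
    have e1 : HasDerivAt (fun t : ℝ => s' + t) 1 0 := (hasDerivAt_id 0).const_add _
    have e2 : HasDerivAt (fun t : ℝ => Real.sin (s' + t)) (Real.cos s') 0 := by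
      simpa only [add_zero, mul_one] using e1.sin
    have e3 : HasDerivAt (fun t : ℝ => Real.cos (s' + t)) (-Real.sin s') 0 := by
      simpa only [add_zero, mul_one] using e1.cos
    have e4 : HasDerivAt (fun t : ℝ => Real.sin s' / Real.sin (s' + t))
        (-(Real.cos s' / Real.sin s')) 0 := by
      refine ((hasDerivAt_const (0 : ℝ) (Real.sin s')).div e2
        (by rw [add_zero]; exact hsin.ne')).congr_deriv ?_
      rw [add_zero]
      field_simp
      ring
    have e5 : HasDerivAt (fun t : ℝ => Real.arctan (Real.sin s' / Real.sin (s' + t)))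
        (-(Real.cos s' / Real.sin s') / 2) 0 := by
      refine e4.arctan.congr_deriv ?_
      rw [add_zero, div_self hsin.ne']
      ring
    refine ((e5.cos.const_mul (lam * Real.cos s')).add
      ((e3.const_mul (-lam)).mul e5.sin)).congr_deriv ?_
    simp only [add_zero, div_self hsin.ne', Real.arctan_one, Real.cos_pi_div_four,
      Real.sin_pi_div_four]
    have := Real.sin_sq_add_cos_sq s'
    field_simp
    linear_combination 2 * this
  · positivity

end Tau

end ScatteringResolvent

end

/-! ### The proposition. -/

open ScatteringResolvent in
theorem proposition8p1 {d : ℕ} {Y : Type*} [TopologicalSpace Y] [T2Space Y] [CompactSpace Y]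
    [ChartedSpace (Model d) Y] [IsManifold (𝓡 d) ∞ Y]
    (h : SmoothMetric d Y) (lam : ℝ) (hlam : 0 < lam) :
    -- over the interior of the front face, `L` is a smooth submanifold of dimension `2 d + 1`
    (∀ p ∈ Leg h lam, p.1 ∈ Ioo 0 (Real.pi / 2) →
      IsSubmanifoldAt (phaseModel d) (2 * d + 2) (Leg h lam) p) ∧
    -- the intersection lies over the interior, and is a submanifold of codimension one in `L`
    (∀ p ∈ Leg h lam ∩ scConormalDiag d Y, p.1 ∈ Ioo 0 (Real.pi / 2) ∧
      IsSubmanifoldAt (phaseModel d) (2 * d + 2 + 1) (Leg h lam ∩ scConormalDiag d Y) p) ∧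
    -- the differential of `τ` restricted to `L` does not vanish where `τ = 0`
    (∀ p ∈ Leg h lam, tau p = 0 →
      ∃ v ∈ tangentVectors (phaseModel d) (Leg h lam) p,
        mfderiv (phaseModel d) 𝓘(ℝ, ℝ) (tau (d := d) (Y := Y)) p v ≠ 0) ∧
    Leg h lam ∩ {p | tau p = 0} = Leg h lam ∩ scConormalDiag d Y ∧
    -- the intersection divides `L` into `{τ < 0}` and `{τ > 0}`
    Leg h lam \ scConormalDiag d Y =
      (Leg h lam ∩ {p | tau p < 0}) ∪ (Leg h lam ∩ {p | 0 < tau p}) ∧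
    Disjoint (Leg h lam ∩ {p | tau p < 0}) (Leg h lam ∩ {p | 0 < tau p}) := by
  have htau := Leg_inter_tau_eq h hlam
  refine ⟨?_, ?_, ?_, htau, ?_, ?_⟩
  · rintro p ((hp | hp) | hp) hθ
    · exact isSubmanifoldAt_of_mem_flowPart h hlam hp hθ
    · exact isSubmanifoldAt_of_mem_diagonalPart h hlam (Or.inl rfl) (by rwa [one_mul]) hθ
    · exact isSubmanifoldAt_of_mem_diagonalPart h hlam (Or.inr rfl) (by rwa [neg_one_mul]) hθ
  · intro p hp
    refine ⟨?_, isSubmanifoldAt_inter_conormal h hlam hp⟩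
    rw [(mem_scConormalDiag_iff.mp hp.2).1]
    exact ⟨by positivity, by linarith [Real.pi_pos]⟩
  · intro p hp hτ
    obtain ⟨⟨hθ, hneg, -⟩, -⟩ := (mem_Leg_and_tau_eq_zero_iff hlam).mp ⟨hp, hτ⟩
    rcases hp with (hp | hp) | hp
    · exact exists_tangentVector_of_mem_flowPart h hlam hp hθ hneg
    · exact exists_tangentVector_of_mem_diagonalPart hlam.ne'
        (fun q hq => Or.inl (Or.inr hq)) hp hθ
    · exact exists_tangentVector_of_mem_diagonalPart (neg_ne_zero.mpr hlam.ne')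
        (fun q hq => Or.inr hq) hp hθ
  · ext q
    have hiff : q ∈ Leg h lam → (q ∈ scConormalDiag d Y ↔ tau q = 0) := fun hq =>
      ⟨fun hc => (htau.ge ⟨hq, hc⟩).2, fun hz => (htau.le ⟨hq, hz⟩).2⟩
    constructor
    · rintro ⟨hq, hc⟩
      rcases lt_or_gt_of_ne (mt (hiff hq).mpr hc) with hlt | hgt
      · exact Or.inl ⟨hq, hlt⟩
      · exact Or.inr ⟨hq, hgt⟩
    · rintro (⟨hq, hlt⟩ | ⟨hq, hgt⟩)
      · exact ⟨hq, fun hc => hlt.ne ((hiff hq).mp hc)⟩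
      · exact ⟨hq, fun hc => hgt.ne' ((hiff hq).mp hc)⟩
  · exact Set.disjoint_left.mpr fun q hneg hpos =>
      lt_asymm (show tau q < 0 from hneg.2) hpos.2
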